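/- **Conventions.** All sets live in the Euclidean plane $\mathbb{R}^2$. A *collection of $m$ convex pseudo-disks* is a family $D_1,\dots,D_m$ of closed convex sets with nonempty interior, possibly unbounded, such that for all $i,j$ the set $D_i\setminus D_j$ is connected (or empty). A *triangle* is either a nondegenerate closed triangle, or an *unbounded triangle*: a closed convex region whose boundary consists of one bounded segment $pq$ and two rays, one from $p$ and one from $q$, with angles strictly between $0$ and $\pi$ at $p$ and $q$; the segment may degenerate to a single point, in which case the region is a wedge of angle strictly between $0$ and $\pi$. A *cap* of $D$ is a set with nonempty interior that is the intersection of $D$ with a closed halfplane. Sets are *openly disjoint* if their interiors are disjoint. A *triangulation of the plane on a finite point set $V$* is a finite set of (bounded or unbounded) triangles that covers the plane, whose set of vertices is exactly $V$, and in which any two distinct triangles are openly disjoint and meet in a common (possibly empty) face of both. **Theorem.** There is an absolute constant $K$ such that the following holds for every collection $D_1,\dots,D_m$ of $m$ convex pseudo-disks. (a) If $m\ge 3$ and $\bigcup_i D_i=\mathbb{R}^2$, then there are a set $V$ of at most $Km$ points and a triangulation $T$ of the plane on $V$, with at most $Km$ triangles, such that every triangle of $T$ is contained in some $D_i$. (b)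 If $\bigcup_i D_i\ne\mathbb{R}^2$, then $\bigcup_i D_i$ is the union of at most $Km$ pairwise openly disjoint sets, each of which is a (bounded or unbounded) triangle contained in some $D_i$ or a cap of some $D_i$. -/

import Mathlib

open Set
open scoped RealInnerProductSpace

/-- The Euclidean plane. -/
abbrev Plane : Type := EuclideanSpace ℝ (Fin 2)

/-- An indexed collection of convex pseudo-disks in the plane: closed convex regions with nonempty
interior, possibly unbounded, such that `C \ D` and `D \ C` are connected (possibly empty) for any
two members `C` and `D`. -/
structure IsConvexPseudoDisks {m : ℕ} (D : Fin m → Set Plane) : Prop where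
  isClosed : ∀ i, IsClosed (D i)
  convex : ∀ i, Convex ℝ (D i)
  interior_nonempty : ∀ i, (interior (D i)).Nonempty
  isPreconnected_diff : ∀ i j, IsPreconnected (D i \ D j)

/-- A (bounded, nondegenerate, closed) triangle. -/
def IsBoundedTriangle (Δ : Set Plane) : Prop :=
  ∃ a b c : Plane, AffineIndependent ℝ ![a, b, c] ∧ Δ = convexHull ℝ {a, b, c}

/-- An unbounded triangle whose boundary consists of the segment from `p` to `p + e`, a ray from `p`
in direction `u`, and a ray from `p + e` in direction `v`. The condition on `v` says that the two
rays leave the line of the segment to the same side and do not approach each other (they may be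
parallel), so that the region is convex, with angles strictly between `0` and `π` at `p` and
`p + e`. -/
def IsUnboundedTriangle (Δ : Set Plane) : Prop :=
  ∃ p e u v : Plane, LinearIndependent ℝ ![e, u] ∧
    (∃ a b : ℝ, 0 ≤ a ∧ 0 < b ∧ v = a • e + b • u) ∧
    Δ = {x | ∃ r s t : ℝ, 0 ≤ r ∧ r ≤ 1 ∧ 0 ≤ s ∧ 0 ≤ t ∧ x = p + r • e + s • u + t • v}

/-- A wedge: an unbounded triangle whose bounded edge degenerates to a point `p`. -/
def IsWedge (Δ : Set Plane) : Prop :=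
  ∃ p u v : Plane, LinearIndependent ℝ ![u, v] ∧
    Δ = {x | ∃ s t : ℝ, 0 ≤ s ∧ 0 ≤ t ∧ x = p + s • u + t • v}

/-- A triangle, bounded or unbounded. Its vertices are its extreme points. -/
def IsTriangle (Δ : Set Plane) : Prop :=
  IsBoundedTriangle Δ ∨ IsUnboundedTriangle Δ ∨ IsWedge Δ

/-- `T` is a triangulation of the entire plane with vertex set `V`: a finite set of (bounded or
unbounded) triangles that cover the plane, whose vertices are exactly the points of `V`, and any two
of which have disjoint interiors and meet in a common (possibly empty) face of both, that is, in an
extreme subset. -/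
structure IsPlaneTriangulation (V : Finset Plane) (T : Finset (Set Plane)) : Prop where
  isTriangle : ∀ Δ ∈ T, IsTriangle Δ
  vertices : (V : Set Plane) = ⋃ Δ ∈ T, Δ.extremePoints ℝ
  disjoint_interior : (T : Set (Set Plane)).PairwiseDisjoint interior
  face_to_face : ∀ Δ ∈ T, ∀ Δ' ∈ T, Δ ≠ Δ' →
    IsExtreme ℝ Δ (Δ ∩ Δ') ∧ IsExtreme ℝ Δ' (Δ ∩ Δ')
  covers : (⋃ Δ ∈ T, Δ) = univ

/-- A cap of `D`: a region (with nonempty interior) formed by the intersection of `D` with a closed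
halfplane. -/
def IsCap (D A : Set Plane) : Prop :=
  (interior A).Nonempty ∧ ∃ (n : Plane) (c : ℝ), n ≠ 0 ∧ A = D ∩ {x | c ≤ ⟪n, x⟫}

/-- `P` is a confined triangulation of the collection `D`: a decomposition of the union of `D` into
regions with pairwise disjoint interiors, each of which is a (bounded or unbounded) triangle
contained in some member of `D`, or a cap of some member of `D`. -/
structure IsConfinedTriangulation {m : ℕ} (D : Fin m → Set Plane) (P : Finset (Set Plane)) :
    Prop where
  isTriangle_or_isCap : ∀ A ∈ P, IsTriangle A ∨ ∃ i, IsCap (D i) A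
  confined : ∀ A ∈ P, ∃ i, A ⊆ D i
  disjoint_interior : (P : Set (Set Plane)).PairwiseDisjoint interior
  covers : (⋃ A ∈ P, A) = ⋃ i, D i

/-! The pseudo-disks are shrunk to a packing of convex sets with the same union; the packing has
linearly many contacts, and each of its members is cut into sectors by rays from an interior point.

Shrinking. Connectedness of `A \ B` is replaced by `DiffsNoncrossing`: no segment spanned by `A \ B`
meets one spanned by `B \ A`. This involves four points at a time, so it survives intersections of
chains, and Zorn's lemma gives a minimal family of closed convex sets inside the given ones that has
the same union and noncrossing differences. In a minimal family no cap of a member is covered by the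
other members (`Minimal.not_cap_subset`): among the members with a covered cap in a given halfplane,
one that is smallest far out in that direction could be truncated, and
`DiffsNoncrossing.of_not_truncated` shows that the truncation creates no crossing. By separation,
each member `C i` then lies in the closed convex hull of `C i \ C j`. The hulls of `C i \ C j` and
`C j \ C i` are disjoint (`DiffsNoncrossing.disjoint_convexHull`), hence so are the interiors of `C
i` and `C j`.

Counting. Call two members in contact if they share more than one point. A line in one of the two
axis directions through the middle of a contact passes through the interiors of both members, and
they are neighbours on it. A sweep produces at most three neighbour pairs per member, each charged
to the start or the end of a member (`card_sweep_adjacent_le`), so there are linearly many contacts.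

Cutting. From an interior point of each member, rays are drawn to the ends of its contacts, in the
recession directions of unbounded contacts, and along the four axes; the points where the axis rays
hit a contact are used from both of its sides. A sector that meets a contact in its interior is
bounded by that contact alone, so it is a triangle. In any other sector the member coincides with
each larger convex body inside the union: with the whole plane in (a), which makes the sector a
wedge, and with `D i` in (b), which makes it a triangle, possibly together with a cap of `D i`.
Since the two sides of a contact are subdivided at the same points, the triangles in (a) meet face
to face. -/

/-! ### The cross product on the plane -/

/-- The cross product (signed area) of two vectors of the plane. -/
def planeCross (x y : Plane) : ℝ := x 0 * y 1 - x 1 * y 0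

theorem planeCross_add_right (x y z : Plane) :
    planeCross x (y + z) = planeCross x y + planeCross x z := by
  simp only [planeCross, PiLp.add_apply]; ring

theorem planeCross_add_left (x y z : Plane) :
    planeCross (x + y) z = planeCross x z + planeCross y z := by
  simp only [planeCross, PiLp.add_apply]; ring

theorem planeCross_sub_right (x y z : Plane) :
    planeCross x (y - z) = planeCross x y - planeCross x z := by
  simp only [planeCross, PiLp.sub_apply]; ring

theorem planeCross_smul_right (x y : Plane) (t : ℝ) :
    planeCross x (t • y) = t * planeCross x y := by
  simp only [planeCross, PiLp.smul_apply, smul_eq_mul]; ring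

theorem planeCross_smul_left (x y : Plane) (t : ℝ) : planeCross (t • x) y = t * planeCross x y := by
  simp only [planeCross, PiLp.smul_apply, smul_eq_mul]; ring

@[simp] theorem planeCross_self (x : Plane) : planeCross x x = 0 := by
  simp only [planeCross]; ring

@[simp] theorem planeCross_zero_right (x : Plane) : planeCross x 0 = 0 := by simp [planeCross]

@[simp] theorem planeCross_zero_left (x : Plane) : planeCross 0 x = 0 := by simp [planeCross]

theorem planeCross_swap (x y : Plane) : planeCross x y = -planeCross y x := by
  simp only [planeCross]; ring

theorem continuous_planeCross_right (x : Plane) : Continuous fun y => planeCross x y := by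
  unfold planeCross; fun_prop

theorem plane_ext {x y : Plane} (h0 : x 0 = y 0) (h1 : x 1 = y 1) : x = y := by
  ext i; fin_cases i <;> assumption

theorem plane_ne_zero {x : Plane} (h : x ≠ 0) : x 0 ≠ 0 ∨ x 1 ≠ 0 := by
  by_contra! hx
  exact h (plane_ext (by simpa using hx.1) (by simpa using hx.2))

theorem exists_smul_of_planeCross_eq_zero {w x : Plane} (hw : w ≠ 0) (h : planeCross w x = 0) :
    ∃ t : ℝ, x = t • w := by
  unfold planeCross at h
  rcases plane_ne_zero hw with h0 | h0
  · refine ⟨x 0 / w 0, plane_ext ?_ ?_⟩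
    · simp [h0]
    · simp only [PiLp.smul_apply, smul_eq_mul]; field_simp; linarith
  · refine ⟨x 1 / w 1, plane_ext ?_ ?_⟩
    · simp only [PiLp.smul_apply, smul_eq_mul]; field_simp; linarith
    · simp [h0]

theorem eq_combo_of_planeCross {a b : Plane} (h : planeCross a b ≠ 0) (x : Plane) :
    x = (planeCross x b / planeCross a b) • a + (planeCross a x / planeCross a b) • b := by
  have key0 : x 0 * planeCross a b = planeCross x b * a 0 + planeCross a x * b 0 := by unfold planeCross; ring
  have key1 : x 1 * planeCross a b = planeCross x b * a 1 + planeCross a x * b 1 := by unfold planeCross; ring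
  apply plane_ext <;> simp only [PiLp.add_apply, PiLp.smul_apply, smul_eq_mul] <;>
    field_simp <;> linarith

theorem planeCross_combo_left (a b : Plane) (s t : ℝ) :
    planeCross a (s • a + t • b) = t * planeCross a b := by
  rw [planeCross_add_right, planeCross_smul_right, planeCross_smul_right, planeCross_self]; ring

theorem planeCross_combo_right (a b : Plane) (s t : ℝ) :
    planeCross (s • a + t • b) b = s * planeCross a b := by
  rw [planeCross_add_left, planeCross_smul_left, planeCross_smul_left, planeCross_self]; ring

theorem exists_planeCross_ne_zero {w : Plane} (hw : w ≠ 0) : ∃ u, planeCross w u ≠ 0 := by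
  by_contra! h
  rcases plane_ne_zero hw with h0 | h0
  · have := h (EuclideanSpace.single 1 1); simp [planeCross] at this; exact h0 this
  · have := h (EuclideanSpace.single 0 1); simp [planeCross] at this; exact h0 this

/-! ### Segments and lines -/

/-- The line through `r` and `s` meets `A` in an interval that contains `z` but neither `r` nor `s`,
so this interval cannot extend beyond the two points. All the crossing arguments below rest on this.
-/
theorem Convex.mem_segment_of_planeCross_eq_zero {A : Set Plane} (hA : Convex ℝ A) {r s z e : Plane}
    (hr : r ∉ A) (hs : s ∉ A) (hz : z ∈ A) (hzrs : z ∈ segment ℝ r s) (he : e ∈ A)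
    (h : planeCross (s - r) (e - r) = 0) : e ∈ segment ℝ r s := by
  have hrs : s - r ≠ 0 := by
    intro h0
    rw [sub_eq_zero] at h0
    subst h0
    rw [segment_same] at hzrs
    exact hr (hzrs ▸ hz)
  obtain ⟨t, ht⟩ := exists_smul_of_planeCross_eq_zero hrs h
  have he' : e = AffineMap.lineMap r s t := by
    rw [AffineMap.lineMap_apply, vsub_eq_sub, vadd_eq_add, ← ht]; abel
  rw [segment_eq_image_lineMap] at hzrs ⊢
  obtain ⟨u, hu, rfl⟩ := hzrs
  have hS := (hA.affine_preimage (AffineMap.lineMap (k := ℝ) r s)).ordConnected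
  refine ⟨t, ⟨?_, ?_⟩, he'.symm⟩
  · by_contra! ht0
    have := hS.out (x := t) (y := u) (by rw [mem_preimage, ← he']; exact he) hz
      (show (0 : ℝ) ∈ Icc t u from ⟨ht0.le, hu.1⟩)
    exact hr (by simpa using this)
  · by_contra! ht0
    have := hS.out (x := u) (y := t) hz (by rw [mem_preimage, ← he']; exact he)
      (show (1 : ℝ) ∈ Icc u t from ⟨hu.2, ht0.le⟩)
    exact hs (by simpa using this)

/-- A segment whose ends lie strictly on different sides of a line crosses this line. -/
theorem exists_mem_openSegment_planeCross_eq_zero (w r : Plane) {x y : Plane}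
    (h : planeCross w (x - r) * planeCross w (y - r) < 0) :
    ∃ e ∈ openSegment ℝ x y, planeCross w (e - r) = 0 := by
  set a := planeCross w (x - r) with ha
  set b := planeCross w (y - r) with hb
  have hab : a - b ≠ 0 := by
    intro h0
    have : a = b := by linarith
    rw [this] at h; nlinarith [mul_self_nonneg b]
  have h01 : 0 < a / (a - b) ∧ a / (a - b) < 1 := by
    rcases lt_or_gt_of_ne hab with h' | h'
    · have ha' : a < 0 := by
        by_contra! h0
        nlinarith
      have hb' : 0 < b := by nlinarith
      constructor
      · exact div_pos_of_neg_of_neg ha' h'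
      · rw [div_lt_one_of_neg h']; linarith
    · have ha' : 0 < a := by
        by_contra! h0
        nlinarith
      have hb' : b < 0 := by nlinarith
      constructor
      · exact div_pos ha' h'
      · rw [div_lt_one h']; linarith
  refine ⟨AffineMap.lineMap x y (a / (a - b)), ?_, ?_⟩
  · rw [openSegment_eq_image_lineMap]
    exact ⟨_, h01, rfl⟩
  · rw [AffineMap.lineMap_apply, vsub_eq_sub, vadd_eq_add]
    have : (a / (a - b)) • (y - x) + x - r
        = (x - r) + (a / (a - b)) • ((y - r) - (x - r)) := by
      rw [sub_sub_sub_cancel_right]; abel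
    rw [this, planeCross_add_right, planeCross_smul_right, planeCross_sub_right w (y - r) (x - r), ← ha, ← hb]
    field_simp; ring

/-! ### Sets whose differences do not cross -/

/-- No segment with ends in `A \ B` meets a segment with ends in `B \ A`. -/
def DiffsNoncrossing (A B : Set Plane) : Prop :=
  ∀ p ∈ A \ B, ∀ q ∈ A \ B, ∀ r ∈ B \ A, ∀ s ∈ B \ A,
    Disjoint (segment ℝ p q) (segment ℝ r s)

theorem DiffsNoncrossing.symm {A B : Set Plane} (h : DiffsNoncrossing A B) :
    DiffsNoncrossing B A :=
  fun p hp q hq r hr s hs => (h r hr s hs p hp q hq).symm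

theorem mem_segment_planeCross_mul_nonpos {w r p q z : Plane} (hz : z ∈ segment ℝ p q)
    (h : planeCross w (z - r) = 0) : planeCross w (p - r) * planeCross w (q - r) ≤ 0 := by
  obtain ⟨a, b, ha, hb, hab, rfl⟩ := hz
  have h' : a * planeCross w (p - r) + b * planeCross w (q - r) = 0 := by
    rw [← h, ← planeCross_smul_right, ← planeCross_smul_right, ← planeCross_add_right]
    congr 1
    have : r = (a + b) • r := by rw [hab, one_smul]
    conv_rhs => rw [this]
    module
  rcases ha.eq_or_lt with rfl | ha'
  · obtain rfl : b = 1 := by linarith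
    have : planeCross w (q - r) = 0 := by linarith
    rw [this]; simp
  · by_contra! hc
    have h1 : a * (planeCross w (p - r) * planeCross w (p - r)) + b * (planeCross w (p - r) * planeCross w (q - r)) = 0 := by
      linear_combination (planeCross w (p - r)) * h'
    have h2 : planeCross w (p - r) ≠ 0 := by
      intro h0; rw [h0] at hc; simp at hc
    have h3 : 0 < planeCross w (p - r) * planeCross w (p - r) := mul_self_pos.2 h2
    have := mul_pos ha' h3
    have := mul_nonneg hb hc.le
    linarith

theorem left_mem_segment_line {r s z : Plane} (hz : z ∈ segment ℝ r s) :
    planeCross (s - r) (z - r) = 0 := by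
  rw [segment_eq_image_lineMap] at hz
  obtain ⟨u, -, rfl⟩ := hz
  rw [AffineMap.lineMap_apply, vsub_eq_sub, vadd_eq_add, add_sub_cancel_right, planeCross_smul_right]
  simp

/-- If the segments cross, the line `r s` meets `A` only inside the segment `r s`, which lies in
`B`. So `A \ B` misses this line although it has points on both sides, and is disconnected. -/
theorem diffsNoncrossing_of_isPreconnected {A B : Set Plane} (hA : Convex ℝ A) (hB : Convex ℝ B)
    (h : IsPreconnected (A \ B)) : DiffsNoncrossing A B := by
  intro p hp q hq r hr s hs
  rw [Set.disjoint_left]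
  intro z hzp hzr
  have hzA : z ∈ A := hA.segment_subset hp.1 hq.1 hzp
  have hmiss : ∀ e ∈ A \ B, planeCross (s - r) (e - r) ≠ 0 := fun e he h0 =>
    he.2 (hB.segment_subset hr.1 hs.1
      (hA.mem_segment_of_planeCross_eq_zero hr.2 hs.2 hzA hzr he.1 h0))
  have hle := mem_segment_planeCross_mul_nonpos (w := s - r) (r := r) hzp (left_mem_segment_line hzr)
  have hcont : ContinuousOn (fun x => planeCross (s - r) (x - r)) (A \ B) :=
    ((continuous_planeCross_right _).comp (continuous_id.sub continuous_const)).continuousOn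
  have hp0 := hmiss p hp
  have hq0 := hmiss q hq
  rcases lt_or_gt_of_ne hp0 with h1 | h1
  · have h2 : 0 ≤ planeCross (s - r) (q - r) := by nlinarith
    obtain ⟨e, he, h0⟩ := h.intermediate_value hp hq hcont ⟨h1.le, h2⟩
    exact hmiss e he h0
  · have h2 : planeCross (s - r) (q - r) ≤ 0 := by nlinarith
    obtain ⟨e, he, h0⟩ := h.intermediate_value hq hp hcont ⟨h2, h1.le⟩
    exact hmiss e he h0

theorem IsPreconnected.exists_mem_diff_interior {α : Type*} [TopologicalSpace α] {S T : Set α}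
    (hS : IsPreconnected S) (hT : IsClosed T) {x y : α} (hx : x ∈ S) (hxT : x ∈ T) (hy : y ∈ S)
    (hyT : y ∉ T) : ∃ e ∈ S, e ∈ T ∧ e ∉ interior T := by
  by_contra! h
  obtain ⟨e, -, he1, he2⟩ := hS (interior T) Tᶜ isOpen_interior hT.isOpen_compl
    (fun e he => (em (e ∈ T)).imp (h e he) id) ⟨x, hx, h x hx hxT⟩ ⟨y, hy, hyT⟩
  exact he2 (interior_subset he1)

/-- A segment that leaves a triangle meets one of its edges. -/
theorem exists_mem_edge_of_mem_convexHull {r : Fin 3 → Plane} {z p : Plane}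
    (hz : z ∈ convexHull ℝ (range r)) (hp : p ∉ convexHull ℝ (range r)) :
    ∃ e ∈ segment ℝ z p, ∃ i j, e ∈ segment ℝ (r i) (r j) := by
  by_cases hr : AffineIndependent ℝ r
  · have hcard : Fintype.card (Fin 3) = Module.finrank ℝ Plane + 1 := by simp
    let b : AffineBasis (Fin 3) ℝ Plane :=
      ⟨r, hr, hr.affineSpan_eq_top_iff_card_eq_finrank_add_one.2 hcard⟩
    have hb : (b : Fin 3 → Plane) = r := rfl
    have hint := b.interior_convexHull
    have hT := b.convexHull_eq_nonneg_coord
    rw [hb] at hint hT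
    have hclosed : IsClosed (convexHull ℝ (range r)) :=
      ((finite_range r).isCompact_convexHull ℝ).isClosed
    -- A frontier point of the triangle has a vanishing barycentric coordinate and lies on the
    -- opposite edge.
    obtain ⟨e, he, h1, h2⟩ := (convex_segment (𝕜 := ℝ) z p).isPreconnected.exists_mem_diff_interior
      hclosed (left_mem_segment ℝ z p) hz (right_mem_segment ℝ z p) hp
    rw [hint] at h2
    rw [hT] at h1
    simp only [mem_ofPred_eq, not_forall, not_lt] at h1 h2
    obtain ⟨k, hk⟩ := h2
    have hk0 : b.coord k e = 0 := le_antisymm hk (h1 k)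
    have hsum := b.sum_coord_apply_eq_one e
    have hcomb := b.linear_combination_coord_eq_self e
    rw [Fin.sum_univ_three] at hsum hcomb
    refine ⟨e, he, ?_⟩
    fin_cases k
    · refine ⟨1, 2, b.coord 1 e, b.coord 2 e, h1 1, h1 2, ?_, ?_⟩
      · simp only [Fin.zero_eta, Fin.isValue] at hk0; rw [hk0] at hsum; linarith
      · simp only [Fin.zero_eta, Fin.isValue] at hk0; rw [hk0] at hcomb; simpa [hb] using hcomb
    · refine ⟨0, 2, b.coord 0 e, b.coord 2 e, h1 0, h1 2, ?_, ?_⟩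
      · simp only [Fin.mk_one, Fin.isValue] at hk0; rw [hk0] at hsum; linarith
      · simp only [Fin.mk_one, Fin.isValue] at hk0; rw [hk0] at hcomb; simpa [hb] using hcomb
    · refine ⟨0, 1, b.coord 0 e, b.coord 1 e, h1 0, h1 1, ?_, ?_⟩
      · simp only [Fin.reduceFinMk, Fin.isValue] at hk0; rw [hk0] at hsum; linarith
      · simp only [Fin.reduceFinMk, Fin.isValue] at hk0; rw [hk0] at hcomb; simpa [hb] using hcomb
  -- A degenerate triangle is contained in one of its edges, so `z` itself will do.
  · refine ⟨z, left_mem_segment ℝ z p, ?_⟩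
    have hr' : r = ![r 0, r 1, r 2] := by ext i; fin_cases i <;> rfl
    have hcol : Collinear ℝ {r 0, r 1, r 2} := by
      by_contra hc
      rw [← affineIndependent_iff_not_collinear_set, ← hr'] at hc
      exact hr hc
    have hrange : range r = {r 0, r 1, r 2} := by
      rw [hr']; simp
      ext x; simp; tauto
    rw [hrange] at hz
    rcases hcol.wbtw_or_wbtw_or_wbtw with h | h | h
    · refine ⟨0, 2, ?_⟩
      rw [← convexHull_pair]
      refine convexHull_min ?_ (convex_convexHull ℝ _) hz
      rintro x (rfl | rfl | rfl)
      · exact subset_convexHull ℝ _ (by simp)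
      · rw [convexHull_pair]; exact h.mem_segment
      · exact subset_convexHull ℝ _ (by simp)
    · refine ⟨1, 0, ?_⟩
      rw [← convexHull_pair]
      refine convexHull_min ?_ (convex_convexHull ℝ _) hz
      rintro x (rfl | rfl | rfl)
      · exact subset_convexHull ℝ _ (by simp)
      · exact subset_convexHull ℝ _ (by simp)
      · rw [convexHull_pair]; exact h.mem_segment
    · refine ⟨2, 1, ?_⟩
      rw [← convexHull_pair]
      refine convexHull_min ?_ (convex_convexHull ℝ _) hz
      rintro x (rfl | rfl | rfl)
      · rw [convexHull_pair]; exact h.mem_segment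
      · exact subset_convexHull ℝ _ (by simp)
      · exact subset_convexHull ℝ _ (by simp)

/-- Carathéodory's theorem in the plane. -/
theorem exists_triangle_of_mem_convexHull {S : Set Plane} {z : Plane} (hz : z ∈ convexHull ℝ S) :
    ∃ r : Fin 3 → Plane, range r ⊆ S ∧ z ∈ convexHull ℝ (range r) := by
  rw [convexHull_eq_union] at hz
  simp only [mem_iUnion] at hz
  obtain ⟨t, htS, htI, hzt⟩ := hz
  have hcard : t.card ≤ 3 := by
    have := htI.card_le_finrank_succ
    have h2 := Submodule.finrank_le (vectorSpan ℝ (range ((↑) : t → Plane)))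
    rw [finrank_euclideanSpace_fin] at h2
    simp only [Fintype.card_coe] at this
    omega
  have hne : t.Nonempty := by
    by_contra h
    rw [Finset.not_nonempty_iff_eq_empty] at h
    simp [h] at hzt
  obtain ⟨x0, hx0⟩ := hne
  have hf : ∃ r : Fin 3 → Plane, range r = (t : Set Plane) := by
    let e := t.equivFin
    -- With fewer than three points, the remaining indices repeat `x0`.
    refine ⟨fun i => if h : (i : ℕ) < t.card then (e.symm ⟨i, h⟩ : Plane) else x0, ?_⟩
    ext x
    constructor
    · rintro ⟨i, rfl⟩
      dsimp only
      split_ifs with h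
      · exact (e.symm ⟨i, h⟩).2
      · exact hx0
    · intro hx
      refine ⟨⟨e ⟨x, hx⟩, (e ⟨x, hx⟩).2.trans_le hcard⟩, ?_⟩
      simp
  obtain ⟨r, hr⟩ := hf
  exact ⟨r, hr ▸ htS, hr ▸ hzt⟩

/-- Let `z` be a common point, in a triangle with vertices in `B \ A`. A segment from `z` to a point
of `A \ B` leaves this triangle, which lies in `B`, through an edge at some `e`. The line of this
edge meets `A` only within the edge, so `A \ B` avoids the line, and noncrossing puts all of `A \ B`
strictly on one side of it. The hull of `A \ B` is then on that side as well, but contains `e`. -/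
theorem DiffsNoncrossing.disjoint_convexHull {A B : Set Plane} (hA : Convex ℝ A)
    (hB : Convex ℝ B) (h : DiffsNoncrossing A B) :
    Disjoint (convexHull ℝ (A \ B)) (convexHull ℝ (B \ A)) := by
  rw [Set.disjoint_left]
  intro z hzA hzB
  obtain ⟨r, hrs, hzr⟩ := exists_triangle_of_mem_convexHull hzB
  have hne : (A \ B).Nonempty := by
    rw [← convexHull_nonempty_iff (𝕜 := ℝ)]; exact ⟨z, hzA⟩
  obtain ⟨p, hp⟩ := hne
  have hpr : p ∉ convexHull ℝ (range r) := fun hc =>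
    hp.2 (convexHull_min (hrs.trans sdiff_subset) hB hc)
  obtain ⟨e, hezp, i, j, heij⟩ := exists_mem_edge_of_mem_convexHull hzr hpr
  have heA : e ∈ convexHull ℝ (A \ B) :=
    (convex_convexHull ℝ _).segment_subset hzA (subset_convexHull ℝ _ hp) hezp
  have heA' : e ∈ A := convexHull_min sdiff_subset hA heA
  have hi := hrs (mem_range_self i)
  have hj := hrs (mem_range_self j)
  have hmiss : ∀ x ∈ A \ B, planeCross (r j - r i) (x - r i) ≠ 0 := fun x hx h0 =>
    hx.2 (hB.segment_subset hi.1 hj.1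
      (hA.mem_segment_of_planeCross_eq_zero hi.2 hj.2 heA' heij hx.1 h0))
  have hside : ∀ x ∈ A \ B, 0 < planeCross (r j - r i) (p - r i) * planeCross (r j - r i) (x - r i) := by
    intro x hx
    by_contra! hc
    have hlt := lt_of_le_of_ne hc (mul_ne_zero (hmiss p hp) (hmiss x hx))
    obtain ⟨e', he', h0⟩ := exists_mem_openSegment_planeCross_eq_zero _ _ hlt
    have he'' := openSegment_subset_segment ℝ _ _ he'
    have he'A := hA.segment_subset hp.1 hx.1 he''
    exact Set.disjoint_left.1 (h p hp x hx _ hi _ hj) he''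
      (hA.mem_segment_of_planeCross_eq_zero hi.2 hj.2 heA' heij he'A h0)
  have hconv : Convex ℝ {x | 0 < planeCross (r j - r i) (p - r i) * planeCross (r j - r i) (x - r i)} := by
    intro x hx y hy a b ha hb hab
    simp only [mem_ofPred_eq] at hx hy ⊢
    have h1 : a • x + b • y - r i = a • (x - r i) + b • (y - r i) := by
      have : r i = (a + b) • r i := by rw [hab, one_smul]
      conv_lhs => rw [this]
      module
    rw [h1, planeCross_add_right, planeCross_smul_right, planeCross_smul_right]
    rcases ha.eq_or_lt with rfl | ha'
    · obtain rfl : b = 1 := by linarith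
      simpa using hy
    · nlinarith [mul_pos ha' hx, mul_nonneg hb hy.le]
  have : e ∈ {x | 0 < planeCross (r j - r i) (p - r i) * planeCross (r j - r i) (x - r i)} :=
    convexHull_min (fun x hx => hside x hx) hconv heA
  rw [mem_ofPred_eq, left_mem_segment_line heij, mul_zero] at this
  exact lt_irrefl _ this

/-! ### Minimal refinements -/

/-- If truncating `A` by a halfplane destroys the noncrossing property with `B`, then `B` reaches
into the part cut off, is contained in `A` there, and is smaller than `A` in that direction. -/
theorem DiffsNoncrossing.of_not_truncated {A B : Set Plane} (hA : Convex ℝ A) (hB : Convex ℝ B)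
    (h : DiffsNoncrossing A B) (n : Plane →L[ℝ] ℝ) (t : ℝ)
    (hnot : ¬ DiffsNoncrossing (A ∩ {x | n x ≤ t}) B) :
    (B ∩ {x | t < n x}).Nonempty ∧ B ∩ {x | t < n x} ⊆ A ∧
      ∃ τ, B ∩ {x | τ ≤ n x} ⊆ A ∧ ¬ A ∩ {x | τ ≤ n x} ⊆ B := by
  have hle : Convex ℝ {x | n x ≤ t} := convex_halfSpace_le n.isLinear t
  have hgt : Convex ℝ {x | t < n x} := convex_halfSpace_gt n.isLinear t
  -- In a new crossing, exactly one of `r` and `s` lies in `A`. If both did, the segment would stay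
  -- in `t < n`, away from `z`; if neither did, `A` and `B` would already cross.
  have main : ∃ p ∈ (A ∩ {x | n x ≤ t}) \ B, ∃ q ∈ (A ∩ {x | n x ≤ t}) \ B, ∃ r ∈ A ∩ B,
      t < n r ∧ ∃ s ∈ B \ A, ∃ z ∈ segment ℝ p q, z ∈ segment ℝ r s := by
    unfold DiffsNoncrossing at hnot
    push Not at hnot
    obtain ⟨p, hp, q, hq, r, hr, s, hs, hd⟩ := hnot
    rw [Set.not_disjoint_iff] at hd
    obtain ⟨z, hzp, hzr⟩ := hd
    have hzt : n z ≤ t := hle.segment_subset hp.1.2 hq.1.2 hzp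
    by_cases hrA : r ∈ A
    · have hrt : t < n r := by
        by_contra! hc
        exact hr.2 ⟨hrA, hc⟩
      have hsA : s ∉ A := fun hsA => by
        have hst : t < n s := by
          by_contra! hc
          exact hs.2 ⟨hsA, hc⟩
        exact absurd (hgt.segment_subset hrt hst hzr) (not_lt.2 hzt)
      exact ⟨p, hp, q, hq, r, ⟨hrA, hr.1⟩, hrt, s, ⟨hs.1, hsA⟩, z, hzp, hzr⟩
    · by_cases hsA : s ∈ A
      · have hst : t < n s := by
          by_contra! hc
          exact hs.2 ⟨hsA, hc⟩
        exact ⟨p, hp, q, hq, s, ⟨hsA, hs.1⟩, hst, r, ⟨hr.1, hrA⟩, z, hzp,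
          segment_symm ℝ r s ▸ hzr⟩
      · exact absurd hzr (Set.disjoint_left.1 (h p ⟨hp.1.1, hp.2⟩ q ⟨hq.1.1, hq.2⟩ r ⟨hr.1, hrA⟩ s
          ⟨hs.1, hsA⟩) hzp)
  obtain ⟨p, hp, q, hq, r, hr, hrt, s, hs, z, hzp, hzr⟩ := main
  have hzB : z ∈ B := hB.segment_subset hr.2 hs.1 hzr
  have line : ∀ e ∈ B, planeCross (q - p) (e - p) = 0 → e ∈ segment ℝ p q := fun e he h0 =>
    hB.mem_segment_of_planeCross_eq_zero hp.2 hq.2 hzB hzp he h0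
  have segA : ∀ e ∈ segment ℝ p q, e ∈ A := fun e he => hA.segment_subset hp.1.1 hq.1.1 he
  have segt : ∀ e ∈ segment ℝ p q, n e ≤ t := fun e he => hle.segment_subset hp.1.2 hq.1.2 he
  have hs0 : planeCross (q - p) (s - p) ≠ 0 := fun h0 => hs.2 (segA _ (line s hs.1 h0))
  have hr0 : planeCross (q - p) (r - p) ≠ 0 := fun h0 => (segt _ (line r hr.2 h0)).not_gt hrt
  have hrs : planeCross (q - p) (r - p) * planeCross (q - p) (s - p) < 0 :=
    lt_of_le_of_ne (mem_segment_planeCross_mul_nonpos hzr (left_mem_segment_line hzp))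
      (mul_ne_zero hr0 hs0)
  -- A point of `B \ A` on the side of `r` would be joined to `s` by a segment that crosses `p q`,
  -- against the hypothesis. So `p q` separates `r` from all of `B \ A`.
  have same_side : ∀ u ∈ B \ A, planeCross (q - p) (u - p) * planeCross (q - p) (r - p) < 0 := by
    intro u hu
    have hu0 : planeCross (q - p) (u - p) ≠ 0 := fun h0 => hu.2 (segA _ (line u hu.1 h0))
    by_contra! hc
    have hus : planeCross (q - p) (u - p) * planeCross (q - p) (s - p) < 0 := by
      have h1 : 0 < planeCross (q - p) (u - p) * planeCross (q - p) (r - p) :=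
        lt_of_le_of_ne hc (mul_ne_zero hu0 hr0).symm
      rcases lt_or_gt_of_ne hr0 with h2 | h2
      · have h3 : 0 < planeCross (q - p) (s - p) := by nlinarith
        have h4 : planeCross (q - p) (u - p) < 0 := by nlinarith
        exact mul_neg_of_neg_of_pos h4 h3
      · have h3 : planeCross (q - p) (s - p) < 0 := by nlinarith
        have h4 : 0 < planeCross (q - p) (u - p) := by nlinarith
        exact mul_neg_of_pos_of_neg h4 h3
    obtain ⟨e, he, h0⟩ := exists_mem_openSegment_planeCross_eq_zero _ _ hus
    have he' := openSegment_subset_segment ℝ _ _ he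
    exact Set.disjoint_left.1 (h p ⟨hp.1.1, hp.2⟩ q ⟨hq.1.1, hq.2⟩ u hu s hs)
      (line e (hB.segment_subset hu.1 hs.1 he') h0) he'
  -- The level is the higher end of `p q`. A segment from `r` to a point of `B \ A` crosses `p q`,
  -- at a point no higher than this level; the end that attains the level is in `A` but not in `B`.
  refine ⟨⟨r, hr.2, hrt⟩, ?_, max (n p) (n q), ?_, ?_⟩
  · rintro u ⟨huB, hut⟩
    by_contra huA
    obtain ⟨e, he, h0⟩ := exists_mem_openSegment_planeCross_eq_zero _ _ (same_side u ⟨huB, huA⟩)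
    have he' := openSegment_subset_segment ℝ _ _ he
    have h1 := segt e (line e (hB.segment_subset huB hr.2 he') h0)
    exact absurd (hgt.segment_subset hut hrt he') (not_lt.2 h1)
  · rintro u ⟨huB, hut⟩
    by_contra huA
    obtain ⟨e, he, h0⟩ := exists_mem_openSegment_planeCross_eq_zero _ _ (same_side u ⟨huB, huA⟩)
    have he' := openSegment_subset_segment ℝ _ _ he
    have hepq := line e (hB.segment_subset huB hr.2 he') h0
    have h1 : n e ≤ max (n p) (n q) :=
      (convex_halfSpace_le n.isLinear (max (n p) (n q))).segment_subset
        (show n p ≤ _ from le_max_left _ _) (show n q ≤ _ from le_max_right _ _) hepq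
    have hmt : max (n p) (n q) ≤ t := max_le hp.1.2 hq.1.2
    obtain ⟨a, b, ha, hb, hab, rfl⟩ := he
    simp only [map_add, map_smul, smul_eq_mul] at h1
    simp only [mem_ofPred_eq] at hut
    have h2 : a * max (n p) (n q) + b * max (n p) (n q) = max (n p) (n q) := by
      rw [← add_mul, hab, one_mul]
    have h3 := mul_le_mul_of_nonneg_left hut ha.le
    have h4 := mul_lt_mul_of_pos_left (hmt.trans_lt hrt) hb
    linarith
  · intro hsub
    rcases le_total (n p) (n q) with hpq | hpq
    · exact hq.2 (hsub ⟨hq.1.1, by simp [hpq]⟩)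
    · exact hp.2 (hsub ⟨hp.1.1, by simp [hpq]⟩)

/-- A family of closed convex sets inside the members of `D`, with the same union, and with
noncrossing differences. -/
structure IsNoncrossingRefinement {ι : Type*} (D C : ι → Set Plane) : Prop where
  isClosed : ∀ i, IsClosed (C i)
  convex : ∀ i, Convex ℝ (C i)
  subset : ∀ i, C i ⊆ D i
  covers : ⋃ i, D i ⊆ ⋃ i, C i
  noncrossing : ∀ i j, DiffsNoncrossing (C i) (C j)

theorem IsChain.exists_le_of_finite {α κ : Type*} [PartialOrder α] [Finite κ] {c : Set α}
    (hc : IsChain (· ≤ ·) c) (hne : c.Nonempty) (f : κ → α) (hf : ∀ k, f k ∈ c) :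
    ∃ y ∈ c, ∀ k, y ≤ f k := by
  classical
  cases nonempty_fintype κ
  suffices ∀ s : Finset κ, ∃ y ∈ c, ∀ k ∈ s, y ≤ f k by
    obtain ⟨y, hy, h⟩ := this Finset.univ
    exact ⟨y, hy, fun k => h k (Finset.mem_univ k)⟩
  intro s
  induction s using Finset.induction_on with
  | empty => obtain ⟨y, hy⟩ := hne; exact ⟨y, hy, by simp⟩
  | insert a s _ ih =>
    obtain ⟨y, hy, h⟩ := ih
    rcases hc.total hy (hf a) with h1 | h1
    · exact ⟨y, hy, fun k hk => (Finset.mem_insert.1 hk).elim (fun e => e ▸ h1) (h k)⟩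
    · exact ⟨f a, hf a, fun k hk => (Finset.mem_insert.1 hk).elim (fun e => e ▸ le_rfl)
        (fun hk => h1.trans (h k hk))⟩

/-- Zorn's lemma in the reversed order; the bound of a chain is its memberwise intersection. A
failure of covering or of noncrossing for the intersection involves finitely many points and
indices, so it would already occur in a single element of the chain. -/
theorem exists_minimal_noncrossingRefinement {ι : Type*} [Finite ι] {D : ι → Set Plane}
    (hD : IsNoncrossingRefinement D D) : ∃ C, Minimal (IsNoncrossingRefinement D) C := by
  suffices h : ∀ c ⊆ {C : (ι → Set Plane)ᵒᵈ | IsNoncrossingRefinement D C},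
      IsChain (α := (ι → Set Plane)ᵒᵈ) (· ≤ ·) c → ∀ y ∈ c,
      ∃ ub ∈ {C : (ι → Set Plane)ᵒᵈ | IsNoncrossingRefinement D C}, ∀ z ∈ c, z ≤ ub by
    obtain ⟨C, -, hC⟩ := @zorn_le_nonempty₀ (ι → Set Plane)ᵒᵈ _ _ h D hD
    exact ⟨C, hC⟩
  intro c hcs hc y hy
  have hcs' : ∀ C ∈ c, IsNoncrossingRefinement D C := hcs
  have hchain : IsChain (α := ι → Set Plane) (· ≤ ·) c := hc.symm
  have hfin : ∀ (κ : Type) [Finite κ] (f : κ → ι → Set Plane), (∀ k, f k ∈ c) →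
      ∃ C ∈ c, ∀ k i, C i ⊆ f k i := fun κ _ f hf => by
    obtain ⟨C, hC, h⟩ := hchain.exists_le_of_finite ⟨y, hy⟩ f hf
    exact ⟨C, hC, fun k i => h k i⟩
  let E : ι → Set Plane := fun i => ⋂ C ∈ c, C i
  have hmem : ∀ i x, x ∈ E i ↔ ∀ C ∈ c, x ∈ C i := fun i x => by simp [E]
  have hnot : ∀ i x, x ∉ E i → ∃ C ∈ c, x ∉ C i := fun i x h => by
    rw [hmem] at h; push Not at h; exact h
  refine ⟨E, ⟨?_, ?_, ?_, ?_, ?_⟩, fun C hC i x hx => (hmem i x).1 hx C hC⟩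
  · exact fun i => isClosed_biInter fun C hC => (hcs' C hC).isClosed i
  · exact fun i => convex_iInter₂ fun C hC => (hcs' C hC).convex i
  · exact fun i x hx => (hcs' y hy).subset i ((hmem i x).1 hx y hy)
  · intro x hx
    by_contra hxE
    simp only [mem_iUnion, not_exists] at hxE
    choose f hf hxf using fun i => hnot i x (hxE i)
    obtain ⟨C, hC, h⟩ := hchain.exists_le_of_finite ⟨y, hy⟩ f hf
    obtain ⟨i, hi⟩ := mem_iUnion.1 ((hcs' C hC).covers hx)
    exact hxf i (h i i hi)
  · intro i j p hp q hq r hr s hs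
    obtain ⟨C1, hC1, h1⟩ := hnot j p hp.2
    obtain ⟨C2, hC2, h2⟩ := hnot j q hq.2
    obtain ⟨C3, hC3, h3⟩ := hnot i r hr.2
    obtain ⟨C4, hC4, h4⟩ := hnot i s hs.2
    -- One element of the chain that witnesses all four exclusions at once.
    obtain ⟨C, hC, h⟩ := hfin (Fin 4) ![C1, C2, C3, C4]
      (fun k => by fin_cases k <;> assumption)
    exact (hcs' C hC).noncrossing i j p ⟨(hmem i p).1 hp.1 C hC, fun h' => h1 (h 0 j h')⟩
      q ⟨(hmem i q).1 hq.1 C hC, fun h' => h2 (h 1 j h')⟩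
      r ⟨(hmem j r).1 hr.1 C hC, fun h' => h3 (h 2 i h')⟩
      s ⟨(hmem j s).1 hs.1 C hC, fun h' => h4 (h 3 i h')⟩

/-- In a minimal refinement, no cap of a member is covered by the other members. -/
theorem Minimal.not_cap_subset {ι : Type*} [Finite ι] {D C : ι → Set Plane}
    (hC : Minimal (IsNoncrossingRefinement D) C) (n : Plane →L[ℝ] ℝ) (t : ℝ) (i : ι)
    (hne : (C i ∩ {x | t < n x}).Nonempty) :
    ¬ C i ∩ {x | t < n x} ⊆ ⋃ l ∈ {l | l ≠ i}, C l := by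
  classical
  intro hcov
  let I : Set ι := {i | (C i ∩ {x | t < n x}).Nonempty ∧
    C i ∩ {x | t < n x} ⊆ ⋃ l ∈ {l | l ≠ i}, C l}
  -- `R j k`: far enough in direction `n`, the member `j` is strictly smaller than `k`. This is a
  -- strict order on a finite set, so a minimal candidate for truncation exists.
  let R : ι → ι → Prop := fun j k => ∃ τ, C j ∩ {x | τ ≤ n x} ⊆ C k ∧ ¬ C k ∩ {x | τ ≤ n x} ⊆ C j
  have hirr : Std.Irrefl R := ⟨fun j ⟨τ, _, h⟩ => h inter_subset_left⟩
  have htrans : IsTrans ι R := by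
    refine ⟨fun a b c ⟨τ, h1, h2⟩ ⟨υ, h3, h4⟩ => ?_⟩
    rcases le_total τ υ with h | h
    · refine ⟨υ, fun x hx => h3 ⟨h1 ⟨hx.1, h.trans hx.2⟩, hx.2⟩, fun hca => h4 fun x hx => ?_⟩
      exact h1 ⟨hca hx, h.trans hx.2⟩
    · refine ⟨τ, fun x hx => h3 ⟨h1 hx, h.trans hx.2⟩, fun hca => h2 fun x hx => ?_⟩
      exact hca ⟨h3 ⟨hx.1, h.trans hx.2⟩, hx.2⟩
  have hwf : WellFounded R := Finite.wellFounded_of_trans_of_irrefl R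
  obtain ⟨k, ⟨hkne, hkcov⟩, hkmin⟩ := hwf.has_min I ⟨i, hne, hcov⟩
  -- A member `j` that obstructs the truncation of `k` has a nonempty cap inside `C k`. It is then
  -- itself a candidate, and `R j k` contradicts the choice of `k`.
  have hcut : ∀ j, DiffsNoncrossing (C k ∩ {x | n x ≤ t}) (C j) := by
    intro j
    by_contra hnot
    obtain ⟨h1, h2, h3⟩ := (hC.prop.noncrossing k j).of_not_truncated (hC.prop.convex k)
      (hC.prop.convex j) n t hnot
    have hjk : k ≠ j := by
      rintro rfl
      obtain ⟨τ, -, h⟩ := h3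
      exact h inter_subset_left
    exact hkmin j ⟨h1, fun x hx => mem_biUnion hjk (h2 hx)⟩ h3
  let C' := Function.update C k (C k ∩ {x | n x ≤ t})
  have hk' : C' k = C k ∩ {x | n x ≤ t} := Function.update_self ..
  have hj' : ∀ j, j ≠ k → C' j = C j := fun j hj => Function.update_of_ne hj ..
  have hle : C' ≤ C := by
    intro j
    by_cases hj : j = k
    · subst hj; rw [hk']; exact inter_subset_left
    · rw [hj' j hj]
  have href : IsNoncrossingRefinement D C' := by
    refine ⟨fun j => ?_, fun j => ?_, fun j => (hle j).trans (hC.prop.subset j), ?_, fun a b => ?_⟩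
    · by_cases hj : j = k
      · subst hj; rw [hk']
        exact (hC.prop.isClosed j).inter (isClosed_le n.continuous continuous_const)
      · rw [hj' j hj]; exact hC.prop.isClosed j
    · by_cases hj : j = k
      · subst hj; rw [hk']
        exact (hC.prop.convex j).inter (convex_halfSpace_le n.isLinear t)
      · rw [hj' j hj]; exact hC.prop.convex j
    · intro x hx
      obtain ⟨j, hj⟩ := mem_iUnion.1 (hC.prop.covers hx)
      by_cases hjk : j = k
      · subst hjk
        by_cases hxt : n x ≤ t
        · exact mem_iUnion.2 ⟨j, by rw [hk']; exact ⟨hj, hxt⟩⟩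
        · obtain ⟨l, hl, hxl⟩ := mem_iUnion₂.1 (hkcov ⟨hj, not_le.1 hxt⟩)
          exact mem_iUnion.2 ⟨l, by rw [hj' l hl]; exact hxl⟩
      · exact mem_iUnion.2 ⟨j, by rw [hj' j hjk]; exact hj⟩
    · by_cases ha : a = k
      · subst ha
        by_cases hb : b = a
        · subst hb
          exact fun p hp => absurd hp.1 hp.2
        · rw [hk', hj' b hb]; exact hcut b
      · by_cases hb : b = k
        · subst hb
          rw [hk', hj' a ha]; exact (hcut a).symm
        · rw [hj' a ha, hj' b hb]; exact hC.prop.noncrossing a b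
  obtain ⟨x, hx, hxt⟩ := hkne
  have := hC.le_of_le href hle k hx
  rw [hk'] at this
  exact absurd (show t < n x from hxt) (_root_.not_lt.2 this.2)

/-- A point of `C i` outside this closed hull is cut off from it by a line, and the resulting cap of
`C i` would be covered by `C j`. -/
theorem Minimal.subset_closure_convexHull {ι : Type*} [Finite ι] {D C : ι → Set Plane}
    (hC : Minimal (IsNoncrossingRefinement D) C) {i j : ι} (hij : i ≠ j) :
    C i ⊆ closure (convexHull ℝ (C i \ C j)) := by
  intro x hx
  by_contra hxc
  obtain ⟨f, u, hu, hux⟩ := geometric_hahn_banach_closed_point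
    (convex_convexHull ℝ (C i \ C j)).closure isClosed_closure hxc
  refine hC.not_cap_subset f u i ⟨x, hx, hux⟩ fun y hy => ?_
  refine mem_biUnion (show j ≠ i from hij.symm) ?_
  by_contra hyj
  exact absurd (hu y (subset_closure (subset_convexHull ℝ _ ⟨hy.1, hyj⟩))) (_root_.not_lt.2 (le_of_lt hy.2))

/-- A convex set and its closure have the same interior, provided that the former has one; this
holds here because the set spans the plane as soon as its closure does. So `interior (C i)` lies in
the hull of `C i \ C j` itself, and the two hulls are disjoint. -/
theorem Minimal.disjoint_interior {ι : Type*} [Finite ι] {D C : ι → Set Plane}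
    (hC : Minimal (IsNoncrossingRefinement D) C) {i j : ι} (hij : i ≠ j) :
    Disjoint (interior (C i)) (interior (C j)) := by
  have key : ∀ {i j : ι}, i ≠ j → interior (C i) ⊆ convexHull ℝ (C i \ C j) := by
    intro i j hij x hx
    have h1 := interior_mono (hC.subset_closure_convexHull hij) hx
    have hne : (interior (convexHull ℝ (C i \ C j))).Nonempty := by
      by_contra hemp
      have hconv := convex_convexHull ℝ (C i \ C j)
      rw [hconv.interior_nonempty_iff_affineSpan_eq_top] at hemp
      apply hemp
      have h2 := hconv.closure.interior_nonempty_iff_affineSpan_eq_top.1 ⟨x, h1⟩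
      rw [eq_top_iff, ← h2, affineSpan_le]
      exact closure_minimal (subset_affineSpan ℝ _)
        (AffineSubspace.closed_of_finiteDimensional _)
    rw [(convex_convexHull ℝ _).interior_closure_eq_interior_of_nonempty_interior hne] at h1
    exact interior_subset h1
  exact ((hC.prop.noncrossing i j).disjoint_convexHull (hC.prop.convex i) (hC.prop.convex j)).mono
    (key hij) (key hij.symm)

/-- A family of closed convex sets with nonempty, pairwise disjoint interiors. -/
structure IsConvexPacking {ι : Type*} (C : ι → Set Plane) : Prop where
  isClosed : ∀ i, IsClosed (C i)
  convex : ∀ i, Convex ℝ (C i)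
  interior_nonempty : ∀ i, (interior (C i)).Nonempty
  disjoint_interior : ∀ i j, i ≠ j → Disjoint (interior (C i)) (interior (C j))

/-- The union of convex pseudo-disks is the union of openly disjoint convex sets, one inside each
pseudo-disk of a subfamily. -/
theorem IsConvexPseudoDisks.exists_packing {m : ℕ} {D : Fin m → Set Plane}
    (hD : IsConvexPseudoDisks D) :
    ∃ (s : Finset (Fin m)) (C : s → Set Plane), IsConvexPacking C ∧ (∀ i : s, C i ⊆ D i) ∧
      (⋃ i, C i) = ⋃ i, D i := by
  classical
  have hDD : IsNoncrossingRefinement D D := ⟨hD.isClosed, hD.convex, fun _ => subset_rfl,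
    subset_rfl, fun i j => diffsNoncrossing_of_isPreconnected (hD.convex i) (hD.convex j)
      (hD.isPreconnected_diff i j)⟩
  obtain ⟨C, hC⟩ := exists_minimal_noncrossingRefinement hDD
  -- Members with empty interior are dropped. They are closed and finite in number, so their union
  -- has empty interior, whereas each `D i` is the closure of its interior: nothing of the union is
  -- lost.
  let s : Finset (Fin m) := {i | (interior (C i)).Nonempty}
  have hs : ∀ i, i ∈ s ↔ (interior (C i)).Nonempty := fun i => by simp [s]
  refine ⟨s, fun i => C i, ⟨fun i => hC.prop.isClosed i, fun i => hC.prop.convex i,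
    fun i => (hs i).1 i.2, fun i j hij => hC.disjoint_interior (fun h => hij (Subtype.ext h))⟩,
    fun i => hC.prop.subset i, ?_⟩
  apply subset_antisymm
  · exact iUnion_subset fun i => (hC.prop.subset i).trans (subset_iUnion D i)
  intro x hx
  by_contra hxC
  have hclosed : IsClosed (⋃ i : s, C i) := isClosed_iUnion_of_finite fun i => hC.prop.isClosed i
  obtain ⟨i, hi⟩ := mem_iUnion.1 hx
  have hxcl : x ∈ closure (interior (D i)) := by
    rw [(hD.convex i).closure_interior_eq_closure_of_nonempty_interior (hD.interior_nonempty i)]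
    exact subset_closure hi
  obtain ⟨y, hyO, hyD⟩ := mem_closure_iff.1 hxcl _ hclosed.isOpen_compl hxC
  have hbad : ∀ t : Finset (Fin m), (∀ j ∈ t, j ∉ s) → interior (⋃ j ∈ t, C j) = ∅ := by
    intro t
    induction t using Finset.induction_on with
    | empty => simp
    | insert a t _ ih =>
      intro ht
      rw [Finset.set_biUnion_insert, interior_union_isClosed_of_interior_empty (hC.prop.isClosed a)
        (ih fun j hj => ht j (Finset.mem_insert_of_mem hj)), ← not_nonempty_iff_eq_empty, ← hs]
      exact ht a (Finset.mem_insert_self a t)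
  have hsub : (⋃ i : s, C i)ᶜ ∩ interior (D i) ⊆ ⋃ j ∈ sᶜ, C j := by
    rintro z ⟨hz1, hz2⟩
    obtain ⟨j, hj⟩ := mem_iUnion.1 (hC.prop.covers (mem_iUnion_of_mem i (interior_subset hz2)))
    refine mem_biUnion (x := j) ?_ hj
    rw [Finset.mem_coe, Finset.mem_compl]
    exact fun hjs => hz1 (mem_iUnion.2 ⟨⟨j, hjs⟩, hj⟩)
  have : y ∈ interior (⋃ j ∈ sᶜ, C j) :=
    interior_maximal hsub (hclosed.isOpen_compl.inter isOpen_interior) ⟨hyO, hyD⟩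
  rw [hbad sᶜ fun j hj => Finset.mem_compl.1 hj] at this
  exact this

/-! ### Counting adjacencies in a sweep -/

/-- Open intervals with a partial order in which any finite number of intervals with a common point
are linearly ordered: at most `3 n` pairs are adjacent at some point. -/
theorem card_sweep_adjacent_le {ι : Type*} [Fintype ι] {X : ι → Set ℝ} {r : ι → ι → Prop}
    (hopen : ∀ i, IsOpen (X i)) (hconn : ∀ i, (X i).OrdConnected)
    (htotal : ∀ i j x, i ≠ j → x ∈ X i → x ∈ X j → r i j ∨ r j i)
    (htrans : ∀ i j k x, x ∈ X i → x ∈ X j → x ∈ X k → r i j → r j k → r i k)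
    (s : Finset (ι × ι))
    (hs : ∀ p ∈ s, ∃ x, x ∈ X p.1 ∧ x ∈ X p.2 ∧ r p.1 p.2 ∧ ∀ k, x ∈ X k → ¬ (r p.1 k ∧ r k p.2)) :
    s.card ≤ 3 * Fintype.card ι := by
  classical
  -- Reading `r i j` as `i` above `j`, the pair is followed from `x` to the left. If nothing ever
  -- separated `i` and `j`, the pair is charged to whichever of them starts inside the other (`P0`,
  -- `P1`). Otherwise it is charged to a separating member `k` at the place `t` where `k` ends
  -- (`P2`).
  let P0 : ι → ι → Prop := fun i j => ∃ x, x ∈ X i ∧ x ∈ X j ∧ r i j ∧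
    (∀ k, ∀ y ≤ x, y ∈ X i → y ∈ X j → y ∈ X k → ¬ (r i k ∧ r k j)) ∧ ∀ y ≤ x, y ∈ X i → y ∈ X j
  let P1 : ι → ι → Prop := fun i j => ∃ x, x ∈ X i ∧ x ∈ X j ∧ r i j ∧
    (∀ k, ∀ y ≤ x, y ∈ X i → y ∈ X j → y ∈ X k → ¬ (r i k ∧ r k j)) ∧ ∀ y ≤ x, y ∈ X j → y ∈ X i
  let P2 : ι → ι → ι → Prop := fun i j k => ∃ t, IsLUB (X k) t ∧ (X k).Nonempty ∧ t ∈ X i ∧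
    t ∈ X j ∧ r i j ∧ (∀ l, t ∈ X l → ¬ (r i l ∧ r l j)) ∧ r i k ∧ r k j
  let Q : ι × ι → ι × Fin 3 → Prop := fun p c =>
    (c.2 = 0 ∧ c.1 = p.1 ∧ P0 p.1 p.2) ∨ (c.2 = 1 ∧ c.1 = p.2 ∧ P1 p.1 p.2) ∨
      (c.2 = 2 ∧ P2 p.1 p.2 c.1)
  have hex : ∀ p ∈ s, ∃ c, Q p c := by
    rintro ⟨i, j⟩ hp
    obtain ⟨x, hxi, hxj, hij, hk⟩ := hs _ hp
    dsimp only at hxi hxj hij hk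
    let B : Finset ι := {k | ∃ y ≤ x, y ∈ X i ∧ y ∈ X j ∧ y ∈ X k ∧ r i k ∧ r k j}
    have hB : ∀ k, k ∈ B ↔ ∃ y ≤ x, y ∈ X i ∧ y ∈ X j ∧ y ∈ X k ∧ r i k ∧ r k j :=
      fun k => by simp [B]
    by_cases hne : B.Nonempty
    -- The last separating member to end. Nothing separates the pair at its right end: by openness
    -- such a member would end later still.
    · obtain ⟨k, hkB, hkmax⟩ := B.exists_max_image (fun k => sSup (X k)) hne
      have hbdd : ∀ l ∈ B, x ∈ upperBounds (X l) := by
        intro l hl z hz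
        obtain ⟨y, hyx, -, -, hyl, h⟩ := (hB l).1 hl
        by_contra! hzx
        exact hk l ((hconn l).out hyl hz ⟨hyx, hzx.le⟩) h
      obtain ⟨y, hyx, hyi, hyj, hyk, hik, hkj⟩ := (hB k).1 hkB
      have hlub : IsLUB (X k) (sSup (X k)) := isLUB_csSup ⟨y, hyk⟩ ⟨x, hbdd k hkB⟩
      have hty : y ≤ sSup (X k) := hlub.1 hyk
      have htx : sSup (X k) ≤ x := hlub.2 (hbdd k hkB)
      have hti := (hconn i).out hyi hxi ⟨hty, htx⟩
      have htj := (hconn j).out hyj hxj ⟨hty, htx⟩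
      refine ⟨(k, 2), Or.inr (Or.inr ⟨rfl, sSup (X k), hlub, ⟨y, hyk⟩, hti, htj, hij, ?_, hik,
        hkj⟩)⟩
      intro l hl h
      have hlB : l ∈ B := (hB l).2 ⟨_, htx, hti, htj, hl, h⟩
      obtain ⟨ε, hε, hsub⟩ := Metric.isOpen_iff.1 (hopen l) _ hl
      have h1 : sSup (X k) + ε / 2 ∈ X l := hsub (by
        rw [Metric.mem_ball, Real.dist_eq, add_sub_cancel_left, abs_of_pos (half_pos hε)]
        exact half_lt_self hε)
      have h2 := le_csSup ⟨x, hbdd l hlB⟩ h1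
      have h3 : sSup (X l) ≤ sSup (X k) := hkmax l hlB
      linarith
    · have hno : ∀ k, ∀ y ≤ x, y ∈ X i → y ∈ X j → y ∈ X k → ¬ (r i k ∧ r k j) :=
        fun k y hyx hyi hyj hyk h => hne ⟨k, (hB k).2 ⟨y, hyx, hyi, hyj, hyk, h⟩⟩
      by_cases hi : ∀ y ≤ x, y ∈ X i → y ∈ X j
      · exact ⟨(i, 0), Or.inl ⟨rfl, rfl, x, hxi, hxj, hij, hno, hi⟩⟩
      · refine ⟨(j, 1), Or.inr (Or.inl ⟨rfl, rfl, x, hxi, hxj, hij, hno, fun y hyx hyj => ?_⟩)⟩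
        push Not at hi
        obtain ⟨z, hzx, hzi, hzj⟩ := hi
        have hzy : z ≤ y := by
          by_contra! hc
          exact hzj ((hconn j).out hyj hxj ⟨hc.le, hzx⟩)
        exact (hconn i).out hzi hxi ⟨hzy, hyx⟩
  have hinj : ∀ p p' c, Q p c → Q p' c → p = p' := by
    rintro ⟨i, j⟩ ⟨i', j'⟩ ⟨k, τ⟩ h h'
    rcases h with ⟨h1, h2, x, hxi, hxj, hij, hno, hsub⟩ | ⟨h1, h2, x, hxi, hxj, hij, hno, hsub⟩ |
        ⟨h1, t, hlub, hkne, hti, htj, hij, hno, hik, hkj⟩ <;>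
      rcases h' with ⟨h1', h2', x', hxi', hxj', hij', hno', hsub'⟩ |
        ⟨h1', h2', x', hxi', hxj', hij', hno', hsub'⟩ |
        ⟨h1', t', hlub', hkne', hti', htj', hij', hno', hik', hkj'⟩ <;>
      dsimp only at * <;> first | (exfalso; omega) | skip
    -- At the smaller of the two sweep positions `i`, `j` and `j'` coexist. As `j` and `j'` are
    -- comparable there, one of them separates `i` from the other.
    · subst h2 h2'
      by_contra hne
      have hjj : j ≠ j' := fun h => hne (by rw [h])
      rcases le_total x x' with hxx | hxx
      · have hx' := hsub' x hxx hxi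
        rcases htotal j j' x hjj hxj hx' with h | h
        · exact hno' j x hxx hxi hx' hxj ⟨hij, h⟩
        · exact hno j' x le_rfl hxi hxj hx' ⟨hij', h⟩
      · have hx' := hsub x' hxx hxi'
        rcases htotal j j' x' hjj hx' hxj' with h | h
        · exact hno' j x' le_rfl hxi' hxj' hx' ⟨hij, h⟩
        · exact hno j' x' hxx hxi' hx' hxj' ⟨hij', h⟩
    · subst h2 h2'
      by_contra hne
      have hii : i ≠ i' := fun h => hne (by rw [h])
      rcases le_total x x' with hxx | hxx
      · have hx' := hsub' x hxx hxj
        rcases htotal i i' x hii hxi hx' with h | h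
        · exact hno i' x le_rfl hxi hxj hx' ⟨h, hij'⟩
        · exact hno' i x hxx hx' hxj hxi ⟨h, hij⟩
      · have hx' := hsub x' hxx hxj'
        rcases htotal i i' x' hii hx' hxi' with h | h
        · exact hno i' x' hxx hx' hxj' hxi' ⟨h, hij'⟩
        · exact hno' i x' le_rfl hxi' hxj' hx' ⟨h, hij⟩
    -- Just before `t`, all of `i`, `j`, `i'`, `j'` coexist with `k`, which lies between both pairs.
    -- So `i` and `i'` are both above `j` and `j'`, and adjacency at `t` leaves room for only one
    -- upper and one lower neighbour.
    · obtain rfl := hlub.unique hlub'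
      obtain ⟨ε, hε, hball⟩ := Metric.isOpen_iff.1
        (((hopen i).inter (hopen j)).inter ((hopen i').inter (hopen j'))) t ⟨⟨hti, htj⟩, hti', htj'⟩
      obtain ⟨y, hyk, hy1, hy2⟩ := hlub.exists_between (show t - ε < t by linarith)
      have hyb : y ∈ Metric.ball t ε := by
        rw [Metric.mem_ball, Real.dist_eq, abs_lt]; constructor <;> linarith
      obtain ⟨⟨hyi, hyj⟩, hyi', hyj'⟩ := hball hyb
      have h1 : i = i' := by
        by_contra hne
        rcases htotal i i' t hne hti hti' with h | h
        · exact hno i' hti' ⟨h, htrans i' k j y hyi' hyk hyj hik' hkj⟩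
        · exact hno' i hti ⟨h, htrans i k j' y hyi hyk hyj' hik hkj'⟩
      have h2 : j = j' := by
        by_contra hne
        rcases htotal j j' t hne htj htj' with h | h
        · exact hno' j htj ⟨htrans i' k j y hyi' hyk hyj hik' hkj, h⟩
        · exact hno j' htj' ⟨htrans i k j' y hyi hyk hyj' hik hkj', h⟩
      rw [h1, h2]
  have hex' : ∀ p, ∃ c, p ∈ s → Q p c := fun p => by
    by_cases hp : p ∈ s
    · obtain ⟨c, hc⟩ := hex p hp
      exact ⟨c, fun _ => hc⟩
    · exact ⟨(p.1, 0), fun h => absurd h hp⟩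
  choose f hf using hex'
  have hcard := Finset.card_le_card_of_injOn (t := (Finset.univ : Finset (ι × Fin 3))) f
    (fun p _ => Finset.mem_coe.2 (Finset.mem_univ _))
    (fun p hp q hq h => hinj p q (f p) (hf p hp) (h ▸ hf q hq))
  rw [Finset.card_univ, Fintype.card_prod, Fintype.card_fin] at hcard
  omega

/-! ### Contacts of convex packings -/

namespace IsConvexPacking

variable {ι : Type*} {C : ι → Set Plane}

theorem closure_interior_eq (hC : IsConvexPacking C) (i : ι) : closure (interior (C i)) = C i := by
  rw [(hC.convex i).closure_interior_eq_closure_of_nonempty_interior (hC.interior_nonempty i),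
    (hC.isClosed i).closure_eq]

theorem disjoint_interior_left (hC : IsConvexPacking C) {i j : ι} (hij : i ≠ j) :
    Disjoint (interior (C i)) (C j) := by
  rw [← hC.closure_interior_eq j]
  exact (hC.disjoint_interior i j hij).closure_right isOpen_interior

/-- A member that touches a relatively interior point of a segment in another member lies on the
other side of this segment. -/
theorem exists_side (hC : IsConvexPacking C) {i k : ι} (hik : i ≠ k) {p q x : Plane}
    (hpq : p ≠ q) (hp : p ∈ C i) (hq : q ∈ C i) (hx : x ∈ openSegment ℝ p q) (hxk : x ∈ C k) :
    ∃ σ : ℝ, (∀ y ∈ C i, σ * planeCross (q - p) (y - x) ≤ 0) ∧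
      (∀ y ∈ C k, 0 ≤ σ * planeCross (q - p) (y - x)) ∧ σ ≠ 0 := by
  obtain ⟨f, u, hi, hk⟩ := geometric_hahn_banach_open (hC.convex i).interior isOpen_interior
    (hC.convex k) (hC.disjoint_interior_left hik)
  have hi' : ∀ y ∈ C i, f y ≤ u := by
    rw [← hC.closure_interior_eq i]
    exact fun y hy => closure_minimal (fun z hz => (hi z hz).le)
      (isClosed_le f.continuous continuous_const) hy
  have hfx : f x = u := le_antisymm
    (hi' x ((hC.convex i).openSegment_subset hp hq hx)) (hk x hxk)
  have hfpq : f (q - p) = 0 := by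
    obtain ⟨a, b, ha, hb, hab, rfl⟩ := hx
    have h1 := hi' p hp
    have h2 := hi' q hq
    rw [map_add, map_smul, map_smul, smul_eq_mul, smul_eq_mul] at hfx
    have h3 : a * (u - f p) + b * (u - f q) = 0 := by
      have : a * u + b * u = u := by rw [← add_mul, hab, one_mul]
      linarith
    have h4 : u - f p = 0 := by
      by_contra h0
      have := mul_pos ha (lt_of_le_of_ne (sub_nonneg.2 h1) (Ne.symm h0))
      have := mul_nonneg hb.le (sub_nonneg.2 h2)
      linarith
    rw [h4, mul_zero, zero_add] at h3
    have h5 : u - f q = 0 := (mul_eq_zero.1 h3).resolve_left hb.ne'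
    rw [map_sub]; linarith
  have hw : q - p ≠ 0 := sub_ne_zero.2 hpq.symm
  obtain ⟨v, hv⟩ := exists_planeCross_ne_zero hw
  have hf : ∀ y, f y = f v / planeCross (q - p) v * planeCross (q - p) y := by
    intro y
    conv_lhs => rw [eq_combo_of_planeCross hv y]
    rw [map_add, map_smul, map_smul, hfpq, smul_zero, zero_add, smul_eq_mul]
    ring
  refine ⟨f v / planeCross (q - p) v, fun y hy => ?_, fun y hy => ?_, fun h0 => ?_⟩
  · rw [← hf, map_sub, hfx]; linarith [hi' y hy]
  · rw [← hf, map_sub, hfx]; linarith [hk y hy]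
  · obtain ⟨c, hc⟩ := hC.interior_nonempty i
    have h1 := hi c hc
    rw [← hfx, hf c, hf x, h0] at h1
    simp at h1

theorem exists_planeCross_sub_ne_zero (hC : IsConvexPacking C) (i : ι) {w : Plane} (hw : w ≠ 0)
    (x : Plane) : ∃ y ∈ C i, planeCross w (y - x) ≠ 0 := by
  by_contra! h
  obtain ⟨c, hc⟩ := hC.interior_nonempty i
  obtain ⟨v, hv⟩ := exists_planeCross_ne_zero hw
  have hcont : Continuous fun t : ℝ => c + t • v := by fun_prop
  have hnhds : ∀ᶠ t : ℝ in nhds 0, c + t • v ∈ interior (C i) :=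
    hcont.continuousAt.eventually_mem (isOpen_interior.mem_nhds (by simpa using hc))
  obtain ⟨ε, hε, hball⟩ := Metric.eventually_nhds_iff.1 hnhds
  have h1 := h _ (interior_subset (hball (y := ε / 2) (by
    rw [Real.dist_eq, sub_zero, abs_of_pos (half_pos hε)]; exact half_lt_self hε)))
  have h2 := h c (interior_subset hc)
  rw [show c + (ε / 2) • v - x = (c - x) + (ε / 2) • v by abel, planeCross_add_right, h2,
    planeCross_smul_right, zero_add] at h1
  exact (mul_ne_zero (half_pos hε).ne' hv) h1

/-- A relatively interior point of a contact segment lies in no third member. -/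
theorem eq_or_eq_of_mem_openSegment (hC : IsConvexPacking C) {i j k : ι} (hij : i ≠ j)
    {p q x : Plane} (hpq : p ≠ q) (hp : p ∈ C i ∩ C j) (hq : q ∈ C i ∩ C j)
    (hx : x ∈ openSegment ℝ p q) (hxk : x ∈ C k) : k = i ∨ k = j := by
  by_contra! h
  obtain ⟨hki, hkj⟩ := h
  have hw : q - p ≠ 0 := sub_ne_zero.2 hpq.symm
  have opp : ∀ a b, a ≠ b → p ∈ C a → q ∈ C a → x ∈ C b → ∀ y ∈ C a, ∀ z ∈ C b,
      planeCross (q - p) (y - x) * planeCross (q - p) (z - x) ≤ 0 := by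
    intro a b hab hpa hqa hxb y hy z hz
    obtain ⟨σ, h1, h2, h3⟩ := hC.exists_side hab hpq hpa hqa hx hxb
    have h4 := mul_nonneg (neg_nonneg.2 (h1 y hy)) (h2 z hz)
    have h5 : 0 < σ * σ := mul_self_pos.2 h3
    by_contra! h6
    nlinarith [mul_pos h5 h6]
  obtain ⟨yi, hyi, hi0⟩ := hC.exists_planeCross_sub_ne_zero i hw x
  obtain ⟨yj, hyj, hj0⟩ := hC.exists_planeCross_sub_ne_zero j hw x
  obtain ⟨yk, hyk, hk0⟩ := hC.exists_planeCross_sub_ne_zero k hw x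
  have h1 := lt_of_le_of_ne (opp i k hki.symm hp.1 hq.1 hxk yi hyi yk hyk) (mul_ne_zero hi0 hk0)
  have h2 := lt_of_le_of_ne (opp j k hkj.symm hp.2 hq.2 hxk yj hyj yk hyk) (mul_ne_zero hj0 hk0)
  have h3 := lt_of_le_of_ne (opp i j hij hp.1 hq.1
    ((hC.convex j).openSegment_subset hp.2 hq.2 hx) yi hyi yj hyj) (mul_ne_zero hi0 hj0)
  have h4 := mul_pos_of_neg_of_neg h1 h2
  have h5 := mul_self_pos.2 hk0
  nlinarith [mul_neg_of_pos_of_neg h5 h3]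

/-- Two members have a contact if they share more than one point. -/
def Contact (C : ι → Set Plane) (i j : ι) : Prop := i ≠ j ∧ ¬ (C i ∩ C j).Subsingleton

/-- The member `i` reaches above the member `j` in direction of the coordinate `b`. -/
def Above (C : ι → Set Plane) (a b : Fin 2) (i j : ι) : Prop :=
  i ≠ j ∧ ∃ u ∈ interior (C i), ∃ v ∈ interior (C j), u a = v a ∧ v b < u b

theorem plane_ext_of_ne {a b : Fin 2} (hab : a ≠ b) {u v : Plane} (ha : u a = v a)
    (hb : u b = v b) : u = v := by
  ext i
  have : i = a ∨ i = b := by omega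
  rcases this with rfl | rfl <;> assumption

/-- One functional separates the two members, and each of the two relations would determine its sign
on the basis vector `b`, in opposite ways. -/
theorem above_asymm (hC : IsConvexPacking C) {a b : Fin 2} (hab : a ≠ b) (i j : ι)
    (h : Above C a b i j) : ¬ Above C a b j i := by
  rintro ⟨-, u', hu', v', hv', ha', hb'⟩
  obtain ⟨hij, u, hu, v, hv, ha, hb⟩ := h
  obtain ⟨f, c, hi, hj⟩ := geometric_hahn_banach_open (hC.convex i).interior isOpen_interior
    (hC.convex j) (hC.disjoint_interior_left hij)
  have h1 : f u < f v := (hi u hu).trans_le (hj v (interior_subset hv))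
  have h2 : f v' < f u' := (hi v' hv').trans_le (hj u' (interior_subset hu'))
  have e1 : u = v + (u b - v b) • EuclideanSpace.single b 1 := by
    apply plane_ext_of_ne hab <;> simp [ha, hab]
  have e2 : u' = v' + (u' b - v' b) • EuclideanSpace.single b 1 := by
    apply plane_ext_of_ne hab <;> simp [ha', hab]
  rw [e1, map_add, map_smul, smul_eq_mul] at h1
  rw [e2, map_add, map_smul, smul_eq_mul] at h2
  have h3 : f (EuclideanSpace.single b 1) < 0 := by nlinarith
  nlinarith

theorem above_total (hC : IsConvexPacking C) {a b : Fin 2} (hab : a ≠ b) {i j : ι} (hij : i ≠ j)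
    {u v : Plane} (hu : u ∈ interior (C i)) (hv : v ∈ interior (C j)) (ha : u a = v a) :
    (v b < u b ∧ Above C a b i j) ∨ (u b < v b ∧ Above C a b j i) := by
  rcases lt_trichotomy (u b) (v b) with h | h | h
  · exact Or.inr ⟨h, hij.symm, v, hv, u, hu, ha.symm, h⟩
  · obtain rfl := plane_ext_of_ne hab ha h
    exact absurd hv (Set.disjoint_left.1 (hC.disjoint_interior i j hij) hu)
  · exact Or.inl ⟨h, hij, u, hu, v, hv, ha, h⟩

theorem lt_of_above (hC : IsConvexPacking C) {a b : Fin 2} (hab : a ≠ b) {i j : ι}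
    (h : Above C a b i j) {u v : Plane} (hu : u ∈ interior (C i)) (hv : v ∈ interior (C j))
    (ha : u a = v a) : v b < u b := by
  rcases hC.above_total hab h.1 hu hv ha with h' | h'
  · exact h'.1
  · exact absurd h'.2 (hC.above_asymm hab i j h)

theorem mem_image_interior (hC : IsConvexPacking C) (a : Fin 2) {i : ι} {p q : Plane}
    (hp : p ∈ C i) (hq : q ∈ C i) {ξ : ℝ} (h1 : p a < ξ) (h2 : ξ < q a) :
    ∃ u ∈ interior (C i), u a = ξ := by
  have hcont : Continuous fun x : Plane => x a := by fun_prop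
  rw [← hC.closure_interior_eq i] at hp hq
  obtain ⟨p', hp'ξ, hp'⟩ := mem_closure_iff.1 hp _ (isOpen_lt hcont continuous_const) h1
  obtain ⟨q', hq'ξ, hq'⟩ := mem_closure_iff.1 hq _ (isOpen_lt continuous_const hcont) h2
  have h1' : p' a < ξ := hp'ξ
  have h2' : ξ < q' a := hq'ξ
  obtain ⟨u, hu, hξ⟩ := (hC.convex i).interior.isPreconnected.intermediate_value hp' hq'
    hcont.continuousOn ⟨h1'.le, h2'.le⟩
  exact ⟨u, hu, hξ⟩

theorem mem_segment_of_coord {a b : Fin 2} (hab : a ≠ b) {x y z : Plane} (h1 : x a = y a)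
    (h2 : y a = z a) (hxy : x b ≤ y b) (hyz : y b ≤ z b) : y ∈ segment ℝ x z := by
  rcases hxy.eq_or_lt with h | h
  · rw [plane_ext_of_ne hab h1 h]; exact left_mem_segment ℝ _ _
  have hpos : 0 < z b - x b := by linarith
  refine ⟨(z b - y b) / (z b - x b), (y b - x b) / (z b - x b),
    div_nonneg (by linarith) hpos.le, div_nonneg (by linarith) hpos.le, ?_, ?_⟩
  · field_simp; ring
  · apply plane_ext_of_ne hab <;> simp only [PiLp.add_apply, PiLp.smul_apply, smul_eq_mul]
    · rw [h1, h2]; field_simp; ring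
    · field_simp; ring

/-- The point of `C k` is vertically between the shared point `m` and a point of `C i` or of `C j`.
By convexity an interior point of `C k` would lie in that other member. -/
theorem not_above_between (hC : IsConvexPacking C) {a b : Fin 2} (hab : a ≠ b) {i j k : ι}
    {ui uj uk m : Plane} (hui : ui ∈ interior (C i)) (huj : uj ∈ interior (C j))
    (huk : uk ∈ interior (C k)) (hm : m ∈ C i ∩ C j) (hi : ui a = m a) (hj : uj a = m a)
    (hk : uk a = m a) (hik : Above C a b i k) (hkj : Above C a b k j) : False := by
  have h1 := hC.lt_of_above hab hik hui huk (hi.trans hk.symm)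
  have h2 := hC.lt_of_above hab hkj huk huj (hk.trans hj.symm)
  rcases le_total (m b) (uk b) with h | h
  · have := (hC.convex i).segment_subset hm.1 (interior_subset hui)
      (mem_segment_of_coord hab hk.symm (hk.trans hi.symm) h h1.le)
    exact Set.disjoint_left.1 (hC.disjoint_interior_left hik.1.symm) huk this
  · have := (hC.convex j).segment_subset (interior_subset huj) hm.2
      (mem_segment_of_coord hab (hj.trans hk.symm) hk h2.le h)
    exact Set.disjoint_left.1 (hC.disjoint_interior_left hkj.1) huk this

/-- The two shared points of a contact differ in some coordinate, so one of the two axis sweeps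
detects it. The constant is `3`, for two sweeps and for both orders of the pair. -/
theorem card_contact_le [Fintype ι] (hC : IsConvexPacking C) (E : Finset (ι × ι))
    (hE : ∀ p ∈ E, Contact C p.1 p.2) : E.card ≤ 12 * Fintype.card ι := by
  classical
  let X : Fin 2 → ι → Set ℝ := fun a i => (fun u : Plane => u a) '' interior (C i)
  let adj : Fin 2 → Fin 2 → ι × ι → Prop := fun a b p => ∃ x, x ∈ X a p.1 ∧ x ∈ X a p.2 ∧
    Above C a b p.1 p.2 ∧ ∀ k, x ∈ X a k → ¬ (Above C a b p.1 k ∧ Above C a b k p.2)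
  let S : Fin 2 → Fin 2 → Finset (ι × ι) := fun a b => {p | adj a b p}
  have hS : ∀ a b, a ≠ b → (S a b).card ≤ 3 * Fintype.card ι := by
    intro a b hab
    refine card_sweep_adjacent_le (X := X a) (r := Above C a b) ?_ ?_ ?_ ?_
      (S a b) (fun p hp => (Finset.mem_filter.1 hp).2)
    · intro i
      have hopen : IsOpenMap (fun u : Plane => u a) := by
        have h := (EuclideanSpace.proj a : Plane →L[ℝ] ℝ).isOpenMap (fun t =>
          ⟨EuclideanSpace.single a t, by simp⟩)
        exact h
      exact hopen _ isOpen_interior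
    · intro i
      have hcont : Continuous fun x : Plane => x a := by fun_prop
      exact ((hC.convex i).interior.isPreconnected.image _ hcont.continuousOn).ordConnected
    · rintro i j x hij ⟨u, hu, rfl⟩ ⟨v, hv, hvu⟩
      exact (hC.above_total hab hij hu hv hvu.symm).imp And.right And.right
    · rintro i j k x ⟨u, hu, rfl⟩ ⟨v, hv, hvu⟩ ⟨w, hw, hwu⟩ hij hjk
      dsimp only at hvu hwu
      have h1 := hC.lt_of_above hab hij hu hv hvu.symm
      have h2 := hC.lt_of_above hab hjk hv hw (hvu.trans hwu.symm)
      refine ⟨?_, u, hu, w, hw, hwu.symm, h2.trans h1⟩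
      rintro rfl
      exact hC.above_asymm hab _ _ hij hjk
  -- The sweep position is that of the midpoint of two shared points: strictly between their
  -- coordinates both interiors are met, and the midpoint prevents a third member from lying
  -- between.
  have key : ∀ a b, a ≠ b → ∀ i j, i ≠ j → ∀ p ∈ C i ∩ C j, ∀ q ∈ C i ∩ C j, p a < q a →
      (i, j) ∈ S a b ∨ (j, i) ∈ S a b := by
    intro a b hab i j hij p hp q hq hpq
    have hm : midpoint ℝ p q ∈ C i ∩ C j :=
      ((hC.convex i).inter (hC.convex j)).segment_subset hp hq (midpoint_mem_segment p q)
    have hma : midpoint ℝ p q a = (p a + q a) / 2 := by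
      rw [midpoint_eq_smul_add]; simp; ring
    obtain ⟨u, hu, hua⟩ := hC.mem_image_interior a hp.1 hq.1 (ξ := midpoint ℝ p q a)
      (by rw [hma]; linarith) (by rw [hma]; linarith)
    obtain ⟨v, hv, hva⟩ := hC.mem_image_interior a hp.2 hq.2 (ξ := midpoint ℝ p q a)
      (by rw [hma]; linarith) (by rw [hma]; linarith)
    have hX : ∀ k, midpoint ℝ p q a ∈ X a k → ∃ w ∈ interior (C k), w a = midpoint ℝ p q a :=
      fun k hk => hk
    rcases hC.above_total hab hij hu hv (hua.trans hva.symm) with ⟨-, h⟩ | ⟨-, h⟩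
    · refine Or.inl (Finset.mem_filter.2 ⟨Finset.mem_univ _, midpoint ℝ p q a, ⟨u, hu, hua⟩,
        ⟨v, hv, hva⟩, h, fun k hk hb => ?_⟩)
      obtain ⟨w, hw, hwa⟩ := hX k hk
      exact hC.not_above_between hab hu hv hw hm hua hva hwa hb.1 hb.2
    · refine Or.inr (Finset.mem_filter.2 ⟨Finset.mem_univ _, midpoint ℝ p q a, ⟨v, hv, hva⟩,
        ⟨u, hu, hua⟩, h, fun k hk hb => ?_⟩)
      obtain ⟨w, hw, hwa⟩ := hX k hk
      exact hC.not_above_between hab hv hu hw hm.symm hva hua hwa hb.1 hb.2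
  have hsub : E ⊆ (S 0 1 ∪ (S 0 1).image Prod.swap) ∪ (S 1 0 ∪ (S 1 0).image Prod.swap) := by
    rintro ⟨i, j⟩ hp
    obtain ⟨hij, hns⟩ := hE _ hp
    rw [Set.not_subsingleton_iff] at hns
    obtain ⟨p, hp, q, hq, hpq⟩ := hns
    have key' : ∀ a b, a ≠ b → p a ≠ q a →
        (i, j) ∈ S a b ∪ (S a b).image Prod.swap := by
      intro a b hab hne
      have : (i, j) ∈ S a b ∨ (j, i) ∈ S a b := by
        rcases lt_or_gt_of_ne hne with h | h
        · exact key a b hab i j hij p hp q hq h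
        · exact key a b hab i j hij q hq p hp h
      rcases this with h | h
      · exact Finset.mem_union_left _ h
      · exact Finset.mem_union_right _ (Finset.mem_image.2 ⟨_, h, rfl⟩)
    by_cases h0 : p 0 = q 0
    · by_cases h1 : p 1 = q 1
      · exact absurd (plane_ext h0 h1) hpq
      · exact Finset.mem_union_right _ (key' 1 0 (by decide) h1)
    · exact Finset.mem_union_left _ (key' 0 1 (by decide) h0)
  have h1 := hS 0 1 (by decide)
  have h2 := hS 1 0 (by decide)
  have h3 := Finset.card_le_card hsub
  have h4 := Finset.card_union_le (S 0 1 ∪ (S 0 1).image Prod.swap)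
    (S 1 0 ∪ (S 1 0).image Prod.swap)
  have h5 := Finset.card_union_le (S 0 1) ((S 0 1).image Prod.swap)
  have h6 := Finset.card_union_le (S 1 0) ((S 1 0).image Prod.swap)
  have h7 := Finset.card_image_le (s := S 0 1) (f := Prod.swap)
  have h8 := Finset.card_image_le (s := S 1 0) (f := Prod.swap)
  omega

end IsConvexPacking

/-! ### Fans of cones -/

/-- The closed convex cone between the directions `p.1` and `p.2`. -/
def closedCone (p : Plane × Plane) : Set Plane :=
  {x | 0 ≤ planeCross p.1 x ∧ 0 ≤ planeCross x p.2}

/-- The interior of the cone between the directions `p.1` and `p.2`. -/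
def openCone (p : Plane × Plane) : Set Plane :=
  {x | 0 < planeCross p.1 x ∧ 0 < planeCross x p.2}

theorem mem_closedCone {a b x : Plane} :
    x ∈ closedCone (a, b) ↔ 0 ≤ planeCross a x ∧ 0 ≤ planeCross x b := Iff.rfl

theorem mem_openCone {a b x : Plane} :
    x ∈ openCone (a, b) ↔ 0 < planeCross a x ∧ 0 < planeCross x b := Iff.rfl

theorem openCone_subset_closedCone (p : Plane × Plane) : openCone p ⊆ closedCone p :=
  fun _ hx => ⟨hx.1.le, hx.2.le⟩

/-- The three-term Plücker relation. It transfers signs between a cone `(a, b)` and the two cones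
into which a direction `u` splits it. -/
theorem planeCross_plucker (a b u x : Plane) :
    planeCross a u * planeCross x b = planeCross a x * planeCross u b +
      planeCross a b * planeCross x u := by
  unfold planeCross; ring

theorem closedCone_left_subset {a b u : Plane} (hab : 0 < planeCross a b)
    (hu : u ∈ openCone (a, b)) : closedCone (a, u) ⊆ closedCone (a, b) := by
  rintro x ⟨h1, h2⟩
  refine ⟨h1, ?_⟩
  have h := planeCross_plucker a b u x
  have h3 := mul_nonneg h1 hu.2.le
  have h4 := mul_nonneg hab.le h2
  exact nonneg_of_mul_nonneg_right (by dsimp only at *; linarith) hu.1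

theorem openCone_left_subset {a b u : Plane} (hab : 0 < planeCross a b)
    (hu : u ∈ openCone (a, b)) : openCone (a, u) ⊆ openCone (a, b) := by
  rintro x ⟨h1, h2⟩
  refine ⟨h1, ?_⟩
  have h := planeCross_plucker a b u x
  have h3 := mul_pos h1 hu.2
  have h4 := mul_pos hab h2
  exact pos_of_mul_pos_right (b := planeCross x b) (by dsimp only at *; linarith) hu.1.le

theorem closedCone_right_subset {a b u : Plane} (hab : 0 < planeCross a b)
    (hu : u ∈ openCone (a, b)) : closedCone (u, b) ⊆ closedCone (a, b) := by
  rintro x ⟨h1, h2⟩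
  refine ⟨?_, h2⟩
  have h := planeCross_plucker a b u x
  rw [planeCross_swap x u] at h
  have h3 := mul_nonneg hu.1.le h2
  have h4 := mul_nonneg hab.le h1
  exact nonneg_of_mul_nonneg_left (b := planeCross u b) (by dsimp only at *; linarith) hu.2

theorem openCone_right_subset {a b u : Plane} (hab : 0 < planeCross a b)
    (hu : u ∈ openCone (a, b)) : openCone (u, b) ⊆ openCone (a, b) := by
  rintro x ⟨h1, h2⟩
  refine ⟨?_, h2⟩
  have h := planeCross_plucker a b u x
  rw [planeCross_swap x u] at h
  have h3 := mul_pos hu.1 h2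
  have h4 := mul_pos hab h1
  exact pos_of_mul_pos_left (a := planeCross a x) (by dsimp only at *; linarith) hu.2.le

/-- A decomposition of the plane into openly disjoint pointed cones, bounded by directions from `F`,
none of which lies inside a cone. -/
structure IsFan (F : Finset Plane) (W : Finset (Plane × Plane)) : Prop where
  pos : ∀ p ∈ W, 0 < planeCross p.1 p.2
  covers : ∀ x, ∃ p ∈ W, x ∈ closedCone p
  disjoint : ∀ p ∈ W, ∀ q ∈ W, p ≠ q → Disjoint (openCone p) (closedCone q)
  fst_mem : ∀ p ∈ W, p.1 ∈ F
  snd_mem : ∀ p ∈ W, p.2 ∈ F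
  notMem : ∀ u ∈ F, ∀ p ∈ W, u ∉ openCone p

/-- The first unit vector. -/
noncomputable def axisX : Plane := EuclideanSpace.single 0 1

/-- The second unit vector. -/
noncomputable def axisY : Plane := EuclideanSpace.single 1 1

open Classical in
/-- The four axis directions. -/
noncomputable def axes : Finset Plane := {axisX, axisY, -axisX, -axisY}

theorem card_axes_le : axes.card ≤ 4 := Finset.card_le_four

@[simp] theorem planeCross_axisX_left (x : Plane) : planeCross axisX x = x 1 := by
  simp [planeCross, axisX]

@[simp] theorem planeCross_axisY_left (x : Plane) : planeCross axisY x = -x 0 := by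
  simp [planeCross, axisY]

@[simp] theorem planeCross_axisX_right (x : Plane) : planeCross x axisX = -x 1 := by
  simp [planeCross, axisX]

@[simp] theorem planeCross_axisY_right (x : Plane) : planeCross x axisY = x 0 := by
  simp [planeCross, axisY]

@[simp] theorem planeCross_neg_left (x y : Plane) : planeCross (-x) y = -planeCross x y := by
  simp only [planeCross, PiLp.neg_apply]; ring

@[simp] theorem planeCross_neg_right (x y : Plane) : planeCross x (-y) = -planeCross x y := by
  simp only [planeCross, PiLp.neg_apply]; ring

theorem isFan_axes : ∃ W, IsFan axes W ∧ W.card ≤ 4 := by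
  classical
  have hX0 : axisX 0 = 1 := by simp [axisX]
  have hX1 : axisX 1 = 0 := by simp [axisX]
  have hY0 : axisY 0 = 0 := by simp [axisY]
  have hY1 : axisY 1 = 1 := by simp [axisY]
  refine ⟨{(axisX, axisY), (axisY, -axisX), (-axisX, -axisY), (-axisY, axisX)}, ?_,
    Finset.card_le_four⟩
  refine ⟨?_, ?_, ?_, ?_, ?_, ?_⟩
  · simp [hX0, hY1]
  · intro x
    simp only [Finset.mem_insert, Finset.mem_singleton, exists_eq_or_imp, exists_eq_left,
      closedCone, mem_ofPred_eq, planeCross_axisX_left, planeCross_axisY_left,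
      planeCross_axisX_right, planeCross_axisY_right, planeCross_neg_left, planeCross_neg_right]
    rcases le_total 0 (x 0) with h0 | h0 <;> rcases le_total 0 (x 1) with h1 | h1
    · exact Or.inl ⟨h1, h0⟩
    · exact Or.inr (Or.inr (Or.inr ⟨by linarith, by linarith⟩))
    · exact Or.inr (Or.inl ⟨by linarith, by linarith⟩)
    · exact Or.inr (Or.inr (Or.inl ⟨by linarith, by linarith⟩))
  · simp only [Finset.mem_insert, Finset.mem_singleton, Set.disjoint_left, openCone, closedCone,
      mem_ofPred_eq]
    rintro p (rfl | rfl | rfl | rfl) q (rfl | rfl | rfl | rfl) hpq x ⟨h1, h2⟩ ⟨h3, h4⟩ <;>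
      first
      | exact hpq rfl
      | (simp at h1 h2 h3 h4; linarith)
  · simp [axes]
  · simp [axes]
  · simp only [axes, Finset.mem_insert, Finset.mem_singleton, openCone, mem_ofPred_eq]
    rintro u (rfl | rfl | rfl | rfl) p (rfl | rfl | rfl | rfl) ⟨h1, h2⟩ <;>
      simp [hX0, hX1, hY0, hY1] at h1 h2

/-- A new direction lies inside at most one cone, and splits this cone in two. -/
theorem IsFan.exists_insert [DecidableEq Plane] {F : Finset Plane} {W : Finset (Plane × Plane)}
    (h : IsFan F W) (u : Plane) : ∃ W', IsFan (insert u F) W' ∧ W'.card ≤ W.card + 1 := by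
  classical
  by_cases hu : ∃ p ∈ W, u ∈ openCone p
  swap
  · push Not at hu
    refine ⟨W, ⟨h.pos, h.covers, h.disjoint, fun p hp => Finset.mem_insert_of_mem (h.fst_mem p hp),
      fun p hp => Finset.mem_insert_of_mem (h.snd_mem p hp), ?_⟩, Nat.le_succ _⟩
    intro v hv p hp
    rcases Finset.mem_insert.1 hv with rfl | hv
    · exact hu p hp
    · exact h.notMem v hv p hp
  obtain ⟨⟨a, b⟩, hp, hu⟩ := hu
  have hab : 0 < planeCross a b := h.pos _ hp
  have hWp : ∀ q, q ∈ W.erase (a, b) → q ∈ W ∧ (a, b) ≠ q := fun q hq =>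
    ⟨Finset.mem_of_mem_erase hq, (Finset.ne_of_mem_erase hq).symm⟩
  refine ⟨insert (a, u) (insert (u, b) (W.erase (a, b))), ⟨?_, ?_, ?_, ?_, ?_, ?_⟩, ?_⟩
  · intro q hq
    rcases Finset.mem_insert.1 hq with rfl | hq
    · exact hu.1
    rcases Finset.mem_insert.1 hq with rfl | hq
    · exact hu.2
    · exact h.pos q (hWp q hq).1
  · intro x
    obtain ⟨q, hq, hx⟩ := h.covers x
    by_cases hqp : q = (a, b)
    · subst hqp
      rcases le_total 0 (planeCross x u) with h1 | h1
      · exact ⟨(a, u), by simp, hx.1, h1⟩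
      · refine ⟨(u, b), by simp, ?_, hx.2⟩
        rw [planeCross_swap]; dsimp only; linarith
    · exact ⟨q, by simp [hq, hqp], hx⟩
  · have hl := openCone_left_subset hab hu
    have hr := openCone_right_subset hab hu
    have hl' := closedCone_left_subset hab hu
    have hr' := closedCone_right_subset hab hu
    have hlr : Disjoint (openCone (a, u)) (closedCone (u, b)) := by
      rw [Set.disjoint_left]
      rintro x ⟨-, h1⟩ ⟨h2, -⟩
      rw [planeCross_swap] at h2
      dsimp only at h1 h2; linarith
    have hrl : Disjoint (openCone (u, b)) (closedCone (a, u)) := by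
      rw [Set.disjoint_left]
      rintro x ⟨h1, -⟩ ⟨-, h2⟩
      rw [planeCross_swap] at h2
      dsimp only at h1 h2; linarith
    intro q hq q' hq' hne
    simp only [Finset.mem_insert] at hq hq'
    rcases hq with rfl | rfl | hq <;> rcases hq' with rfl | rfl | hq'
    · exact absurd rfl hne
    · exact hlr
    · exact (h.disjoint _ hp _ (hWp _ hq').1 (hWp _ hq').2).mono_left hl
    · exact hrl
    · exact absurd rfl hne
    · exact (h.disjoint _ hp _ (hWp _ hq').1 (hWp _ hq').2).mono_left hr
    · exact (h.disjoint _ (hWp _ hq).1 _ hp (hWp _ hq).2.symm).mono_right hl'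
    · exact (h.disjoint _ (hWp _ hq).1 _ hp (hWp _ hq).2.symm).mono_right hr'
    · exact h.disjoint _ (hWp _ hq).1 _ (hWp _ hq').1 hne
  · intro q hq
    simp only [Finset.mem_insert] at hq
    rcases hq with rfl | rfl | hq
    · exact Finset.mem_insert_of_mem (h.fst_mem (a, b) hp)
    · exact Finset.mem_insert_self _ _
    · exact Finset.mem_insert_of_mem (h.fst_mem _ (hWp _ hq).1)
  · intro q hq
    simp only [Finset.mem_insert] at hq
    rcases hq with rfl | rfl | hq
    · exact Finset.mem_insert_self _ _
    · exact Finset.mem_insert_of_mem (h.snd_mem (a, b) hp)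
    · exact Finset.mem_insert_of_mem (h.snd_mem _ (hWp _ hq).1)
  · intro v hv q hq
    simp only [Finset.mem_insert] at hq
    rcases Finset.mem_insert.1 hv with rfl | hv
    · rcases hq with rfl | rfl | hq
      · rintro ⟨-, h1⟩
        simp at h1
      · rintro ⟨h1, -⟩
        simp at h1
      · exact fun hc => Set.disjoint_left.1 (h.disjoint _ (hWp _ hq).1 _ hp (hWp _ hq).2.symm) hc
          (openCone_subset_closedCone _ hu)
    · rcases hq with rfl | rfl | hq
      · exact fun hc => h.notMem v hv _ hp (openCone_left_subset hab hu hc)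
      · exact fun hc => h.notMem v hv _ hp (openCone_right_subset hab hu hc)
      · exact h.notMem v hv _ (hWp _ hq).1
  · have h1 := Finset.card_insert_le (a, u) (insert (u, b) (W.erase (a, b)))
    have h2 := Finset.card_insert_le (u, b) (W.erase (a, b))
    have h3 := Finset.card_erase_add_one hp
    omega

theorem exists_isFan [DecidableEq Plane] (F : Finset Plane) :
    ∃ W, IsFan (F ∪ axes) W ∧ W.card ≤ F.card + 4 := by
  induction F using Finset.induction_on with
  | empty =>
    obtain ⟨W, hW, hc⟩ := isFan_axes
    exact ⟨W, by simpa using hW, by simpa using hc⟩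
  | insert u F hu ih =>
    obtain ⟨W, hW, hc⟩ := ih
    obtain ⟨W', hW', hc'⟩ := hW.exists_insert u
    rw [Finset.insert_union]
    refine ⟨W', hW', ?_⟩
    rw [Finset.card_insert_of_notMem hu]
    omega

/-! ### Triangles spanned by two directions -/

/-- The triangle with apex `c`, bounded by the directions `a` and `b` and cut off by a line that
meets the two sides at `c + A⁻¹ • a` and `c + B⁻¹ • b`, or at infinity where `A` or `B` vanishes. -/
def coneTriangle (c a b : Plane) (A B : ℝ) : Set Plane :=
  {x | ∃ s t : ℝ, 0 ≤ s ∧ 0 ≤ t ∧ s * A + t * B ≤ 1 ∧ x = c + s • a + t • b}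

theorem linearIndependent_of_planeCross {a b : Plane} (h : planeCross a b ≠ 0) :
    LinearIndependent ℝ ![a, b] := by
  rw [LinearIndependent.pair_iff]
  intro s t hst
  have h1 := planeCross_combo_left a b s t
  have h2 := planeCross_combo_right a b s t
  rw [hst, planeCross_zero_right] at h1
  rw [hst, planeCross_zero_left] at h2
  exact ⟨(mul_eq_zero.1 h2.symm).resolve_right h, (mul_eq_zero.1 h1.symm).resolve_right h⟩

theorem convex_coneTriangle (c a b : Plane) (A B : ℝ) : Convex ℝ (coneTriangle c a b A B) := by
  rintro _ ⟨s, t, hs, ht, hst, rfl⟩ _ ⟨s', t', hs', ht', hst', rfl⟩ α β hα hβ hαβ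
  refine ⟨α * s + β * s', α * t + β * t', by positivity, by positivity, ?_, ?_⟩
  · have h1 := mul_le_mul_of_nonneg_left hst hα
    have h2 := mul_le_mul_of_nonneg_left hst' hβ
    linarith
  · have : c = (α + β) • c := by rw [hαβ, one_smul]
    conv_rhs => rw [this]
    module

theorem isTriangle_coneTriangle {a b : Plane} (hab : planeCross a b ≠ 0) (c : Plane) {A B : ℝ}
    (hA : 0 ≤ A) (hB : 0 ≤ B) : IsTriangle (coneTriangle c a b A B) := by
  have hba : planeCross b a ≠ 0 := by rw [planeCross_swap]; exact neg_ne_zero.2 hab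
  rcases hA.eq_or_lt with rfl | hA' <;> rcases hB.eq_or_lt with rfl | hB'
  · refine Or.inr (Or.inr ⟨c, a, b, linearIndependent_of_planeCross hab, ?_⟩)
    ext x
    constructor
    · rintro ⟨s, t, hs, ht, -, rfl⟩
      exact ⟨s, t, hs, ht, rfl⟩
    · rintro ⟨s, t, hs, ht, rfl⟩
      exact ⟨s, t, hs, ht, by simp, rfl⟩
  -- If exactly one of `A` and `B` vanishes, the region is a half-strip, an unbounded triangle with
  -- parallel rays.
  · refine Or.inr (Or.inl ⟨c, B⁻¹ • b, a, a, linearIndependent_of_planeCross ?_,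
      ⟨0, 1, le_rfl, one_pos, by simp⟩, ?_⟩)
    · rw [planeCross_smul_left]; exact mul_ne_zero (inv_ne_zero hB'.ne') hba
    ext x
    constructor
    · rintro ⟨s, t, hs, ht, hst, rfl⟩
      refine ⟨t * B, s, 0, by positivity, by linarith, hs, le_rfl, ?_⟩
      rw [smul_smul, mul_assoc, mul_inv_cancel₀ hB'.ne', mul_one, zero_smul]; abel
    · rintro ⟨r, s, t, hr, hr1, hs, ht, rfl⟩
      refine ⟨s + t, r * B⁻¹, by positivity, by positivity, ?_, by module⟩
      rw [mul_assoc, inv_mul_cancel₀ hB'.ne']; linarith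
  · refine Or.inr (Or.inl ⟨c, A⁻¹ • a, b, b, linearIndependent_of_planeCross ?_,
      ⟨0, 1, le_rfl, one_pos, by simp⟩, ?_⟩)
    · rw [planeCross_smul_left]; exact mul_ne_zero (inv_ne_zero hA'.ne') hab
    ext x
    constructor
    · rintro ⟨s, t, hs, ht, hst, rfl⟩
      refine ⟨s * A, t, 0, by positivity, by linarith, ht, le_rfl, ?_⟩
      rw [smul_smul, mul_assoc, mul_inv_cancel₀ hA'.ne', mul_one, zero_smul]; abel
    · rintro ⟨r, s, t, hr, hr1, hs, ht, rfl⟩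
      refine ⟨r * A⁻¹, s + t, by positivity, by positivity, ?_, by module⟩
      rw [mul_assoc, inv_mul_cancel₀ hA'.ne']; linarith
  · refine Or.inl ⟨c, c + A⁻¹ • a, c + B⁻¹ • b, ?_, ?_⟩
    · rw [affineIndependent_iff_not_collinear_set]
      intro hcol
      obtain ⟨v, hv⟩ := (collinear_iff_of_mem (p₀ := c) (by simp)).1 hcol
      obtain ⟨r1, h1⟩ := hv (c + A⁻¹ • a) (by simp)
      obtain ⟨r2, h2⟩ := hv (c + B⁻¹ • b) (by simp)
      rw [vadd_eq_add, add_comm c, add_left_inj] at h1 h2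
      have h3 : planeCross (A⁻¹ • a) (B⁻¹ • b) = 0 := by
        rw [h1, h2, planeCross_smul_left, planeCross_smul_right, planeCross_self]; ring
      rw [planeCross_smul_left, planeCross_smul_right] at h3
      exact mul_ne_zero (inv_ne_zero hA'.ne') (mul_ne_zero (inv_ne_zero hB'.ne') hab) h3
    · apply subset_antisymm
      · rintro x ⟨s, t, hs, ht, hst, rfl⟩
        have hconv := convex_convexHull ℝ {c, c + A⁻¹ • a, c + B⁻¹ • b}
        have hmem := hconv.sum_mem (t := Finset.univ) (w := ![1 - (s * A + t * B), s * A, t * B])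
          (z := ![c, c + A⁻¹ • a, c + B⁻¹ • b])
          (by
            intro i _
            fin_cases i <;> simp <;> first | positivity | linarith)
          (by simp [Fin.sum_univ_three]; ring)
          (by
            intro i _
            fin_cases i <;> exact subset_convexHull ℝ _ (by simp))
        convert hmem using 1
        simp only [Fin.sum_univ_three, Matrix.cons_val_zero, Matrix.cons_val_one, Matrix.cons_val]
        rw [smul_add, smul_add, smul_smul, smul_smul, mul_assoc, mul_assoc,
          mul_inv_cancel₀ hA'.ne', mul_inv_cancel₀ hB'.ne']
        module
      · refine convexHull_min ?_ (convex_coneTriangle c a b A B)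
        rintro x (rfl | rfl | rfl)
        · exact ⟨0, 0, le_rfl, le_rfl, by simp, by simp⟩
        · exact ⟨A⁻¹, 0, by positivity, le_rfl, by simp [hA'.ne'], by simp⟩
        · exact ⟨0, B⁻¹, le_rfl, by positivity, by simp [hB'.ne'], by simp⟩

/-! ### Extreme points of triangles -/

theorem eq_zero_of_mem_extremePoints {S : Set Plane} {x d : Plane} (hx : x ∈ S.extremePoints ℝ)
    (h1 : x + d ∈ S) (h2 : x - d ∈ S) : d = 0 := by
  have h := hx.2 h1 h2 ⟨1 / 2, 1 / 2, by norm_num, by norm_num, by norm_num, by module⟩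
  simpa using h

theorem IsTriangle.exists_finset_extremePoints {Δ : Set Plane} (h : IsTriangle Δ) :
    ∃ S : Finset Plane, S.card ≤ 3 ∧ (S : Set Plane) = Δ.extremePoints ℝ := by
  classical
  suffices h : ∃ S : Finset Plane, S.card ≤ 3 ∧ Δ.extremePoints ℝ ⊆ S by
    obtain ⟨S, hS, hsub⟩ := h
    refine ⟨S.filter (· ∈ Δ.extremePoints ℝ), (Finset.card_filter_le _ _).trans hS, ?_⟩
    ext x
    simp only [Finset.coe_filter, mem_ofPred_eq]
    exact ⟨And.right, fun hx => ⟨hsub hx, hx⟩⟩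
  rcases h with ⟨a, b, c, -, rfl⟩ | ⟨p, e, u, v, hlin, ⟨α, β, hα, hβ, rfl⟩, rfl⟩ | ⟨p, u, v, hlin, rfl⟩
  · exact ⟨{a, b, c}, Finset.card_le_three, by simpa using extremePoints_convexHull_subset⟩
  · refine ⟨{p, p + e}, Finset.card_le_two.trans (by norm_num), ?_⟩
    intro x hx
    have hlin' := LinearIndependent.pair_iff.1 hlin
    obtain ⟨r, s, t, hr, hr1, hs, ht, hxe⟩ := hx.1
    have hs0 : s = 0 := by
      have := eq_zero_of_mem_extremePoints (d := s • u) hx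
        ⟨r, 2 * s, t, hr, hr1, by positivity, ht, by rw [hxe]; module⟩
        ⟨r, 0, t, hr, hr1, le_rfl, ht, by rw [hxe]; module⟩
      exact (hlin' 0 s (by rw [this]; simp)).2
    have ht0 : t = 0 := by
      have := eq_zero_of_mem_extremePoints (d := t • (α • e + β • u)) hx
        ⟨r, s, 2 * t, hr, hr1, hs, by positivity, by rw [hxe]; module⟩
        ⟨r, s, 0, hr, hr1, hs, le_rfl, by rw [hxe]; module⟩
      have h2 := (hlin' (t * α) (t * β) (by rw [← this]; module)).2
      exact (mul_eq_zero.1 h2).resolve_right hβ.ne'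
    have hr0 : r = 0 ∨ r = 1 := by
      -- The displacement `r * (1 - r)` keeps the parameter in `[0, 1]` in both directions and
      -- vanishes only at the two ends.
      have := eq_zero_of_mem_extremePoints (d := (r * (1 - r)) • e) hx
        ⟨r + r * (1 - r), s, t, by nlinarith, by nlinarith, hs, ht, by rw [hxe]; module⟩
        ⟨r - r * (1 - r), s, t, by nlinarith, by nlinarith, hs, ht, by rw [hxe]; module⟩
      have h2 := (hlin' (r * (1 - r)) 0 (by rw [this]; simp)).1
      rcases mul_eq_zero.1 h2 with h | h
      · exact Or.inl h
      · exact Or.inr (by linarith)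
    subst hs0 ht0
    rcases hr0 with rfl | rfl <;> simp [hxe]
  · refine ⟨{p}, by simp, ?_⟩
    intro x hx
    have hlin' := LinearIndependent.pair_iff.1 hlin
    obtain ⟨s, t, hs, ht, hxe⟩ := hx.1
    have := eq_zero_of_mem_extremePoints (d := s • u + t • v) hx
      ⟨2 * s, 2 * t, by positivity, by positivity, by rw [hxe]; module⟩
      ⟨0, 0, le_rfl, le_rfl, by rw [hxe]; module⟩
    obtain ⟨rfl, rfl⟩ := hlin' s t this
    simp [hxe]

/-! ### The gauge of a convex set with respect to an interior point -/

/-- The gauge of `C` with respect to the centre `c`. -/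
noncomputable def gaugeAt (C : Set Plane) (c x : Plane) : ℝ := gauge ((fun y => c + y) ⁻¹' C) x

/-- `C` is a closed convex set with `c` in its interior. -/
structure IsBodyAt (C : Set Plane) (c : Plane) : Prop where
  isClosed : IsClosed C
  convex : Convex ℝ C
  mem_interior : c ∈ interior C

theorem gaugeAt_nonneg (C : Set Plane) (c x : Plane) : 0 ≤ gaugeAt C c x := gauge_nonneg _

theorem gaugeAt_smul (C : Set Plane) (c x : Plane) {t : ℝ} (ht : 0 ≤ t) :
    gaugeAt C c (t • x) = t * gaugeAt C c x := gauge_smul_of_nonneg ht x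

theorem gaugeAt_univ (c x : Plane) : gaugeAt univ c x = 0 := by
  refine le_antisymm (le_of_forall_pos_le_add fun ε hε => ?_) (gaugeAt_nonneg _ _ _)
  rw [zero_add]
  refine gauge_le_of_mem hε.le ?_
  rw [preimage_univ, smul_set_univ₀ hε.ne']
  exact mem_univ x

namespace IsBodyAt

variable {C D : Set Plane} {c : Plane}

theorem convex_preimage (h : IsBodyAt C c) : Convex ℝ ((fun y => c + y) ⁻¹' C) :=
  h.convex.translate_preimage_right c

theorem preimage_mem_nhds (h : IsBodyAt C c) : (fun y => c + y) ⁻¹' C ∈ nhds 0 := by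
  have : Continuous fun y : Plane => c + y := by fun_prop
  exact this.continuousAt.preimage_mem_nhds (by simpa using mem_interior_iff_mem_nhds.1 h.mem_interior)

theorem gaugeAt_add_le (h : IsBodyAt C c) (x y : Plane) :
    gaugeAt C c (x + y) ≤ gaugeAt C c x + gaugeAt C c y :=
  gauge_add_le h.convex_preimage (absorbent_nhds_zero h.preimage_mem_nhds) x y

theorem continuous_gaugeAt (h : IsBodyAt C c) : Continuous (gaugeAt C c) :=
  continuous_gauge h.convex_preimage h.preimage_mem_nhds

theorem add_mem_iff (h : IsBodyAt C c) (x : Plane) : c + x ∈ C ↔ gaugeAt C c x ≤ 1 := by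
  have hcl : IsClosed ((fun y => c + y) ⁻¹' C) := h.isClosed.preimage (by fun_prop)
  unfold gaugeAt
  rw [gauge_le_one_iff_mem_closure h.convex_preimage h.preimage_mem_nhds, hcl.closure_eq]
  rfl

theorem mem_iff (h : IsBodyAt C c) (x : Plane) : x ∈ C ↔ gaugeAt C c (x - c) ≤ 1 := by
  rw [← h.add_mem_iff, add_sub_cancel]

theorem add_mem_interior_iff (h : IsBodyAt C c) (x : Plane) :
    c + x ∈ interior C ↔ gaugeAt C c x < 1 := by
  unfold gaugeAt
  rw [gauge_lt_one_iff_mem_interior h.convex_preimage h.preimage_mem_nhds]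
  have : (fun y => c + y) ⁻¹' C = (Homeomorph.addLeft c) ⁻¹' C := rfl
  rw [this, ← (Homeomorph.addLeft c).preimage_interior]
  rfl

theorem mem_interior_iff (h : IsBodyAt C c) (x : Plane) :
    x ∈ interior C ↔ gaugeAt C c (x - c) < 1 := by
  rw [← h.add_mem_interior_iff, add_sub_cancel]

theorem gaugeAt_mono (h : IsBodyAt C c) (hCD : C ⊆ D) (x : Plane) :
    gaugeAt D c x ≤ gaugeAt C c x :=
  gauge_mono (absorbent_nhds_zero h.preimage_mem_nhds) (preimage_mono hCD) x

theorem gaugeAt_combo_le (h : IsBodyAt C c) (a b : Plane) {s t : ℝ} (hs : 0 ≤ s) (ht : 0 ≤ t) :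
    gaugeAt C c (s • a + t • b) ≤ s * gaugeAt C c a + t * gaugeAt C c b := by
  rw [← gaugeAt_smul C c a hs, ← gaugeAt_smul C c b ht]
  exact h.gaugeAt_add_le _ _

/-- The ray may start anywhere in `C`: by subadditivity, the gauge of `s • d` is bounded
independently of `s`. -/
theorem gaugeAt_eq_zero_of_ray (h : IsBodyAt C c) {y d : Plane}
    (hd : ∀ s : ℝ, 0 ≤ s → y + s • d ∈ C) : gaugeAt C c d = 0 := by
  refine le_antisymm ?_ (gaugeAt_nonneg _ _ _)
  by_contra! hpos
  have hM : ∀ s : ℝ, 0 ≤ s → s * gaugeAt C c d ≤ 1 + gaugeAt C c (c - y) := by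
    intro s hs
    have h1 := (h.mem_iff _).1 (hd s hs)
    have h2 := h.gaugeAt_add_le (y + s • d - c) (c - y)
    rw [show y + s • d - c + (c - y) = s • d by abel, gaugeAt_smul C c d hs] at h2
    linarith
  have h1 := gaugeAt_nonneg C c (c - y)
  have h2 := hM ((2 + gaugeAt C c (c - y)) / gaugeAt C c d) (by positivity)
  rw [div_mul_cancel₀ _ hpos.ne'] at h2
  linarith

end IsBodyAt

/-! ### Sectors of a convex set -/

/-- The translate of a closed cone with apex `c`. -/
def coneAt (c : Plane) (p : Plane × Plane) : Set Plane := {x | x - c ∈ closedCone p}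

theorem isClosed_coneAt (c : Plane) (p : Plane × Plane) : IsClosed (coneAt c p) := by
  have h1 : Continuous fun x => planeCross p.1 (x - c) :=
    (continuous_planeCross_right _).comp (continuous_id.sub continuous_const)
  have h2 : Continuous fun x => planeCross (x - c) p.2 := by
    simp_rw [fun x => planeCross_swap (x - c) p.2]
    exact ((continuous_planeCross_right _).comp (continuous_id.sub continuous_const)).neg
  exact (isClosed_le continuous_const h1).inter (isClosed_le continuous_const h2)

theorem isOpen_openConeAt (c : Plane) (p : Plane × Plane) : IsOpen {x | x - c ∈ openCone p} := by
  have h1 : Continuous fun x => planeCross p.1 (x - c) :=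
    (continuous_planeCross_right _).comp (continuous_id.sub continuous_const)
  have h2 : Continuous fun x => planeCross (x - c) p.2 := by
    simp_rw [fun x => planeCross_swap (x - c) p.2]
    exact ((continuous_planeCross_right _).comp (continuous_id.sub continuous_const)).neg
  exact (isOpen_lt continuous_const h1).inter (isOpen_lt continuous_const h2)

theorem combo_mem_closedCone {a b : Plane} (hab : 0 < planeCross a b) {s t : ℝ} (hs : 0 ≤ s)
    (ht : 0 ≤ t) : s • a + t • b ∈ closedCone (a, b) := by
  rw [mem_closedCone, planeCross_combo_left, planeCross_combo_right]
  exact ⟨mul_nonneg ht hab.le, mul_nonneg hs hab.le⟩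

theorem exists_combo_of_mem_closedCone {a b x : Plane} (hab : 0 < planeCross a b)
    (hx : x ∈ closedCone (a, b)) : ∃ s t : ℝ, 0 ≤ s ∧ 0 ≤ t ∧ x = s • a + t • b :=
  ⟨_, _, div_nonneg hx.2 hab.le, div_nonneg hx.1 hab.le, eq_combo_of_planeCross hab.ne' x⟩

theorem exists_smul_of_mem_closedCone_diff {p : Plane × Plane} {x : Plane}
    (hp : 0 < planeCross p.1 p.2) (hx : x ∈ closedCone p) (hxo : x ∉ openCone p) :
    ∃ s : ℝ, 0 ≤ s ∧ (x = s • p.1 ∨ x = s • p.2) := by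
  have h := eq_combo_of_planeCross hp.ne' x
  by_cases h1 : 0 < planeCross p.1 x
  · have h2 : planeCross x p.2 = 0 := le_antisymm (not_lt.1 fun h2 => hxo ⟨h1, h2⟩) hx.2
    rw [h2, zero_div, zero_smul, zero_add] at h
    exact ⟨_, div_nonneg hx.1 hp.le, Or.inr h⟩
  · have h2 : planeCross p.1 x = 0 := le_antisymm (not_lt.1 h1) hx.1
    rw [h2, zero_div, zero_smul, add_zero] at h
    exact ⟨_, div_nonneg hx.2 hp.le, Or.inl h⟩

theorem add_smul_mem_openCone {p : Plane × Plane} {x y : Plane} (hx : x ∈ closedCone p)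
    (hy : y ∈ openCone p) {t : ℝ} (ht : 0 < t) : x + t • y ∈ openCone p := by
  refine ⟨?_, ?_⟩
  · rw [planeCross_add_right, planeCross_smul_right]
    exact add_pos_of_nonneg_of_pos hx.1 (mul_pos ht hy.1)
  · rw [planeCross_add_left, planeCross_smul_left]
    exact add_pos_of_nonneg_of_pos hx.2 (mul_pos ht hy.2)

theorem smul_mem_openCone {p : Plane × Plane} {x : Plane} (hx : x ∈ openCone p) {t : ℝ}
    (ht : 0 < t) : t • x ∈ openCone p := by
  refine ⟨?_, ?_⟩
  · rw [planeCross_smul_right]; exact mul_pos ht hx.1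
  · rw [planeCross_smul_left]; exact mul_pos ht hx.2

theorem smul_mem_closedCone {p : Plane × Plane} {x : Plane} (hx : x ∈ closedCone p) {t : ℝ}
    (ht : 0 ≤ t) : t • x ∈ closedCone p := by
  refine ⟨?_, ?_⟩
  · rw [planeCross_smul_right]; exact mul_nonneg ht hx.1
  · rw [planeCross_smul_left]; exact mul_nonneg ht hx.2

theorem combo_mem_openCone {p : Plane × Plane} {x y : Plane} (hx : x ∈ openCone p)
    (hy : y ∈ closedCone p) {s t : ℝ} (hs : 0 < s) (ht : 0 ≤ t) :
    s • x + t • y ∈ openCone p := by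
  rw [add_comm]
  exact add_smul_mem_openCone (smul_mem_closedCone hy ht) hx hs

theorem bisector_mem_openCone {a b : Plane} (hab : 0 < planeCross a b) :
    a + b ∈ openCone (a, b) := by
  rw [mem_openCone, planeCross_add_right, planeCross_add_left]
  simpa using hab

theorem interior_coneAt_subset {c : Plane} {p : Plane × Plane} (hp : 0 < planeCross p.1 p.2) :
    interior (coneAt c p) ⊆ {x | x - c ∈ openCone p} := by
  intro x hx
  have hcont : Continuous fun t : ℝ => x - t • (p.1 + p.2) := by fun_prop
  have hnhds : ∀ᶠ t : ℝ in nhds 0, x - t • (p.1 + p.2) ∈ interior (coneAt c p) :=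
    hcont.continuousAt.eventually_mem (isOpen_interior.mem_nhds (by simpa using hx))
  obtain ⟨ε, hε, hball⟩ := Metric.eventually_nhds_iff.1 hnhds
  have h1 := interior_subset (hball (y := ε / 2) (by
    rw [Real.dist_eq, sub_zero, abs_of_pos (half_pos hε)]; exact half_lt_self hε))
  have h2 := add_smul_mem_openCone h1 (bisector_mem_openCone hp) (half_pos hε)
  rwa [show x - (ε / 2) • (p.1 + p.2) - c + (ε / 2) • (p.1 + p.2) = x - c by abel] at h2

namespace IsBodyAt

variable {C D : Set Plane} {c a b : Plane}

theorem coneTriangle_subset (h : IsBodyAt C c) (hab : 0 < planeCross a b) :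
    coneTriangle c a b (gaugeAt C c a) (gaugeAt C c b) ⊆ C ∩ coneAt c (a, b) := by
  rintro x ⟨s, t, hs, ht, hst, rfl⟩
  rw [add_assoc]
  refine ⟨(h.add_mem_iff _).2 ((h.gaugeAt_combo_le a b hs ht).trans hst), ?_⟩
  change c + (s • a + t • b) - c ∈ closedCone (a, b)
  rw [add_sub_cancel_left]
  exact combo_mem_closedCone hab hs ht

/-- A sector on which the gauge is linear is a triangle. -/
theorem inter_coneAt_eq_of_linear (h : IsBodyAt C c) (hab : 0 < planeCross a b)
    (hlin : ∀ s t : ℝ, 0 ≤ s → 0 ≤ t →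
      s * gaugeAt C c a + t * gaugeAt C c b ≤ gaugeAt C c (s • a + t • b)) :
    C ∩ coneAt c (a, b) = coneTriangle c a b (gaugeAt C c a) (gaugeAt C c b) := by
  refine subset_antisymm ?_ (h.coneTriangle_subset hab)
  rintro x ⟨hxC, hx⟩
  obtain ⟨s, t, hs, ht, hst⟩ := exists_combo_of_mem_closedCone hab hx
  refine ⟨s, t, hs, ht, (hlin s t hs ht).trans ?_, ?_⟩
  · rw [← hst]; exact (h.mem_iff x).1 hxC
  · rw [add_assoc, ← hst]; abel

theorem planeCross_le_gaugeAt (h : IsBodyAt C c) {w : Plane}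
    (hw : ∀ x ∈ C, planeCross w (x - c) ≤ 1) (x : Plane) : planeCross w x ≤ gaugeAt C c x := by
  refine le_of_forall_gt_imp_ge_of_dense fun r hr => ?_
  have hr0 : 0 < r := (gaugeAt_nonneg C c x).trans_lt hr
  have h1 : c + r⁻¹ • x ∈ C := by
    rw [h.add_mem_iff, gaugeAt_smul C c x (inv_nonneg.2 hr0.le), inv_mul_le_iff₀ hr0, mul_one]
    exact hr.le
  have h2 := hw _ h1
  rwa [add_sub_cancel_left, planeCross_smul_right, inv_mul_le_iff₀ hr0, mul_one] at h2

/-- A face of `C` that meets an open cone, but has no end in it, spans the whole cone. -/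
theorem face_spans_cone (h : IsBodyAt C c) {p : Plane × Plane} {w y : Plane} {σ : Set Plane}
    (hσ : IsClosed σ) (hσ' : Convex ℝ σ) (hσC : σ ⊆ C)
    (hwC : ∀ x ∈ C, planeCross w (x - c) ≤ 1) (hwσ : ∀ x ∈ σ, planeCross w (x - c) = 1)
    (hext : ∀ v ∈ σ.extremePoints ℝ, v - c ∉ openCone p)
    (hrec : ∀ d ∈ openCone p, planeCross w d = 0 → ¬ ∀ s : ℝ, 0 ≤ s → y + s • d ∈ σ)
    (hy : y ∈ σ) (hyp : y - c ∈ openCone p) :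
    (∀ x ∈ closedCone p, planeCross w x = 1 → c + x ∈ σ) ∧
      ∀ x ∈ closedCone p, gaugeAt C c x = planeCross w x := by
  set y0 := y - c with hy0
  have hwy : planeCross w y0 = 1 := hwσ y hy
  have hyc : y = c + y0 := by rw [hy0]; abel
  have hw0 : w ≠ 0 := by rintro rfl; simp at hwy
  -- On the way from `y` to a point outside `σ` but in the open cone, the last point of `σ` is an
  -- extreme point, because `σ` lies on a line. It is in the open cone, which `hext` forbids.
  have hopen : ∀ x ∈ openCone p, planeCross w x = 1 → c + x ∈ σ := by
    intro x hx hwx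
    by_contra hxσ
    set d := x - y0 with hd
    have hd0 : d ≠ 0 := by
      intro h0
      rw [hd, sub_eq_zero] at h0
      rw [h0, ← hyc] at hxσ
      exact hxσ hy
    have hwd : planeCross w d = 0 := by rw [hd, planeCross_sub_right, hwx, hwy]; ring
    let S : Set ℝ := {t | c + y0 + t • d ∈ σ}
    have hSc : IsClosed S := hσ.preimage (by fun_prop : Continuous fun t : ℝ => c + y0 + t • d)
    have hS0 : (0 : ℝ) ∈ S := by change c + y0 + (0 : ℝ) • d ∈ σ; rw [zero_smul, add_zero, ← hyc]; exact hy
    have hS1 : (1 : ℝ) ∉ S := by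
      change ¬ c + y0 + (1 : ℝ) • d ∈ σ
      rw [one_smul, hd, add_assoc, add_sub_cancel]; exact hxσ
    have hSconv : Convex ℝ S := by
      intro t ht u hu α β hα hβ hαβ
      have h1 := hσ' ht hu hα hβ hαβ
      have h2 : α • (c + y0 + t • d) + β • (c + y0 + u • d) = c + y0 + (α • t + β • u) • d := by
        have : c + y0 = (α + β) • (c + y0) := by rw [hαβ, one_smul]
        conv_rhs => rw [this]
        simp only [smul_eq_mul]
        module
      rw [h2] at h1
      exact h1
    have hSub : ∀ t ∈ S, t ≤ 1 := by
      intro t ht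
      by_contra! hc
      exact hS1 (hSconv.ordConnected.out hS0 ht ⟨zero_le_one, hc.le⟩)
    have hτ : sSup S ∈ S := hSc.csSup_mem ⟨0, hS0⟩ ⟨1, hSub⟩
    have hτ0 : 0 ≤ sSup S := le_csSup ⟨1, hSub⟩ hS0
    have hτ1 : sSup S < 1 := lt_of_le_of_ne (hSub _ hτ) (fun h0 => hS1 (h0 ▸ hτ))
    have hpar : ∀ z ∈ σ, ∃ t ∈ S, z = c + y0 + t • d := by
      intro z hz
      have h1 : planeCross w (z - c - y0) = 0 := by
        rw [planeCross_sub_right, hwσ z hz, hwy]; ring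
      obtain ⟨α, hα⟩ := exists_smul_of_planeCross_eq_zero hw0 hwd
      obtain ⟨β, hβ⟩ := exists_smul_of_planeCross_eq_zero hw0 h1
      have hα0 : α ≠ 0 := by
        rintro rfl
        rw [zero_smul] at hα; exact hd0 hα
      have h2 : z = c + y0 + (β / α) • d := by
        rw [hα, smul_smul, div_mul_cancel₀ _ hα0, ← hβ]; abel
      exact ⟨β / α, by change c + y0 + (β / α) • d ∈ σ; rw [← h2]; exact hz, h2⟩
    refine hext (c + y0 + sSup S • d) ⟨hτ, ?_⟩ ?_
    · intro x1 hx1 x2 hx2 hx12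
      obtain ⟨t1, ht1, rfl⟩ := hpar x1 hx1
      obtain ⟨t2, ht2, rfl⟩ := hpar x2 hx2
      obtain ⟨α, β, hα, hβ, hαβ, he⟩ := hx12
      have h1 := le_csSup ⟨1, hSub⟩ ht1
      have h2 := le_csSup ⟨1, hSub⟩ ht2
      have h3 : (α * t1 + β * t2 - sSup S) • d = 0 := by
        have h4 : α • (c + y0 + t1 • d) + β • (c + y0 + t2 • d)
            = (α + β) • (c + y0) + (α * t1 + β * t2) • d := by module
        rw [h4, hαβ, one_smul, add_right_inj] at he
        rw [sub_smul, he, sub_self]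
      have h4 := (smul_eq_zero.1 h3).resolve_right hd0
      have h5 : α * (sSup S - t1) + β * (sSup S - t2) = 0 := by
        have : (α + β) * sSup S = sSup S := by rw [hαβ, one_mul]
        linarith
      have h6 : sSup S - t1 = 0 := by
        by_contra h0
        have := mul_pos hα (lt_of_le_of_ne (sub_nonneg.2 h1) (Ne.symm h0))
        have := mul_nonneg hβ.le (sub_nonneg.2 h2)
        linarith
      rw [show t1 = sSup S by linarith]
    · have h1 : c + y0 + sSup S • d - c = (1 - sSup S) • y0 + sSup S • x := by
        rw [hd]; module
      rw [h1]
      exact combo_mem_openCone hyp (openCone_subset_closedCone _ hx) (by linarith) hτ0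
  have hclosed : ∀ x ∈ closedCone p, planeCross w x = 1 → c + x ∈ σ := by
    intro x hx hwx
    have h1 : openSegment ℝ y (c + x) ⊆ σ := by
      rintro _ ⟨s, t, hs, ht, hst, rfl⟩
      have h2 : s • y + t • (c + x) = c + (s • y0 + t • x) := by
        have : c = (s + t) • c := by rw [hst, one_smul]
        rw [hyc]
        conv_rhs => rw [this]
        module
      rw [h2]
      refine hopen _ (combo_mem_openCone hyp hx hs ht.le) ?_
      rw [planeCross_add_right, planeCross_smul_right, planeCross_smul_right, hwy, hwx]
      linarith
    have h3 := closure_minimal h1 hσ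
    rw [closure_openSegment] at h3
    exact h3 (right_mem_segment ℝ _ _)
  refine ⟨hclosed, fun x hx => le_antisymm ?_ (h.planeCross_le_gaugeAt hwC x)⟩
  have hpos : ∀ x ∈ closedCone p, 0 < planeCross w x → gaugeAt C c x ≤ planeCross w x := by
    intro x hx hwx
    have h1 := hσC (hclosed ((planeCross w x)⁻¹ • x) (smul_mem_closedCone hx (inv_nonneg.2 hwx.le))
      (by rw [planeCross_smul_right, inv_mul_cancel₀ hwx.ne']))
    rwa [h.add_mem_iff, gaugeAt_smul C c x (inv_nonneg.2 hwx.le), inv_mul_le_iff₀ hwx, mul_one]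
      at h1
  rcases lt_trichotomy 0 (planeCross w x) with hwx | hwx | hwx
  · exact hpos x hx hwx
  -- Directions parallel to the face are approximated by `x + δ • y0`; the error is at most `δ * M`,
  -- so `δ = ε / M` suffices.
  · rw [← hwx]
    refine le_of_forall_pos_le_add fun ε hε => ?_
    set M := 1 + gaugeAt C c (-y0) with hM
    have hM0 : 0 < M := by have := gaugeAt_nonneg C c (-y0); linarith
    have hδ : 0 < ε / M := div_pos hε hM0
    have h1 := hpos (x + (ε / M) • y0)
      (openCone_subset_closedCone _ (add_smul_mem_openCone hx hyp hδ))
      (by rw [planeCross_add_right, planeCross_smul_right, ← hwx, hwy]; linarith)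
    rw [planeCross_add_right, planeCross_smul_right, ← hwx, hwy, zero_add, mul_one] at h1
    have h2 := h.gaugeAt_add_le (x + (ε / M) • y0) ((ε / M) • (-y0))
    rw [show x + (ε / M) • y0 + (ε / M) • (-y0) = x by module, gaugeAt_smul C c _ hδ.le] at h2
    have h3 : ε / M + ε / M * gaugeAt C c (-y0) = ε := by
      rw [← mul_one_add, ← hM, div_mul_cancel₀ _ hM0.ne']
    linarith
  -- If the form were negative at `x`, the cone would contain in its interior a direction parallel
  -- to the face, and the whole ray from `y` in this direction would lie in `σ`.
  · exfalso
    have hd : (-planeCross w x) • y0 + (1 : ℝ) • x ∈ openCone p :=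
      combo_mem_openCone hyp hx (by linarith) zero_le_one
    have hwd : planeCross w ((-planeCross w x) • y0 + (1 : ℝ) • x) = 0 := by
      rw [planeCross_add_right, planeCross_smul_right, planeCross_smul_right, hwy]; ring
    refine hrec _ hd hwd fun s hs => ?_
    have h1 := hclosed (y0 + s • ((-planeCross w x) • y0 + (1 : ℝ) • x))
      (by
        have := combo_mem_openCone hyp (openCone_subset_closedCone _ hd) one_pos hs
        rw [one_smul] at this
        exact openCone_subset_closedCone _ this)
      (by rw [planeCross_add_right, planeCross_smul_right, hwd, hwy]; ring)
    rw [hyc, add_assoc]; exact h1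

/-- The linear functional that takes the values `A` and `B` at `a` and `b`. -/
noncomputable def sectorForm (a b : Plane) (A B : ℝ) (x : Plane) : ℝ :=
  (A * planeCross x b + B * planeCross a x) / planeCross a b

theorem sectorForm_combo (hab : planeCross a b ≠ 0) (A B s t : ℝ) :
    sectorForm a b A B (s • a + t • b) = s * A + t * B := by
  unfold sectorForm
  rw [planeCross_combo_left, planeCross_combo_right]
  field_simp

theorem sectorForm_add (a b : Plane) (A B : ℝ) (x y : Plane) :
    sectorForm a b A B (x + y) = sectorForm a b A B x + sectorForm a b A B y := by
  unfold sectorForm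
  rw [planeCross_add_left, planeCross_add_right]; ring

theorem sectorForm_smul (a b : Plane) (A B t : ℝ) (x : Plane) :
    sectorForm a b A B (t • x) = t * sectorForm a b A B x := by
  unfold sectorForm
  rw [planeCross_smul_left, planeCross_smul_right]; ring

theorem continuous_sectorForm (a b : Plane) (A B : ℝ) : Continuous (sectorForm a b A B) := by
  unfold sectorForm planeCross
  fun_prop

/-- The part of `D` beyond the chord of a sector. -/
def sectorCap (D : Set Plane) (c a b : Plane) (A B : ℝ) : Set Plane :=
  D ∩ {x | 1 ≤ sectorForm a b A B (x - c)}

theorem isCap_sectorCap {A B : ℝ} (hne : (interior (sectorCap D c a b A B)).Nonempty) :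
    IsCap D (sectorCap D c a b A B) := by
  refine ⟨hne, ?_⟩
  let n : Plane := !₂[(A * b 1 - B * a 1) / planeCross a b, (B * a 0 - A * b 0) / planeCross a b]
  have hn : ∀ x : Plane, ⟪n, x⟫ = sectorForm a b A B x := by
    intro x
    simp only [PiLp.inner_apply, Fin.sum_univ_two, n, sectorForm]
    simp [planeCross]
    ring
  refine ⟨n, 1 + ⟪n, c⟫, ?_, ?_⟩
  · intro h0
    obtain ⟨x, hx⟩ := hne
    have h1 : 1 ≤ sectorForm a b A B (x - c) := (interior_subset hx).2
    rw [← hn, h0, inner_zero_left] at h1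
    linarith
  · ext x
    simp only [sectorCap, mem_inter_iff, mem_ofPred_eq, ← hn, inner_sub_right]
    constructor <;> rintro ⟨h1, h2⟩ <;> exact ⟨h1, by linarith⟩

theorem disjoint_interior_coneTriangle_sectorCap (hab : 0 < planeCross a b) (A B : ℝ) :
    Disjoint (interior (coneTriangle c a b A B)) (interior (sectorCap D c a b A B)) := by
  rw [Set.disjoint_left]
  intro x hx1 hx2
  have hle : ∀ y ∈ coneTriangle c a b A B, sectorForm a b A B (y - c) ≤ 1 := by
    rintro y ⟨s, t, -, -, hst, rfl⟩
    rw [add_assoc, add_sub_cancel_left, sectorForm_combo hab.ne']; exact hst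
  have hge : ∀ y ∈ sectorCap D c a b A B, 1 ≤ sectorForm a b A B (y - c) := fun y hy => hy.2
  have hx : sectorForm a b A B (x - c) = 1 :=
    le_antisymm (hle x (interior_subset hx1)) (hge x (interior_subset hx2))
  have hcont : Continuous fun t : ℝ => x + t • (x - c) := by fun_prop
  have hnhds : ∀ᶠ t : ℝ in nhds 0, x + t • (x - c) ∈ interior (coneTriangle c a b A B) :=
    hcont.continuousAt.eventually_mem (isOpen_interior.mem_nhds (by simpa using hx1))
  obtain ⟨ε, hε, hball⟩ := Metric.eventually_nhds_iff.1 hnhds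
  have h1 := hle _ (interior_subset (hball (y := ε / 2) (by
    rw [Real.dist_eq, sub_zero, abs_of_pos (half_pos hε)]; exact half_lt_self hε)))
  rw [show x + (ε / 2) • (x - c) - c = (x - c) + (ε / 2) • (x - c) by abel, sectorForm_add,
    sectorForm_smul, hx] at h1
  linarith

/-- A sector in which `C` and a larger body `D` coincide is a triangle, or the union of a triangle
and a cap of `D`. -/
theorem inter_coneAt_eq_or (hC : IsBodyAt C c) (hD : IsBodyAt D c) (hab : 0 < planeCross a b)
    (hg : ∀ x ∈ closedCone (a, b), gaugeAt D c x = gaugeAt C c x) :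
    C ∩ coneAt c (a, b) = coneTriangle c a b (gaugeAt C c a) (gaugeAt C c b) ∨
    (IsCap D (sectorCap D c a b (gaugeAt C c a) (gaugeAt C c b)) ∧
      C ∩ coneAt c (a, b) = coneTriangle c a b (gaugeAt C c a) (gaugeAt C c b) ∪
        sectorCap D c a b (gaugeAt C c a) (gaugeAt C c b)) := by
  set A := gaugeAt C c a with hA
  set B := gaugeAt C c b with hB
  have hA0 : 0 ≤ A := gaugeAt_nonneg _ _ _
  have hB0 : 0 ≤ B := gaugeAt_nonneg _ _ _
  have hCD : D ∩ coneAt c (a, b) = C ∩ coneAt c (a, b) := by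
    ext x
    constructor <;> rintro ⟨h1, h2⟩ <;> refine ⟨?_, h2⟩
    · rw [hC.mem_iff, ← hg _ h2]; exact (hD.mem_iff x).1 h1
    · rw [hD.mem_iff, hg _ h2]; exact (hC.mem_iff x).1 h1
  have hcover : C ∩ coneAt c (a, b) ⊆ coneTriangle c a b A B ∪ sectorCap D c a b A B := by
    intro x hx
    rcases le_total (sectorForm a b A B (x - c)) 1 with h1 | h1
    · left
      obtain ⟨s, t, hs, ht, hst⟩ := exists_combo_of_mem_closedCone hab hx.2
      rw [hst, sectorForm_combo hab.ne'] at h1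
      exact ⟨s, t, hs, ht, h1, by rw [add_assoc, ← hst]; abel⟩
    · exact Or.inr ⟨(hCD.symm ▸ hx : x ∈ D ∩ coneAt c (a, b)).1, h1⟩
  have ha : gaugeAt D c a = A := hg a (by
    have := combo_mem_closedCone hab (zero_le_one' ℝ) (le_refl (0 : ℝ)); simpa using this)
  have hb : gaugeAt D c b = B := hg b (by
    have := combo_mem_closedCone hab (le_refl (0 : ℝ)) (zero_le_one' ℝ); simpa using this)
  -- Beyond the chord, `D` cannot leave the cone: adding back the negative multiple of `b` gives a
  -- multiple of `a`, and subadditivity of the gauge yields `s * A ≤ 1 - t * B`.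
  have out : ∀ s t : ℝ, gaugeAt D c (s • a + t • b) ≤ 1 → t < 0 → s * A + t * B ≤ 1 := by
    intro s t hg1 ht
    rcases le_or_gt s 0 with hs | hs
    · nlinarith [mul_nonneg (neg_nonneg.2 hs) hA0, mul_nonneg (neg_nonneg.2 ht.le) hB0]
    · have h1 := hD.gaugeAt_add_le (s • a + t • b) ((-t) • b)
      rw [show s • a + t • b + (-t) • b = s • a by module, gaugeAt_smul D c a hs.le,
        gaugeAt_smul D c b (by linarith), ha, hb] at h1
      linarith
  have out' : ∀ s t : ℝ, gaugeAt D c (s • a + t • b) ≤ 1 → s < 0 → s * A + t * B ≤ 1 := by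
    intro s t hg1 hs
    rcases le_or_gt t 0 with ht | ht
    · nlinarith [mul_nonneg (neg_nonneg.2 hs.le) hA0, mul_nonneg (neg_nonneg.2 ht) hB0]
    · have h1 := hD.gaugeAt_add_le (s • a + t • b) ((-s) • a)
      rw [show s • a + t • b + (-s) • a = t • b by module, gaugeAt_smul D c b ht.le,
        gaugeAt_smul D c a (by linarith), ha, hb] at h1
      linarith
  have hin : ∀ x ∈ D, 1 < sectorForm a b A B (x - c) → x ∈ coneAt c (a, b) := by
    intro x hx hx1
    have hx2 := eq_combo_of_planeCross hab.ne' (x - c)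
    have hxD := (hD.mem_iff x).1 hx
    by_contra hxc
    rw [hx2, sectorForm_combo hab.ne'] at hx1
    rw [hx2] at hxD
    change ¬ (0 ≤ planeCross a (x - c) ∧ 0 ≤ planeCross (x - c) b) at hxc
    rw [not_and_or, not_le, not_le] at hxc
    rcases hxc with h0 | h0
    · exact absurd hx1 (not_lt.2 (out _ _ hxD (div_neg_of_neg_of_pos h0 hab)))
    · exact absurd hx1 (not_lt.2 (out' _ _ hxD (div_neg_of_neg_of_pos h0 hab)))
  by_cases hne : ∃ y ∈ D, 1 < sectorForm a b A B (y - c)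
  · right
    obtain ⟨y, hyD, hy1⟩ := hne
    have hcont : Continuous fun x => sectorForm a b A B (x - c) :=
      (continuous_sectorForm a b A B).comp (continuous_id.sub continuous_const)
    have hint : (interior (sectorCap D c a b A B)).Nonempty := by
      have hycl : y ∈ closure (interior D) := by
        rw [hD.convex.closure_interior_eq_closure_of_nonempty_interior ⟨c, hD.mem_interior⟩]
        exact subset_closure hyD
      obtain ⟨z, hz1, hz2⟩ := mem_closure_iff.1 hycl _ (isOpen_lt continuous_const hcont) hy1
      refine ⟨z, interior_maximal (s := sectorCap D c a b A B)
        (t := {x | 1 < sectorForm a b A B (x - c)} ∩ interior D) ?_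
        ((isOpen_lt continuous_const hcont).inter isOpen_interior) ⟨hz1, hz2⟩⟩
      exact fun x hx => ⟨interior_subset hx.2, (show 1 < sectorForm a b A B (x - c) from hx.1).le⟩
    refine ⟨isCap_sectorCap hint, subset_antisymm hcover (union_subset
      (hC.coneTriangle_subset hab) ?_)⟩
    rw [← hCD]
    rintro x ⟨hxD, hx1⟩
    refine ⟨hxD, ?_⟩
    -- Points of `D` exactly on the chord line are limits of points strictly beyond it, along the
    -- segment to `y`.
    have hseg : openSegment ℝ x y ⊆ coneAt c (a, b) := by
      rintro _ ⟨s, t, hs, ht, hst, rfl⟩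
      refine hin _ (hD.convex hxD hyD hs.le ht.le hst) ?_
      have h1 : s • x + t • y - c = s • (x - c) + t • (y - c) := by
        have : c = (s + t) • c := by rw [hst, one_smul]
        conv_lhs => rw [this]
        module
      have h2 : 1 ≤ sectorForm a b A B (x - c) := hx1
      rw [h1, sectorForm_add, sectorForm_smul, sectorForm_smul]
      have h3 := mul_le_mul_of_nonneg_left h2 hs.le
      have h4 := mul_lt_mul_of_pos_left hy1 ht
      linarith
    have h3 := closure_minimal hseg (isClosed_coneAt c (a, b))
    rw [closure_openSegment] at h3
    exact h3 (left_mem_segment ℝ _ _)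
  · left
    push Not at hne
    refine subset_antisymm ?_ (hC.coneTriangle_subset hab)
    intro x hx
    obtain ⟨s, t, hs, ht, hst⟩ := exists_combo_of_mem_closedCone hab hx.2
    have h1 := hne x (hCD.symm ▸ hx : x ∈ D ∩ coneAt c (a, b)).1
    rw [hst, sectorForm_combo hab.ne'] at h1
    exact ⟨s, t, hs, ht, h1, by rw [add_assoc, ← hst]; abel⟩

end IsBodyAt

/-! ### Fans subordinate to a convex packing -/

/-- Of three distinct collinear points one lies strictly between the others, so it is not extreme.
-/
theorem exists_finset_extremePoints_of_line {σ : Set Plane} {w c : Plane} {r : ℝ} (hw : w ≠ 0)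
    (hσ : ∀ x ∈ σ, planeCross w (x - c) = r) :
    ∃ S : Finset Plane, S.card ≤ 2 ∧ (S : Set Plane) = σ.extremePoints ℝ := by
  have hmid : ∀ x ∈ σ.extremePoints ℝ, ∀ y ∈ σ.extremePoints ℝ, ∀ z ∈ σ.extremePoints ℝ,
      y ≠ x → y ≠ z → ¬ Wbtw ℝ x y z := by
    intro x hx y hy z hz hyx hyz h
    have h1 : Sbtw ℝ x y z := ⟨h, hyx, hyz⟩
    have h2 : y ∈ openSegment ℝ x z := by
      rw [openSegment_eq_image_lineMap]
      exact h1.mem_image_Ioo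
    exact hyx (hy.2 hx.1 hz.1 h2).symm
  have hcard : (σ.extremePoints ℝ).encard ≤ 2 := by
    by_contra! h
    obtain ⟨t, ht, htc⟩ := Set.exists_subset_encard_eq (k := 3) (by
      simpa [show (2 : ℕ∞) + 1 = 3 by norm_num] using Order.add_one_le_of_lt h)
    obtain ⟨x, y, z, hxy, hxz, hyz, rfl⟩ := Set.encard_eq_three.1 htc
    have hx := ht (show x ∈ ({x, y, z} : Set Plane) by simp)
    have hy := ht (show y ∈ ({x, y, z} : Set Plane) by simp)
    have hz := ht (show z ∈ ({x, y, z} : Set Plane) by simp)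
    have hcol : Collinear ℝ {x, y, z} := by
      refine (collinear_iff_of_mem (p₀ := x) (by simp)).2 ⟨w, ?_⟩
      have hx' := hσ x hx.1
      have hline : ∀ u ∈ σ, ∃ t : ℝ, u = t • w +ᵥ x := by
        intro u hu
        have h1 : planeCross w (u - x) = 0 := by
          rw [show u - x = (u - c) - (x - c) by abel, planeCross_sub_right, hx', hσ u hu, sub_self]
        obtain ⟨t, ht⟩ := exists_smul_of_planeCross_eq_zero hw h1
        exact ⟨t, by rw [← ht, vadd_eq_add, sub_add_cancel]⟩
      rintro u (rfl | rfl | rfl)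
      · exact hline _ hx.1
      · exact hline _ hy.1
      · exact hline _ hz.1
    rcases hcol.wbtw_or_wbtw_or_wbtw with h | h | h
    · exact hmid x hx y hy z hz hxy.symm hyz h
    · exact hmid y hy z hz x hx hyz.symm hxz.symm h
    · exact hmid z hz x hx y hy hxz hxy h
  have hfin : (σ.extremePoints ℝ).Finite := Set.finite_of_encard_le_coe (k := 2) hcard
  refine ⟨hfin.toFinset, ?_, hfin.coe_toFinset⟩
  rw [hfin.encard_eq_coe_toFinset_card] at hcard
  exact_mod_cast hcard

namespace IsConvexPacking

variable {ι : Type*} {C : ι → Set Plane}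

theorem isBodyAt (hC : IsConvexPacking C) {i : ι} {c : Plane} (hc : c ∈ interior (C i)) :
    IsBodyAt (C i) c := ⟨hC.isClosed i, hC.convex i, hc⟩

theorem gaugeAt_eq_one (hC : IsConvexPacking C) {i j : ι} (hij : i ≠ j) {c x : Plane}
    (hc : c ∈ interior (C i)) (hx : x ∈ C i ∩ C j) : gaugeAt (C i) c (x - c) = 1 := by
  have h := hC.isBodyAt hc
  refine le_antisymm ((h.mem_iff x).1 hx.1) (not_lt.1 fun hlt => ?_)
  exact Set.disjoint_left.1 (hC.disjoint_interior_left hij) ((h.mem_interior_iff x).2 hlt) hx.2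

/-- The separating line at the midpoint of two shared points supports `C i` along the whole contact.
It misses the interior point `c`, so its form can be normalized to the value `1` on the contact. -/
theorem Contact.exists_line (hC : IsConvexPacking C) {i j : ι} (h : Contact C i j) {c : Plane}
    (hc : c ∈ interior (C i)) : ∃ w : Plane, w ≠ 0 ∧ (∀ x ∈ C i, planeCross w (x - c) ≤ 1) ∧
      ∀ x ∈ C i ∩ C j, planeCross w (x - c) = 1 := by
  obtain ⟨hij, hns⟩ := h
  rw [Set.not_subsingleton_iff] at hns
  obtain ⟨p, hp, q, hq, hpq⟩ := hns
  have hm : midpoint ℝ p q ∈ openSegment ℝ p q :=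
    ⟨1 / 2, 1 / 2, by norm_num, by norm_num, by norm_num, by
      rw [midpoint_eq_smul_add, invOf_eq_inv]; module⟩
  set m := midpoint ℝ p q
  have hmj := (hC.convex j).openSegment_subset hp.2 hq.2 hm
  obtain ⟨τ, hi, hj, hτ⟩ := hC.exists_side hij hpq hp.1 hq.1 hm hmj
  have hqp : q - p ≠ 0 := sub_ne_zero.2 hpq.symm
  have hκ : 0 < -(τ * planeCross (q - p) (c - m)) := by
    rw [neg_pos]
    refine lt_of_le_of_ne (hi c (interior_subset hc)) fun h0 => ?_
    obtain ⟨v, hv⟩ := exists_planeCross_ne_zero hqp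
    have hcont : Continuous fun t : ℝ => c + t • v := by fun_prop
    have hnhds : ∀ᶠ t : ℝ in nhds 0, c + t • v ∈ interior (C i) :=
      hcont.continuousAt.eventually_mem (isOpen_interior.mem_nhds (by simpa using hc))
    obtain ⟨ε, hε, hball⟩ := Metric.eventually_nhds_iff.1 hnhds
    have h1 := hi _ (interior_subset (hball (y := ε / 2) (by
      rw [Real.dist_eq, sub_zero, abs_of_pos (half_pos hε)]; exact half_lt_self hε)))
    have h2 := hi _ (interior_subset (hball (y := -(ε / 2)) (by
      rw [Real.dist_eq, sub_zero, abs_neg, abs_of_pos (half_pos hε)]; exact half_lt_self hε)))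
    rw [show c + (ε / 2) • v - m = (c - m) + (ε / 2) • v by abel, planeCross_add_right, mul_add,
      h0, planeCross_smul_right, zero_add] at h1
    rw [show c + (-(ε / 2)) • v - m = (c - m) + (-(ε / 2)) • v by abel, planeCross_add_right,
      mul_add, h0, planeCross_smul_right, zero_add] at h2
    have h3 : τ * (ε / 2 * planeCross (q - p) v) = 0 := by linarith
    exact mul_ne_zero hτ (mul_ne_zero (half_pos hε).ne' hv) h3
  set κ := -(τ * planeCross (q - p) (c - m))
  have hval : ∀ x, planeCross ((τ / κ) • (q - p)) (x - c)
      = τ * planeCross (q - p) (x - m) / κ + 1 := by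
    intro x
    rw [planeCross_smul_left, show x - c = (x - m) - (c - m) by abel, planeCross_sub_right]
    have : τ * planeCross (q - p) (c - m) = -κ := by simp [κ]
    field_simp
    linarith
  refine ⟨(τ / κ) • (q - p), smul_ne_zero (div_ne_zero hτ hκ.ne') hqp, fun x hx => ?_,
    fun x hx => ?_⟩
  · rw [hval]
    have := div_nonpos_of_nonpos_of_nonneg (hi x hx) hκ.le
    linarith
  · rw [hval, le_antisymm (hi x hx.1) (hj x hx.2), zero_div, zero_add]

/-- In a sector without contacts, a member coincides with any larger body inside the union. -/
theorem gaugeAt_eq_of_no_contact [Finite ι] (hC : IsConvexPacking C) {i : ι} {c : Plane}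
    (hc : c ∈ interior (C i)) {D : Set Plane} (hD : IsBodyAt D c) (hCD : C i ⊆ D)
    (hDC : D ⊆ ⋃ j, C j) {p : Plane × Plane} (hp : 0 < planeCross p.1 p.2)
    (hno : ∀ j, Contact C i j → ∀ x ∈ C i ∩ C j, x - c ∉ openCone p) :
    ∀ x ∈ closedCone p, gaugeAt D c x = gaugeAt (C i) c x := by
  have hB := hC.isBodyAt hc
  have key : ∀ x ∈ openCone p, gaugeAt (C i) c x ≤ gaugeAt D c x := by
    intro x hx
    by_contra! hlt
    have hx0 : x ≠ 0 := by
      rintro rfl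
      have := hx.1
      simp at this
    obtain ⟨w, hw⟩ := exists_planeCross_ne_zero hx0
    have hcont : Continuous fun t : ℝ => x + t • w := by fun_prop
    have hO : IsOpen {y | y ∈ openCone p ∧ gaugeAt D c y < gaugeAt (C i) c y} := by
      refine IsOpen.inter ?_ (isOpen_lt hD.continuous_gaugeAt hB.continuous_gaugeAt)
      simpa using isOpen_openConeAt 0 p
    have hnhds : ∀ᶠ t : ℝ in nhds 0,
        x + t • w ∈ {y | y ∈ openCone p ∧ gaugeAt D c y < gaugeAt (C i) c y} :=
      hcont.continuousAt.eventually_mem (hO.mem_nhds (by simpa using ⟨hx, hlt⟩))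
    obtain ⟨ε, hε, hball⟩ := Metric.eventually_nhds_iff.1 hnhds
    -- If the gauges differ at `x`, they differ on a short transversal `x + t • w`. In each of these
    -- directions the boundary point of `C i` is interior to `D`, so some other member must contain
    -- it.
    have hex : ∀ t : Ioo (-ε) ε, ∃ j, j ≠ i ∧ 0 < gaugeAt (C i) c (x + (t : ℝ) • w) ∧
        c + (gaugeAt (C i) c (x + (t : ℝ) • w))⁻¹ • (x + (t : ℝ) • w) ∈ C i ∩ C j ∧
        (gaugeAt (C i) c (x + (t : ℝ) • w))⁻¹ • (x + (t : ℝ) • w) ∈ openCone p := by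
      rintro ⟨t, ht⟩
      obtain ⟨h1, h2⟩ := hball (y := t) (by rw [Real.dist_eq, sub_zero, abs_lt]; exact ht)
      dsimp only
      set u := x + t • w
      have hG : 0 < gaugeAt (C i) c u := (gaugeAt_nonneg D c u).trans_lt h2
      set G := gaugeAt (C i) c u
      have hyC : gaugeAt (C i) c (G⁻¹ • u) = 1 := by
        rw [gaugeAt_smul _ _ _ (inv_nonneg.2 hG.le), inv_mul_cancel₀ hG.ne']
      have hyD : c + G⁻¹ • u ∈ interior D := by
        rw [hD.add_mem_interior_iff, gaugeAt_smul _ _ _ (inv_nonneg.2 hG.le), inv_mul_lt_iff₀ hG,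
          mul_one]
        exact h2
      have hj : ∃ j, j ≠ i ∧ c + G⁻¹ • u ∈ C j := by
        by_contra! hcon
        have hcl : IsClosed (⋃ j : {j // j ≠ i}, C j) :=
          isClosed_iUnion_of_finite fun j => hC.isClosed j
        have hsub : interior D ∩ (⋃ j : {j // j ≠ i}, C j)ᶜ ⊆ C i := by
          rintro z ⟨hz1, hz2⟩
          obtain ⟨k, hk⟩ := mem_iUnion.1 (hDC (interior_subset hz1))
          by_cases hki : k = i
          · exact hki ▸ hk
          · exact absurd (mem_iUnion.2 ⟨⟨k, hki⟩, hk⟩) hz2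
        have h3 := interior_maximal hsub (isOpen_interior.inter hcl.isOpen_compl)
          (show c + G⁻¹ • u ∈ _ from ⟨hyD, fun hz => by
            obtain ⟨k, hk⟩ := mem_iUnion.1 hz
            exact hcon k k.2 hk⟩)
        rw [hB.add_mem_interior_iff, hyC] at h3
        exact lt_irrefl _ h3
      obtain ⟨j, hji, hj⟩ := hj
      exact ⟨j, hji, hG, ⟨(hB.add_mem_iff _).2 hyC.le, hj⟩, smul_mem_openCone h1 (inv_pos.2 hG)⟩
    choose j hji hpos hmem hcone using hex
    -- Infinitely many directions and finitely many members: some `C j` receives two of the boundary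
    -- points. They are distinct, being on different rays, so `j` is a contact inside the open cone.
    have : Infinite (Ioo (-ε) ε) := (Ioo_infinite (by linarith)).to_subtype
    obtain ⟨t, t', htt, hjt⟩ := Finite.exists_ne_map_eq_of_infinite j
    have hsub : (C i ∩ C (j t)).Subsingleton := by
      by_contra hns
      refine hno (j t) ⟨(hji t).symm, hns⟩ _ (hmem t) ?_
      rw [add_sub_cancel_left]; exact hcone t
    have heq := hsub (hmem t) (by have := hmem t'; rwa [← hjt] at this)
    rw [add_right_inj] at heq
    set α := (gaugeAt (C i) c (x + (t : ℝ) • w))⁻¹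
    set β := (gaugeAt (C i) c (x + (t' : ℝ) • w))⁻¹
    have hα : 0 < α := inv_pos.2 (hpos t)
    have h1 := congrArg (fun z => planeCross z w) heq
    have h2 := congrArg (fun z => planeCross x z) heq
    simp only [planeCross_smul_left, planeCross_smul_right, planeCross_add_left,
      planeCross_add_right, planeCross_self, mul_zero, add_zero, zero_add] at h1 h2
    have hαβ : α = β := mul_right_cancel₀ hw h1
    rw [← hαβ] at h2
    have h3 := mul_right_cancel₀ hw (mul_left_cancel₀ hα.ne' h2)
    exact htt (Subtype.ext h3)
  intro x hx
  refine le_antisymm (hB.gaugeAt_mono hCD x) ?_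
  set e := p.1 + p.2
  have hcD : Continuous fun t : ℝ => gaugeAt D c (x + t • e) :=
    hD.continuous_gaugeAt.comp (by fun_prop)
  have hcC : Continuous fun t : ℝ => gaugeAt (C i) c (x + t • e) :=
    hB.continuous_gaugeAt.comp (by fun_prop)
  -- Continuity along the bisector extends the equality to the sides of the cone.
  have hsub : Ioi (0 : ℝ) ⊆ {t | gaugeAt (C i) c (x + t • e) ≤ gaugeAt D c (x + t • e)} :=
    fun t ht => key _ (add_smul_mem_openCone hx (bisector_mem_openCone hp) ht)
  have h0 := closure_minimal hsub (isClosed_le hcC hcD)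
  rw [closure_Ioi] at h0
  have h1 := h0 (self_mem_Ici : (0 : ℝ) ∈ Ici 0)
  simpa using h1

/-- Fans around the centres `c i` whose rays pass through all ends of contacts, and which
subdivide every contact in the same way from both sides. -/
structure IsSubordinateFan (C : ι → Set Plane) (c : ι → Plane)
    (W : ι → Finset (Plane × Plane)) : Prop where
  pos : ∀ i, ∀ p ∈ W i, 0 < planeCross p.1 p.2
  covers : ∀ i x, ∃ p ∈ W i, x ∈ closedCone p
  disjoint : ∀ i, ∀ p ∈ W i, ∀ q ∈ W i, p ≠ q → Disjoint (openCone p) (closedCone q)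
  notMem_extremePoints : ∀ i j, Contact C i j → ∀ p ∈ W i, ∀ x ∈ C i ∩ C j,
    x - c i ∈ openCone p → x ∉ (C i ∩ C j).extremePoints ℝ
  face : ∀ i j, Contact C i j → ∀ p ∈ W i, ∀ y ∈ C i ∩ C j, y - c i ∈ openCone p →
    ∃ w, (∀ x ∈ C i, planeCross w (x - c i) ≤ 1) ∧
      (∀ x ∈ closedCone p, planeCross w x = 1 → c i + x ∈ C i ∩ C j) ∧
      ∀ x ∈ closedCone p, gaugeAt (C i) (c i) x = planeCross w x
  mem_openCone : ∀ i j, Contact C i j → ∀ p ∈ W i, ∀ q ∈ W j, ∀ x ∈ C i ∩ C j,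
    x - c i ∈ openCone p → x - c j ∈ closedCone q → x - c j ∈ openCone q

theorem eq_of_mem_of_notMem_extremePoints (hC : IsConvexPacking C) {i j k : ι} (hij : i ≠ j)
    {x : Plane} (hx : x ∈ C i ∩ C j) (hxe : x ∉ (C i ∩ C j).extremePoints ℝ) (hxk : x ∈ C k) :
    k = i ∨ k = j := by
  rw [mem_extremePoints_iff_left] at hxe
  push Not at hxe
  obtain ⟨p, hp, q, hq, hxpq, hpx⟩ := hxe hx
  refine hC.eq_or_eq_of_mem_openSegment hij ?_ hp hq hxpq hxk
  rintro rfl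
  rw [openSegment_same] at hxpq
  exact hpx hxpq.symm

theorem exists_isSubordinateFan [Fintype ι] (hC : IsConvexPacking C) (c : ι → Plane)
    (hc : ∀ i, c i ∈ interior (C i)) :
    ∃ W, IsSubordinateFan C c W ∧ ∑ i, (W i).card ≤ 148 * Fintype.card ι := by
  classical
  have hB : ∀ i, IsBodyAt (C i) (c i) := fun i => hC.isBodyAt (hc i)
  have hline : ∀ i j, ∃ w : Plane, Contact C i j → w ≠ 0 ∧
      (∀ x ∈ C i, planeCross w (x - c i) ≤ 1) ∧ ∀ x ∈ C i ∩ C j, planeCross w (x - c i) = 1 := by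
    intro i j
    by_cases h : Contact C i j
    · obtain ⟨w, hw⟩ := h.exists_line hC (hc i)
      exact ⟨w, fun _ => hw⟩
    · exact ⟨0, fun h' => absurd h' h⟩
  choose w hw using hline
  have hS : ∀ σ : Set Plane, ∃ S : Finset Plane, (∃ i j, Contact C i j ∧ σ = C i ∩ C j) →
      S.card ≤ 2 ∧ (S : Set Plane) = σ.extremePoints ℝ := by
    intro σ
    by_cases h : ∃ i j, Contact C i j ∧ σ = C i ∩ C j
    · obtain ⟨i, j, hij, rfl⟩ := h
      obtain ⟨S, hS⟩ := exists_finset_extremePoints_of_line (hw i j hij).1 (hw i j hij).2.2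
      exact ⟨S, fun _ => hS⟩
    · exact ⟨∅, fun h' => absurd h' h⟩
  choose S hS using hS
  -- The points where the axis rays leave `C i`. A ray that never leaves has gauge `0` and gives the
  -- point `c i`, which belongs to no other member and is removed by the filter in `Q`.
  let hits : ι → Finset Plane := fun i =>
    axes.image fun d => c i + (gaugeAt (C i) (c i) d)⁻¹ • d
  let Q : ι → ι → Finset Plane := fun i j =>
    S (C i ∩ C j) ∪ (hits i ∪ hits j).filter (· ∈ C i ∩ C j)
  -- The directions in which the contact is unbounded; a sector containing one in its interior would
  -- not be cut off by the contact line.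
  let R : ι → ι → Finset Plane := fun i j =>
    ({w i j, -w i j} : Finset Plane).filter fun d =>
      ∃ y ∈ C i ∩ C j, ∀ s : ℝ, 0 ≤ s → y + s • d ∈ C i ∩ C j
  let F : ι → Finset Plane := fun i => (Finset.univ.filter (Contact C i)).biUnion fun j =>
    (Q i j).image (· - c i) ∪ R i j
  -- The same points subdivide a contact from both sides, axis hits of either centre included.
  have hQsymm : ∀ i j x, x ∈ Q i j → x ∈ Q j i := by
    intro i j x hx
    simp only [Q, Finset.mem_union, Finset.mem_filter] at hx ⊢
    rw [inter_comm (C j)]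
    tauto
  have hQF : ∀ i j, Contact C i j → ∀ x ∈ Q i j, x - c i ∈ F i := fun i j hij x hx =>
    Finset.mem_biUnion.2 ⟨j, by simpa using hij,
      Finset.mem_union_left _ (Finset.mem_image_of_mem _ hx)⟩
  have hextQ : ∀ i j, Contact C i j → ∀ x ∈ (C i ∩ C j).extremePoints ℝ, x ∈ Q i j :=
    fun i j hij x hx => Finset.mem_union_left _ (by
      rw [← Finset.mem_coe, (hS _ ⟨i, j, hij, rfl⟩).2]; exact hx)
  have hQmem : ∀ i j, Contact C i j → ∀ x ∈ Q i j, x ∈ C i ∩ C j := by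
    intro i j hij x hx
    rcases Finset.mem_union.1 hx with h | h
    · rw [← Finset.mem_coe, (hS _ ⟨i, j, hij, rfl⟩).2] at h
      exact h.1
    · exact (Finset.mem_filter.1 h).2
  have hhits : ∀ i, (hits i).card ≤ 4 := fun i => Finset.card_image_le.trans card_axes_le
  have hQcard : ∀ i j, Contact C i j → (Q i j).card ≤ 10 := by
    intro i j hij
    have h1 := Finset.card_union_le (S (C i ∩ C j)) ((hits i ∪ hits j).filter (· ∈ C i ∩ C j))
    have h2 := Finset.card_filter_le (hits i ∪ hits j) (· ∈ C i ∩ C j)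
    have h3 := Finset.card_union_le (hits i) (hits j)
    have h4 := (hS _ ⟨i, j, hij, rfl⟩).1
    have h5 := hhits i
    have h6 := hhits j
    change (S (C i ∩ C j) ∪ (hits i ∪ hits j).filter (· ∈ C i ∩ C j)).card ≤ 10
    omega
  have hFcard : ∀ i, (F i).card ≤ 12 * (Finset.univ.filter (Contact C i)).card := by
    intro i
    rw [mul_comm]
    refine Finset.card_biUnion_le_card_mul _ _ _ fun j hj => ?_
    have h1 := Finset.card_union_le ((Q i j).image (· - c i)) (R i j)
    have h2 := Finset.card_image_le (s := Q i j) (f := (· - c i))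
    have h3 := hQcard i j (Finset.mem_filter.1 hj).2
    have h4 : (R i j).card ≤ 2 := (Finset.card_filter_le _ _).trans Finset.card_le_two
    omega
  choose W hW hWcard using fun i => exists_isFan (F i)
  have hnotF : ∀ i, ∀ p ∈ W i, ∀ u ∈ F i, u ∉ openCone p := fun i p hp u hu =>
    (hW i).notMem u (Finset.mem_union_left _ hu) p hp
  have hne : ∀ i j, Contact C i j → ∀ p ∈ W i, ∀ x ∈ C i ∩ C j,
      x - c i ∈ openCone p → x ∉ (C i ∩ C j).extremePoints ℝ := fun i j hij p hp x _ hxp hxe =>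
    hnotF i p hp _ (hQF i j hij x (hextQ i j hij x hxe)) hxp
  refine ⟨W, ⟨fun i => (hW i).pos, fun i => (hW i).covers, fun i => (hW i).disjoint, hne, ?_, ?_⟩,
    ?_⟩
  · intro i j hij p hp y hy hyp
    obtain ⟨hw0, hwC, hwσ⟩ := hw i j hij
    refine ⟨w i j, hwC, ?_⟩
    refine (hB i).face_spans_cone ((hC.isClosed i).inter (hC.isClosed j))
      ((hC.convex i).inter (hC.convex j)) inter_subset_left hwC hwσ ?_ ?_ hy hyp
    · exact fun v hv hvp => hne i j hij p hp v hv.1 hvp hv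
    · intro d hd hwd hray
      obtain ⟨t, rfl⟩ := exists_smul_of_planeCross_eq_zero hw0 hwd
      have hR : ∀ e ∈ ({w i j, -w i j} : Finset Plane), ∀ r : ℝ, 0 < r → t • w i j = r • e →
          False := by
        intro e he r hr hre
        have heo : e ∈ openCone p := by
          have := smul_mem_openCone hd (inv_pos.2 hr)
          rwa [hre, smul_smul, inv_mul_cancel₀ hr.ne', one_smul] at this
        refine hnotF i p hp e (Finset.mem_biUnion.2 ⟨j, by simpa using hij,
          Finset.mem_union_right _ (Finset.mem_filter.2 ⟨he, y, hy, fun s hs => ?_⟩)⟩) heo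
        have h1 := hray (s * r⁻¹) (mul_nonneg hs (inv_nonneg.2 hr.le))
        rwa [hre, smul_smul, mul_assoc, inv_mul_cancel₀ hr.ne', mul_one] at h1
      rcases lt_trichotomy t 0 with ht | ht | ht
      · exact hR (-w i j) (by simp) (-t) (by linarith) (by module)
      · rw [ht, zero_smul] at hd
        have := hd.1
        simp at this
      · exact hR (w i j) (by simp) t ht rfl
  · intro i j hij p hp q hq x hx hxp hxq
    by_contra hxo
    have hxe := hne i j hij p hp x hx hxp
    have hgx : gaugeAt (C j) (c j) (x - c j) = 1 := hC.gaugeAt_eq_one hij.1.symm (hc j) hx.symm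
    suffices hxQ : x ∈ Q j i from hnotF i p hp _ (hQF i j hij x (hQsymm j i x hxQ)) hxp
    -- A point of the contact on a ray of the fan at `c j` is a subdivision point. Rays to points of
    -- `Q j k` reach the boundary exactly there, and `k = i` since `x` is not an end of the contact;
    -- recession rays never reach the boundary; an axis ray reaches it at a point of `hits j`.
    have key : ∀ s : ℝ, 0 ≤ s → ∀ d ∈ F j ∪ axes, x - c j = s • d → x ∈ Q j i := by
      intro s hs d hd hsd
      rw [hsd, gaugeAt_smul _ _ _ hs] at hgx
      rcases Finset.mem_union.1 hd with hd | hd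
      · obtain ⟨k, hk, hd⟩ := Finset.mem_biUnion.1 hd
        have hjk : Contact C j k := (Finset.mem_filter.1 hk).2
        rcases Finset.mem_union.1 hd with hd | hd
        · obtain ⟨v, hv, rfl⟩ := Finset.mem_image.1 hd
          have hvm := hQmem j k hjk v hv
          rw [hC.gaugeAt_eq_one hjk.1 (hc j) hvm, mul_one] at hgx
          rw [hgx, one_smul, sub_left_inj] at hsd
          subst hsd
          rcases hC.eq_of_mem_of_notMem_extremePoints hij.1 hx hxe hvm.2 with h | h
          · exact h ▸ hv
          · exact absurd h.symm hjk.1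
        · exfalso
          obtain ⟨-, y, -, hy⟩ := Finset.mem_filter.1 hd
          rw [(hB j).gaugeAt_eq_zero_of_ray fun s hs => (hy s hs).1, mul_zero] at hgx
          exact zero_ne_one hgx
      · have hs' : s = (gaugeAt (C j) (c j) d)⁻¹ := eq_inv_of_mul_eq_one_left hgx
        refine Finset.mem_union_right _ (Finset.mem_filter.2 ⟨Finset.mem_union_left _ ?_, hx.symm⟩)
        refine Finset.mem_image.2 ⟨d, hd, ?_⟩
        rw [← hs', ← hsd, add_sub_cancel]
    obtain ⟨s, hs, h | h⟩ := exists_smul_of_mem_closedCone_diff ((hW j).pos q hq) hxq hxo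
    · exact key s hs _ ((hW j).fst_mem q hq) h
    · exact key s hs _ ((hW j).snd_mem q hq) h
  · have hdeg : ∑ i, (Finset.univ.filter (Contact C i)).card ≤ 12 * Fintype.card ι := by
      rw [← Finset.card_sigma, ← Finset.card_image_of_injective
        (f := fun x : (_ : ι) × ι => (x.1, x.2)) _ (fun x y h => by
          rcases x with ⟨x1, x2⟩; rcases y with ⟨y1, y2⟩
          simp only [Prod.mk.injEq] at h
          obtain ⟨rfl, rfl⟩ := h
          rfl)]
      refine hC.card_contact_le _ fun p hp => ?_
      obtain ⟨x, hx, rfl⟩ := Finset.mem_image.1 hp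
      exact (Finset.mem_filter.1 (Finset.mem_sigma.1 hx).2).2
    -- Each contact contributes at most `10` points (two ends and eight axis hits) and two recession
    -- directions. With at most `12` ordered contacts per member on average and four axes, this is
    -- `12 * 12 + 4 = 148`.
    calc ∑ i, (W i).card ≤ ∑ i, (12 * (Finset.univ.filter (Contact C i)).card + 4) :=
          Finset.sum_le_sum fun i _ => (hWcard i).trans (Nat.add_le_add_right (hFcard i) 4)
      _ = 12 * ∑ i, (Finset.univ.filter (Contact C i)).card + 4 * Fintype.card ι := by
          rw [Finset.sum_add_distrib, ← Finset.mul_sum, Finset.sum_const, Finset.card_univ,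
            smul_eq_mul, mul_comm 4]
      _ ≤ 148 * Fintype.card ι := by omega

end IsConvexPacking

/-! ### Confined triangulations -/

/-- The sides of a pointed cone are faces: if a positive combination lies on a side, so do both `x`
and `y`. -/
theorem eq_smul_of_combo_notMem_openCone {p : Plane × Plane} (hp : 0 < planeCross p.1 p.2)
    {x y : Plane} (hx : x ∈ closedCone p) (hy : y ∈ closedCone p) {α β : ℝ} (hα : 0 < α)
    (hβ : 0 < β) (h : α • x + β • y ∉ openCone p) :
    ∃ r : ℝ, 0 ≤ r ∧ x = r • (α • x + β • y) := by
  have key : ∀ (d : Plane) (s t : ℝ), 0 ≤ s → 0 ≤ t → x = s • d → y = t • d →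
      ∃ r : ℝ, 0 ≤ r ∧ x = r • (α • x + β • y) := by
    rintro d s t hs ht rfl rfl
    rcases hs.eq_or_lt with rfl | hs
    · exact ⟨0, le_rfl, by simp⟩
    · have h0 : 0 < α * s + β * t := by positivity
      refine ⟨s / (α * s + β * t), by positivity, ?_⟩
      rw [smul_smul α, smul_smul β, ← add_smul, smul_smul, div_mul_cancel₀ _ h0.ne']
  have hx' := eq_combo_of_planeCross hp.ne' x
  have hy' := eq_combo_of_planeCross hp.ne' y
  have hsum : ∀ u v : ℝ, 0 ≤ u → 0 ≤ v → ¬ 0 < α * u + β * v → u = 0 ∧ v = 0 := by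
    intro u v hu hv huv
    have h1 := mul_nonneg hα.le hu
    have h2 := mul_nonneg hβ.le hv
    exact ⟨(mul_eq_zero.1 (by linarith : α * u = 0)).resolve_left hα.ne',
      (mul_eq_zero.1 (by linarith : β * v = 0)).resolve_left hβ.ne'⟩
  by_cases h1 : 0 < α * planeCross p.1 x + β * planeCross p.1 y
  · have h2 : ¬ 0 < α * planeCross x p.2 + β * planeCross y p.2 := fun h2 => h ⟨by
      rwa [planeCross_add_right, planeCross_smul_right, planeCross_smul_right], by
      rwa [planeCross_add_left, planeCross_smul_left, planeCross_smul_left]⟩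
    obtain ⟨h3, h4⟩ := hsum _ _ hx.2 hy.2 h2
    rw [h3, zero_div, zero_smul, zero_add] at hx'
    rw [h4, zero_div, zero_smul, zero_add] at hy'
    exact key _ _ _ (div_nonneg hx.1 hp.le) (div_nonneg hy.1 hp.le) hx' hy'
  · obtain ⟨h3, h4⟩ := hsum _ _ hx.1 hy.1 h1
    rw [h3, zero_div, zero_smul, add_zero] at hx'
    rw [h4, zero_div, zero_smul, add_zero] at hy'
    exact key _ _ _ (div_nonneg hx.2 hp.le) (div_nonneg hy.2 hp.le) hx' hy'

/-- The triangle cut off from a sector of `C` by the chord between the ends of its two sides. -/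
noncomputable def sectorTriangle (C : Set Plane) (c : Plane) (p : Plane × Plane) : Set Plane :=
  coneTriangle c p.1 p.2 (gaugeAt C c p.1) (gaugeAt C c p.2)

theorem isTriangle_sectorTriangle (C : Set Plane) (c : Plane) {p : Plane × Plane}
    (hp : 0 < planeCross p.1 p.2) : IsTriangle (sectorTriangle C c p) :=
  isTriangle_coneTriangle hp.ne' c (gaugeAt_nonneg _ _ _) (gaugeAt_nonneg _ _ _)

theorem fst_mem_closedCone {p : Plane × Plane} (hp : 0 < planeCross p.1 p.2) :
    p.1 ∈ closedCone p := ⟨(planeCross_self _).ge, hp.le⟩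

theorem snd_mem_closedCone {p : Plane × Plane} (hp : 0 < planeCross p.1 p.2) :
    p.2 ∈ closedCone p := ⟨hp.le, (planeCross_self _).ge⟩

theorem IsBodyAt.inter_coneAt_eq_sectorTriangle {C : Set Plane} {c w : Plane} {p : Plane × Plane}
    (h : IsBodyAt C c) (hp : 0 < planeCross p.1 p.2)
    (hg : ∀ x ∈ closedCone p, gaugeAt C c x = planeCross w x) :
    C ∩ coneAt c p = sectorTriangle C c p := by
  refine h.inter_coneAt_eq_of_linear hp fun s t hs ht => ?_
  rw [hg _ (fst_mem_closedCone hp), hg _ (snd_mem_closedCone hp),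
    hg _ (combo_mem_closedCone hp hs ht), planeCross_add_right, planeCross_smul_right,
    planeCross_smul_right]

namespace IsConvexPacking.IsSubordinateFan

variable {ι : Type*} {C : ι → Set Plane} {c : ι → Plane} {W : ι → Finset (Plane × Plane)}

theorem iUnion_sectors (hW : IsSubordinateFan C c W) :
    (⋃ i, ⋃ p ∈ W i, C i ∩ coneAt (c i) p) = ⋃ i, C i := by
  refine iUnion_congr fun i => subset_antisymm (iUnion₂_subset fun _ _ => inter_subset_left) ?_
  intro x hx
  obtain ⟨p, hp, hxp⟩ := hW.covers i (x - c i)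
  exact mem_iUnion₂.2 ⟨p, hp, hx, hxp⟩

theorem disjoint_interior_sectors (hW : IsSubordinateFan C c W) (hC : IsConvexPacking C)
    {i j : ι} {p q : Plane × Plane} (hp : p ∈ W i) (hq : q ∈ W j)
    (hne : (⟨i, p⟩ : (_ : ι) × (Plane × Plane)) ≠ ⟨j, q⟩) :
    Disjoint (interior (C i ∩ coneAt (c i) p)) (interior (C j ∩ coneAt (c j) q)) := by
  by_cases hij : i = j
  · subst hij
    have hpq : p ≠ q := fun h => hne (by rw [h])
    rw [Set.disjoint_left]
    intro x hx1 hx2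
    exact Set.disjoint_left.1 (hW.disjoint i p hp q hq hpq)
      (interior_coneAt_subset (hW.pos i p hp) (interior_mono inter_subset_right hx1))
      (interior_subset hx2).2
  · exact (hC.disjoint_interior_left hij).mono (interior_mono inter_subset_left)
      (interior_subset.trans inter_subset_left)

/-- Every sector of a member of a packing of the plane is a triangle. -/
theorem sector_eq_of_iUnion_eq_univ [Finite ι] (hW : IsSubordinateFan C c W)
    (hC : IsConvexPacking C) (hc : ∀ i, c i ∈ interior (C i)) (hU : (⋃ i, C i) = univ) {i : ι}
    {p : Plane × Plane} (hp : p ∈ W i) :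
    C i ∩ coneAt (c i) p = sectorTriangle (C i) (c i) p := by
  by_cases h : ∃ j, Contact C i j ∧ ∃ x ∈ C i ∩ C j, x - c i ∈ openCone p
  · obtain ⟨j, hij, y, hy, hyp⟩ := h
    obtain ⟨w, -, -, hg⟩ := hW.face i j hij p hp y hy hyp
    exact (hC.isBodyAt (hc i)).inter_coneAt_eq_sectorTriangle (hW.pos i p hp) hg
  · push Not at h
    -- Comparison with the whole plane shows that the gauge vanishes, so that the sector is the
    -- entire cone.
    have hg := hC.gaugeAt_eq_of_no_contact (hc i) (D := univ)
      ⟨isClosed_univ, convex_univ, by simp⟩ (subset_univ _) hU.ge (hW.pos i p hp) h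
    refine (hC.isBodyAt (hc i)).inter_coneAt_eq_sectorTriangle (w := 0) (hW.pos i p hp) ?_
    intro x hx
    rw [← hg x hx, gaugeAt_univ, planeCross_zero_left]

/-- Every sector of a member of a packing is a triangle or the union of a triangle and a cap of any
larger body inside the union. -/
theorem sector_eq_or [Finite ι] (hW : IsSubordinateFan C c W) (hC : IsConvexPacking C)
    (hc : ∀ i, c i ∈ interior (C i)) {i : ι} {D : Set Plane} (hD : IsClosed D)
    (hD' : Convex ℝ D) (hCD : C i ⊆ D) (hDC : D ⊆ ⋃ j, C j) {p : Plane × Plane} (hp : p ∈ W i) :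
    C i ∩ coneAt (c i) p = sectorTriangle (C i) (c i) p ∨ ∃ A, IsCap D A ∧
      Disjoint (interior (sectorTriangle (C i) (c i) p)) (interior A) ∧
      C i ∩ coneAt (c i) p = sectorTriangle (C i) (c i) p ∪ A := by
  have hpos := hW.pos i p hp
  by_cases h : ∃ j, Contact C i j ∧ ∃ x ∈ C i ∩ C j, x - c i ∈ openCone p
  · obtain ⟨j, hij, y, hy, hyp⟩ := h
    obtain ⟨w, -, -, hg⟩ := hW.face i j hij p hp y hy hyp
    exact Or.inl ((hC.isBodyAt (hc i)).inter_coneAt_eq_sectorTriangle hpos hg)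
  · push Not at h
    have hDb : IsBodyAt D (c i) := ⟨hD, hD', interior_mono hCD (hc i)⟩
    have hg := hC.gaugeAt_eq_of_no_contact (hc i) hDb hCD hDC hpos h
    rcases (hC.isBodyAt (hc i)).inter_coneAt_eq_or hDb hpos hg with h1 | ⟨h1, h2⟩
    · exact Or.inl h1
    · exact Or.inr ⟨_, h1, IsBodyAt.disjoint_interior_coneTriangle_sectorCap hpos _ _, h2⟩

/-- The sectors of a packing of the plane meet face to face. -/
theorem isExtreme_inter [Finite ι] (hW : IsSubordinateFan C c W) (hC : IsConvexPacking C)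
    (hc : ∀ i, c i ∈ interior (C i)) (hU : (⋃ i, C i) = univ) {i j : ι} {p q : Plane × Plane}
    (hp : p ∈ W i) (hq : q ∈ W j) (hne : (⟨i, p⟩ : (_ : ι) × (Plane × Plane)) ≠ ⟨j, q⟩) :
    IsExtreme ℝ (C i ∩ coneAt (c i) p)
      (C i ∩ coneAt (c i) p ∩ (C j ∩ coneAt (c j) q)) := by
  have hpos := hW.pos i p hp
  have hB := hC.isBodyAt (hc i)
  refine ⟨inter_subset_left, ?_⟩
  rintro x1 ⟨hx1, hx1p⟩ x2 ⟨hx2, hx2p⟩ z ⟨⟨hz, hzp⟩, hzj, hzq⟩ ⟨α, β, hα, hβ, hαβ, hzeq⟩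
  refine ⟨⟨hx1, hx1p⟩, ?_⟩
  have hz' : α • (x1 - c i) + β • (x2 - c i) = z - c i := by
    have : c i = (α + β) • c i := by rw [hαβ, one_smul]
    rw [← hzeq]
    conv_rhs => rw [this]
    module
  by_cases hij : i = j
  · subst hij
    have hpq : p ≠ q := fun h => hne (by rw [h])
    obtain ⟨r, hr, hr'⟩ := eq_smul_of_combo_notMem_openCone hpos hx1p hx2p hα hβ (fun h =>
      Set.disjoint_left.1 (hW.disjoint i p hp q hq hpq) (hz' ▸ h) hzq)
    refine ⟨hx1, ?_⟩
    change x1 - c i ∈ closedCone q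
    rw [hr', hz']
    exact smul_mem_closedCone hzq hr
  have hgz : gaugeAt (C i) (c i) (z - c i) = 1 := hC.gaugeAt_eq_one hij (hc i) ⟨hz, hzj⟩
  have heq : ∀ u v : ℝ, u ≤ 1 → v ≤ 1 → α * u + β * v = 1 → u = 1 := by
    intro u v hu hv huv
    by_contra h0
    have h1 := mul_pos hα (sub_pos.2 (lt_of_le_of_ne hu h0))
    have h2 := mul_nonneg hβ.le (sub_nonneg.2 hv)
    linarith
  by_cases hzo : z - c i ∈ openCone p
  swap
  -- Here `z` is on a side of the cone and on the boundary of `C i`, so it is a vertex of the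
  -- sector: `x1` and `x2` lie on the same ray with gauge at most `1`, and both equal `z`.
  · rw [← hz'] at hzo
    obtain ⟨r, hr, hr'⟩ := eq_smul_of_combo_notMem_openCone hpos hx1p hx2p hα hβ hzo
    obtain ⟨t, ht, ht'⟩ := eq_smul_of_combo_notMem_openCone hpos hx2p hx1p hβ hα
      (by rwa [add_comm])
    rw [add_comm (β • _)] at ht'
    rw [hz'] at hr' ht'
    have h1 := (hB.mem_iff x1).1 hx1
    have h2 := (hB.mem_iff x2).1 hx2
    rw [hr', gaugeAt_smul _ _ _ hr, hgz, mul_one] at h1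
    rw [ht', gaugeAt_smul _ _ _ ht, hgz, mul_one] at h2
    have h3 := congrArg (gaugeAt (C i) (c i)) hz'
    rw [hr', ht', smul_smul, smul_smul, ← add_smul, gaugeAt_smul _ _ _ (by positivity), hgz,
      mul_one] at h3
    rw [heq r t h1 h2 h3, one_smul, sub_left_inj] at hr'
    rw [hr']
    exact ⟨hzj, hzq⟩
  -- Without a contact in the open cone the gauge would vanish there, but it is `1` at `z`. So a
  -- contact spans the sector, and `z`, which is not one of its ends, lies in no third member: the
  -- contact is with `j`.
  obtain ⟨k, hik, y, hy, hyp⟩ : ∃ k, Contact C i k ∧ ∃ x ∈ C i ∩ C k, x - c i ∈ openCone p := by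
    by_contra h
    push Not at h
    have hg := hC.gaugeAt_eq_of_no_contact (hc i) (D := univ)
      ⟨isClosed_univ, convex_univ, by simp⟩ (subset_univ _) hU.ge hpos h _ hzp
    rw [gaugeAt_univ, hgz] at hg
    exact zero_ne_one hg
  obtain ⟨w, hwC, hwσ, hg⟩ := hW.face i k hik p hp y hy hyp
  have hwz : planeCross w (z - c i) = 1 := by rw [← hg _ hzp, hgz]
  have hzk := hwσ _ hzp hwz
  rw [add_sub_cancel] at hzk
  obtain rfl : j = k := (hC.eq_of_mem_of_notMem_extremePoints hik.1 hzk
    (hW.notMem_extremePoints i k hik p hp z hzk hzo) hzj).resolve_left (Ne.symm hij)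
  have hwx : planeCross w (x1 - c i) = 1 := by
    refine heq _ _ (hwC _ hx1) (hwC _ hx2) ?_
    rw [← hwz, ← hz', planeCross_add_right, planeCross_smul_right, planeCross_smul_right]
  have hx1j := hwσ _ hx1p hwx
  rw [add_sub_cancel] at hx1j
  refine ⟨hx1j.2, ?_⟩
  by_contra hx1q
  -- If the segment from `z` to `x1` left the cone `q`, it would do so at a point `e ≠ x1`, which is
  -- still in the open cone `p`. The fans subdivide the contact alike, so `e` would be interior to
  -- the cone `q`.
  obtain ⟨e, he, heT, heI⟩ := (convex_segment z x1).isPreconnected.exists_mem_diff_interior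
    (isClosed_coneAt (c j) q) (left_mem_segment ℝ z x1) hzq (right_mem_segment ℝ z x1) hx1q
  have hemem := ((hC.convex i).inter (hC.convex j)).segment_subset hzk hx1j he
  obtain ⟨s, t, hs, ht, hst, rfl⟩ := he
  have hs0 : 0 < s := by
    refine lt_of_le_of_ne hs ?_
    rintro rfl
    rw [zero_add] at hst
    rw [hst, zero_smul, one_smul, zero_add] at heT
    exact hx1q heT
  have heo : s • z + t • x1 - c i ∈ openCone p := by
    have h1 : s • z + t • x1 - c i = s • (z - c i) + t • (x1 - c i) := by
      have : c i = (s + t) • c i := by rw [hst, one_smul]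
      conv_lhs => rw [this]
      module
    rw [h1]
    exact combo_mem_openCone hzo hx1p hs0 ht
  refine heI (interior_maximal ?_ (isOpen_openConeAt (c j) q)
    (hW.mem_openCone i j hik p hp q hq _ hemem heo heT))
  exact fun x hx => openCone_subset_closedCone q hx

end IsConvexPacking.IsSubordinateFan

/-- A packing refining `D`, together with fans that are subordinate to it. -/
theorem IsConvexPseudoDisks.exists_packing_fan {m : ℕ} {D : Fin m → Set Plane}
    (hD : IsConvexPseudoDisks D) :
    ∃ (s : Finset (Fin m)) (C : s → Set Plane) (c : s → Plane) (W : s → Finset (Plane × Plane)),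
      IsConvexPacking C ∧ (∀ i : s, C i ⊆ D i) ∧ (⋃ i, C i) = ⋃ i, D i ∧
      (∀ i, c i ∈ interior (C i)) ∧ IsConvexPacking.IsSubordinateFan C c W ∧
      (Finset.univ.sigma W).card ≤ 148 * m := by
  obtain ⟨s, C, hC, hCD, hU⟩ := hD.exists_packing
  choose c hc using hC.interior_nonempty
  obtain ⟨W, hW, hcard⟩ := hC.exists_isSubordinateFan c hc
  refine ⟨s, C, c, W, hC, hCD, hU, hc, hW, ?_⟩
  rw [Finset.card_sigma]
  refine hcard.trans (Nat.mul_le_mul_left _ ?_)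
  rw [Fintype.card_coe]
  exact (Finset.card_le_univ s).trans (Fintype.card_fin m).le

/-- The triangles are the sectors, at most `148 * m` of them, with at most three vertices each. -/
theorem IsConvexPseudoDisks.exists_isPlaneTriangulation {m : ℕ} {D : Fin m → Set Plane}
    (hD : IsConvexPseudoDisks D) (hU : (⋃ i, D i) = univ) :
    ∃ (V : Finset Plane) (T : Finset (Set Plane)), V.card ≤ 444 * m ∧ T.card ≤ 148 * m ∧
      IsPlaneTriangulation V T ∧ ∀ Δ ∈ T, ∃ i, Δ ⊆ D i := by
  classical
  obtain ⟨s, C, c, W, hC, hCD, hUC, hc, hW, hcard⟩ := hD.exists_packing_fan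
  rw [hU] at hUC
  let f : (_ : s) × (Plane × Plane) → Set Plane := fun n => C n.1 ∩ coneAt (c n.1) n.2
  let T := (Finset.univ.sigma W).image f
  have hT : ∀ Δ ∈ T, ∃ i, ∃ p ∈ W i, Δ = C i ∩ coneAt (c i) p := by
    intro Δ hΔ
    obtain ⟨⟨i, p⟩, hn, rfl⟩ := Finset.mem_image.1 hΔ
    exact ⟨i, p, (Finset.mem_sigma.1 hn).2, rfl⟩
  have htri : ∀ Δ ∈ T, IsTriangle Δ := by
    intro Δ hΔ
    obtain ⟨i, p, hp, rfl⟩ := hT Δ hΔ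
    rw [hW.sector_eq_of_iUnion_eq_univ hC hc hUC hp]
    exact isTriangle_sectorTriangle _ _ (hW.pos i p hp)
  have hTcard : T.card ≤ 148 * m := Finset.card_image_le.trans hcard
  have hS : ∀ Δ : Set Plane, ∃ S : Finset Plane,
      Δ ∈ T → S.card ≤ 3 ∧ (S : Set Plane) = Δ.extremePoints ℝ := by
    intro Δ
    by_cases h : Δ ∈ T
    · obtain ⟨S, hS⟩ := (htri Δ h).exists_finset_extremePoints
      exact ⟨S, fun _ => hS⟩
    · exact ⟨∅, fun h' => absurd h' h⟩
  choose S hS using hS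
  refine ⟨T.biUnion S, T, ?_, hTcard, ⟨htri, ?_, ?_, ?_, ?_⟩, ?_⟩
  · have := Finset.card_biUnion_le_card_mul T S 3 fun Δ hΔ => (hS Δ hΔ).1
    omega
  · rw [Finset.coe_biUnion]
    exact iUnion₂_congr fun Δ hΔ => (hS Δ hΔ).2
  · intro Δ hΔ Δ' hΔ' hne
    obtain ⟨i, p, hp, rfl⟩ := hT Δ hΔ
    obtain ⟨j, q, hq, rfl⟩ := hT Δ' hΔ'
    exact hW.disjoint_interior_sectors hC hp hq fun h => hne (congrArg f h)
  · intro Δ hΔ Δ' hΔ' hne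
    obtain ⟨i, p, hp, rfl⟩ := hT Δ hΔ
    obtain ⟨j, q, hq, rfl⟩ := hT Δ' hΔ'
    refine ⟨hW.isExtreme_inter hC hc hUC hp hq fun h => hne (congrArg f h), ?_⟩
    rw [inter_comm (C i ∩ _)]
    exact hW.isExtreme_inter hC hc hUC hq hp fun h => hne (congrArg f h).symm
  · refine eq_univ_of_forall fun x => ?_
    have hx : x ∈ ⋃ i, ⋃ p ∈ W i, C i ∩ coneAt (c i) p := by
      rw [hW.iUnion_sectors, hUC]; trivial
    obtain ⟨i, hx⟩ := mem_iUnion.1 hx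
    obtain ⟨p, hp, hx⟩ := mem_iUnion₂.1 hx
    exact mem_iUnion₂.2 ⟨f ⟨i, p⟩, Finset.mem_image_of_mem f (by simpa using hp), hx⟩
  · intro Δ hΔ
    obtain ⟨i, p, hp, rfl⟩ := hT Δ hΔ
    exact ⟨i, inter_subset_left.trans (hCD i)⟩

/-- Each sector contributes a triangle and at most one cap, hence the constant `2 * 148`. -/
theorem IsConvexPseudoDisks.exists_isConfinedTriangulation {m : ℕ} {D : Fin m → Set Plane}
    (hD : IsConvexPseudoDisks D) :
    ∃ P : Finset (Set Plane), P.card ≤ 296 * m ∧ IsConfinedTriangulation D P := by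
  classical
  obtain ⟨s, C, c, W, hC, hCD, hUC, hc, hW, hcard⟩ := hD.exists_packing_fan
  have hDC : ∀ i, D i ⊆ ⋃ j, C j := fun i => hUC ▸ subset_iUnion D i
  have hsplit : ∀ n : (_ : s) × (Plane × Plane), ∃ P : Finset (Set Plane), n.2 ∈ W n.1 →
      P.card ≤ 2 ∧ (∀ A ∈ P, IsTriangle A ∨ IsCap (D n.1) A) ∧
      (P : Set (Set Plane)).PairwiseDisjoint interior ∧
      (⋃ A ∈ P, A) = C n.1 ∩ coneAt (c n.1) n.2 := by
    rintro ⟨i, p⟩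
    by_cases hp : p ∈ W i
    swap
    · exact ⟨∅, fun h => absurd h hp⟩
    have htri := isTriangle_sectorTriangle (C i) (c i) (hW.pos i p hp)
    rcases hW.sector_eq_or hC hc (hD.isClosed i) (hD.convex i) (hCD i) (hDC i) hp with
      h | ⟨A, hA, hdis, h⟩
    · refine ⟨{sectorTriangle (C i) (c i) p}, fun _ => ⟨by simp, ?_, by simp, by simp [h]⟩⟩
      rintro A hA
      rw [Finset.mem_singleton] at hA
      exact Or.inl (hA ▸ htri)
    · refine ⟨{sectorTriangle (C i) (c i) p, A}, fun _ => ⟨Finset.card_le_two, ?_, ?_, ?_⟩⟩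
      · intro B hB
        rcases Finset.mem_insert.1 hB with rfl | hB
        · exact Or.inl htri
        · rw [Finset.mem_singleton] at hB
          exact Or.inr (hB ▸ hA)
      · rw [Finset.coe_insert, Finset.coe_singleton]
        exact pairwise_pair_of_symm.2 fun _ => hdis
      · rw [Finset.set_biUnion_insert, Finset.set_biUnion_singleton]
        exact h.symm
  choose P hP using hsplit
  have hmem : ∀ n ∈ Finset.univ.sigma W, n.2 ∈ W n.1 := fun n hn => (Finset.mem_sigma.1 hn).2
  have hsub : ∀ n ∈ Finset.univ.sigma W, ∀ A ∈ P n, A ⊆ C n.1 ∩ coneAt (c n.1) n.2 := by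
    intro n hn A hA
    rw [← (hP n (hmem n hn)).2.2.2]
    exact subset_iUnion₂ (s := fun A _ => A) A hA
  refine ⟨(Finset.univ.sigma W).biUnion P, ?_, ?_, ?_, ?_, ?_⟩
  · have := Finset.card_biUnion_le_card_mul (Finset.univ.sigma W) P 2
      fun n hn => (hP n (hmem n hn)).1
    omega
  · intro A hA
    obtain ⟨n, hn, hA⟩ := Finset.mem_biUnion.1 hA
    exact ((hP n (hmem n hn)).2.1 A hA).imp_right fun h => ⟨n.1, h⟩
  · intro A hA
    obtain ⟨n, hn, hA⟩ := Finset.mem_biUnion.1 hA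
    exact ⟨n.1, (hsub n hn A hA).trans (inter_subset_left.trans (hCD n.1))⟩
  · intro A hA B hB hne
    obtain ⟨n, hn, hA⟩ := Finset.mem_biUnion.1 hA
    obtain ⟨k, hk, hB⟩ := Finset.mem_biUnion.1 hB
    by_cases hnk : n = k
    · subst hnk
      exact (hP n (hmem n hn)).2.2.1 hA hB hne
    · exact (hW.disjoint_interior_sectors hC (hmem n hn) (hmem k hk) hnk).mono
        (interior_mono (hsub n hn A hA)) (interior_mono (hsub k hk B hB))
  · rw [← hUC, ← hW.iUnion_sectors]
    apply subset_antisymm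
    · refine iUnion₂_subset fun A hA => ?_
      obtain ⟨n, hn, hA⟩ := Finset.mem_biUnion.1 hA
      exact (hsub n hn A hA).trans fun x hx =>
        mem_iUnion.2 ⟨n.1, mem_iUnion₂.2 ⟨n.2, hmem n hn, hx⟩⟩
    · intro x hx
      obtain ⟨i, hx⟩ := mem_iUnion.1 hx
      obtain ⟨p, hp, hx⟩ := mem_iUnion₂.1 hx
      rw [← (hP ⟨i, p⟩ hp).2.2.2] at hx
      obtain ⟨A, hA, hx⟩ := mem_iUnion₂.1 hx
      exact mem_iUnion₂.2 ⟨A, Finset.mem_biUnion.2 ⟨⟨i, p⟩, by simpa using hp, hA⟩, hx⟩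

theorem mainTheorem3 :
    ∃ K : ℕ, ∀ (m : ℕ) (D : Fin m → Set Plane), IsConvexPseudoDisks D →
      (3 ≤ m → (⋃ i, D i) = univ →
        ∃ (V : Finset Plane) (T : Finset (Set Plane)),
          V.card ≤ K * m ∧ T.card ≤ K * m ∧ IsPlaneTriangulation V T ∧
          ∀ Δ ∈ T, ∃ i, Δ ⊆ D i) ∧
      ((⋃ i, D i) ≠ univ →
        ∃ P : Finset (Set Plane), P.card ≤ K * m ∧ IsConfinedTriangulation D P) := by
  refine ⟨444, fun m D hD => ⟨fun _ hU => ?_, fun _ => ?_⟩⟩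
  · obtain ⟨V, T, hV, hT, h⟩ := hD.exists_isPlaneTriangulation hU
    exact ⟨V, T, hV, hT.trans (Nat.mul_le_mul_right m (by norm_num)), h⟩
  · obtain ⟨P, hP, h⟩ := hD.exists_isConfinedTriangulation
    exact ⟨P, hP.trans (Nat.mul_le_mul_right m (by norm_num)), h⟩
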